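/- **Theorem 2.1 (Positive definite Hessian).** Let $d\ge 1$ and let $\Omega\subset\mathbb R^d$ be a polyhedral domain: a nonempty connected open set that is the interior of its closure and whose closure is a finite union of closed $d$-simplices. Let $\hat K$ be a reference $d$-simplex with $|\hat K|=1$. Let $\mathcal L v=-\nabla\cdot(A\nabla v)+b\cdot\nabla v+cv$ with $A,b,c\in L^\infty(\Omega)$ be elliptic: $A$ is uniformly positive definite, and the bilinear form $a(v,w)=\int_\Omega (A\nabla v\cdot\nabla w+(b\cdot\nabla v)\,w+c\,v\,w)\,dx$ is coercive on $H^1_0(\Omega)$. Then there is a constant $C>0$, depending only on $d$, $\hat K$, $\Omega$ and $\mathcal L$, such that the following holds. Let $f\in L^2(\Omega)$, let $g$ be a function on $\partial\Omega$, and let $u\in H^2(\Omega)$ be a solution of $$\mathcal L u=f \text{ in } \Omega,\qquad u=g \text{ on } \partial\Omega,$$ that is, $a(u,\varphi)=\int_\Omega f\varphi\,dx$ for all $\varphi\in C_c^\infty(\Omega)$ and $u(x)\to g(z)$ as $\Omega\ni x\to z$ for every $z\in\partial\Omega$. Let $H$ be the (weak) Hessian of $u$, and assume that it is uniformly positive definite: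 $H(x)\ge\gamma I$ for a.e. $x\in\Omega$, with some $\gamma>0$ (for symmetric matrices, $\ge$ means that the difference is positive semidefinite). Let $\mathcal T_h$ be a conforming simplicial mesh of $\Omega$ with $N$ elements, let $F_K$ be an affine map of $\hat K$ onto $K$ with Jacobian matrix $F_K'$, for every $K\in\mathcal T_h$, and let $u_h$ be a linear finite element solution on $\mathcal T_h$: $u_h$ is continuous and piecewise affine, $u_h=g$ at the mesh vertices on $\partial\Omega$, and $a(u_h,v_h)=\int_\Omega f v_h\,dx$ for all continuous piecewise affine $v_h$ that vanish on $\partial\Omega$. Let $R$ be an integrable symmetric-matrix-valued function (the recovered Hessian), uniformly positive definite in $\Omega$, and let $R_K=\frac1{|K|}\int_K R\,dx$ be its average over $K$. Assume that, with element-wise constants $C_{R-,K}$, $C_{R+,K}$ and constants $C_{R-},C_{R+}>0$, $$C_{R-,K}\,I\le R_K^{-1}H(x)\le C_{R+,K}\,I\qquad\text{for a.e. } x\in K \text{ and all } K\in\mathcal T_h$$ (that is, the eigenvalues of $R_K^{-1}H(x)$ lie in $[C_{R-,K},C_{R+,K}]$), and $$C_{R-}\le\min_{K}C_{R-,K},\qquad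 \sqrt{\frac1N\sum_{K}C_{R+,K}^2}\le C_{R+}.$$ Assume finally that the mesh is quasi-$M$-uniform for the metric tensor $$M_K=\det(R_K)^{-\frac1{d+2}}\,\|R_K\|_2^{\frac2{d+2}}\,R_K,$$ that is, for some constants $C_{eq},C_{ali}\ge1$ and all $K\in\mathcal T_h$, $$|K|\det(M_K)^{\frac12}\le \frac{C_{eq}}{N}\sum_{\tilde K\in\mathcal T_h}|\tilde K|\det(M_{\tilde K})^{\frac12},\qquad \frac1d\operatorname{tr}\bigl((F_K')^TM_KF_K'\bigr)\le C_{ali}\,|K|^{\frac2d}\det(M_K)^{\frac1d}.$$ Then $$|u-u_h|_{H^1(\Omega)}\le C\; C_{ali}^{\frac{d+1}2}\,C_{eq}^{\frac{d+2}{2d}}\,\frac{C_{R+}}{C_{R-}}\,N^{-\frac1d}\,\bigl\|\det(H)^{\frac1d}H\bigr\|_{L^{\frac d{d+2}}(\Omega)}^{\frac12},$$ where $|\cdot|_{H^1(\Omega)}$ is the $L^2(\Omega)$ norm of the gradient, and the last norm is $\bigl(\int_\Omega\|\det(H)^{1/d}H\|_2^{d/(d+2)}dx\bigr)^{(d+2)/d}$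 with the spectral norm $\|\cdot\|_2$. -/

import Mathlib

open MeasureTheory Set Filter Topology
open scoped Matrix ContDiff ENNReal Matrix.Norms.L2Operator

noncomputable section

/-- `ℝᵈ` with the Euclidean norm. -/
abbrev Euc (d : ℕ) : Type := EuclideanSpace ℝ (Fin d)

/-! ### Simplices, polyhedral domains, simplicial meshes -/

/-- `s` is the vertex set of a nondegenerate `d`-simplex in `ℝᵈ`. -/
def IsSimplex {d : ℕ} (s : Finset (Euc d)) : Prop :=
  s.card = d + 1 ∧ AffineIndependent ℝ ((↑) : s → Euc d)

/-- The closed simplex with vertex set `s`. -/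
def cell {d : ℕ} (s : Finset (Euc d)) : Set (Euc d) := convexHull ℝ (s : Set (Euc d))

/-- A (bounded) polyhedral domain: a connected nonempty open set whose closure is a finite union of
closed simplices and which is the interior of its closure (no slits or punctures). -/
structure IsPolyhedralDomain {d : ℕ} (Ω : Set (Euc d)) : Prop where
  isOpen : IsOpen Ω
  isConnected : IsConnected Ω
  interior_closure : interior (closure Ω) = Ω
  polyhedral : ∃ S : Finset (Finset (Euc d)), (∀ s ∈ S, IsSimplex s) ∧
    closure Ω = ⋃ s ∈ S, cell s

/-- A conforming simplicial mesh of `Ω`; elements are given by their vertex sets. -/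
structure SimplicialMesh {d : ℕ} (Ω : Set (Euc d)) where
  elems : Finset (Finset (Euc d))
  isSimplex : ∀ s ∈ elems, IsSimplex s
  /-- Two elements meet in the (possibly empty) common face spanned by their common vertices. -/
  conforming : ∀ s ∈ elems, ∀ t ∈ elems,
    cell s ∩ cell t = convexHull ℝ ((s : Set (Euc d)) ∩ (t : Set (Euc d)))
  cover : closure Ω = ⋃ s ∈ elems, cell s

namespace SimplicialMesh

variable {d : ℕ} {Ω : Set (Euc d)}

/-- The number `N` of elements. -/
def numElems (T : SimplicialMesh Ω) : ℕ := T.elems.card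

/-- The mesh vertices. -/
def vertices (T : SimplicialMesh Ω) : Set (Euc d) := {z | ∃ s ∈ T.elems, z ∈ s}

/-- The linear finite element space: functions that are affine on every closed element (and hence
continuous on the closure of `Ω`). -/
def feSpace (T : SimplicialMesh Ω) : Set (Euc d → ℝ) :=
  {v | ∀ s ∈ T.elems, ∃ p : Euc d →ᵃ[ℝ] ℝ, EqOn v p (cell s)}

/-- The finite element functions that vanish on the boundary. -/
def feSpaceZero (T : SimplicialMesh Ω) : Set (Euc d → ℝ) :=
  {v | v ∈ T.feSpace ∧ ∀ x ∈ frontier Ω, v x = 0}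

/-- `F` assigns to every element an affine map of the reference simplex `Khat` onto that element. -/
def IsReferenceMap (T : SimplicialMesh Ω) (Khat : Finset (Euc d))
    (F : Finset (Euc d) → Euc d →ᵃ[ℝ] Euc d) : Prop :=
  ∀ s ∈ T.elems, F s '' cell Khat = cell s

end SimplicialMesh

/-- The (constant) Jacobian matrix of an affine map of `ℝᵈ`. -/
def jacobian {d : ℕ} (F : Euc d →ᵃ[ℝ] Euc d) : Matrix (Fin d) (Fin d) ℝ :=
  LinearMap.toMatrix (EuclideanSpace.basisFun (Fin d) ℝ).toBasis
    (EuclideanSpace.basisFun (Fin d) ℝ).toBasis F.linear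

/-! ### Weak derivatives -/

/-- Smooth functions with compact support in `Ω`. -/
def testFunctions {d : ℕ} (Ω : Set (Euc d)) : Set (Euc d → ℝ) :=
  {φ | ContDiff ℝ ∞ φ ∧ HasCompactSupport φ ∧ tsupport φ ⊆ Ω}

/-- `g` is the weak partial derivative `∂ᵢ f` in `Ω`. -/
def HasWeakPartial {d : ℕ} (Ω : Set (Euc d)) (i : Fin d) (f g : Euc d → ℝ) : Prop :=
  ∀ φ ∈ testFunctions Ω,
    ∫ x in Ω, f x * gradient φ x i = -∫ x in Ω, g x * φ x

/-- `u ∈ H²(Ω)` with weak gradient `Du` and weak Hessian `H`. -/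
structure IsH2 {d : ℕ} (Ω : Set (Euc d)) (u : Euc d → ℝ) (Du : Euc d → Euc d)
    (H : Euc d → Matrix (Fin d) (Fin d) ℝ) : Prop where
  memLp : MemLp u 2 (volume.restrict Ω)
  memLp_grad : ∀ i, MemLp (fun x => Du x i) 2 (volume.restrict Ω)
  memLp_hess : ∀ i j, MemLp (fun x => H x i j) 2 (volume.restrict Ω)
  weak_grad : ∀ i, HasWeakPartial Ω i u (fun x => Du x i)
  weak_hess : ∀ i j, HasWeakPartial Ω j (fun x => Du x i) (fun x => H x i j)

/-! ### The boundary value problem and its finite element discretization -/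

/-- The coefficients of the operator `ℒ u = -div (A ∇u) + b · ∇u + c u`. -/
structure SecondOrderOperator (d : ℕ) where
  A : Euc d → (Euc d →L[ℝ] Euc d)
  b : Euc d → Euc d
  c : Euc d → ℝ

/-- The bilinear form `∫_Ω (A ∇v · ∇w + (b · ∇v) w + c v w)` of the operator, where `Dv` is the
gradient of `v`, and `w` is differentiable almost everywhere. -/
def SecondOrderOperator.form {d : ℕ} (L : SecondOrderOperator d) (Ω : Set (Euc d))
    (v : Euc d → ℝ) (Dv : Euc d → Euc d) (w : Euc d → ℝ) : ℝ :=
  ∫ x in Ω, (inner ℝ (L.A x (Dv x)) (gradient w x) + inner ℝ (L.b x) (Dv x) * w x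
    + L.c x * v x * w x)

/-- `ℒ` is elliptic on `Ω`: its coefficients are bounded and measurable, its principal part is
uniformly elliptic and its bilinear form is `H¹₀(Ω)`-elliptic (coercivity is stated on the dense
subspace of test functions). -/
structure SecondOrderOperator.IsElliptic {d : ℕ} (L : SecondOrderOperator d)
    (Ω : Set (Euc d)) : Prop where
  memLp_A : MemLp L.A ∞ (volume.restrict Ω)
  memLp_b : MemLp L.b ∞ (volume.restrict Ω)
  memLp_c : MemLp L.c ∞ (volume.restrict Ω)
  uniformly_elliptic : ∃ θ > (0 : ℝ), ∀ᵐ x ∂(volume.restrict Ω), ∀ ξ : Euc d,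
    θ * ‖ξ‖ ^ 2 ≤ inner ℝ (L.A x ξ) ξ
  coercive : ∃ α > (0 : ℝ), ∀ φ ∈ testFunctions Ω,
    α * ∫ x in Ω, (φ x ^ 2 + ‖gradient φ x‖ ^ 2) ≤ L.form Ω φ (gradient φ) φ

/-- `u` (with weak gradient `Du`) solves `ℒ u = f` in `Ω` weakly, and `u = g` on `∂Ω`, the boundary
values being attained as limits from inside. -/
structure IsBVPSolution {d : ℕ} (L : SecondOrderOperator d) (Ω : Set (Euc d))
    (f g u : Euc d → ℝ) (Du : Euc d → Euc d) : Prop where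
  weak_form : ∀ φ ∈ testFunctions Ω, L.form Ω u Du φ = ∫ x in Ω, f x * φ x
  boundary : ∀ z ∈ frontier Ω, Tendsto u (𝓝[Ω] z) (𝓝 (g z))

/-- `uh` is a linear finite element solution of `ℒ u = f` in `Ω`, `u = g` on `∂Ω`: it interpolates
`g` at the boundary vertices and satisfies the Galerkin equations. Finite element functions are
differentiable off the element boundaries, hence almost everywhere. -/
structure IsFESolution {d : ℕ} (L : SecondOrderOperator d) {Ω : Set (Euc d)}
    (T : SimplicialMesh Ω) (f g uh : Euc d → ℝ) : Prop where
  mem : uh ∈ T.feSpace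
  boundary : ∀ z ∈ T.vertices, z ∈ frontier Ω → uh z = g z
  galerkin : ∀ v ∈ T.feSpaceZero, L.form Ω uh (gradient uh) v = ∫ x in Ω, f x * v x

/-! ### Metric tensor and quasi-`M`-uniform meshes -/

/-- The average of a matrix-valued function over an element. -/
def cellAverage {d : ℕ} (R : Euc d → Matrix (Fin d) (Fin d) ℝ) (s : Finset (Euc d)) :
    Matrix (Fin d) (Fin d) ℝ :=
  Matrix.of fun i j => ⨍ x in cell s, R x i j

/-- The metric tensor `det(S)^{-1/(d+2)} ‖S‖₂^{2/(d+2)} S`, with the spectral norm. -/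
def metricTensor {d : ℕ} (S : Matrix (Fin d) (Fin d) ℝ) : Matrix (Fin d) (Fin d) ℝ :=
  (S.det ^ (-(1 : ℝ) / (d + 2)) * ‖S‖ ^ ((2 : ℝ) / (d + 2))) • S

/-- The mesh is quasi-`M`-uniform for the elementwise metric tensor `M`, with equidistribution
constant `Ceq` and alignment constant `Cali`. -/
structure IsQuasiMUniform {d : ℕ} {Ω : Set (Euc d)} (T : SimplicialMesh Ω)
    (F : Finset (Euc d) → Euc d →ᵃ[ℝ] Euc d) (M : Finset (Euc d) → Matrix (Fin d) (Fin d) ℝ)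
    (Ceq Cali : ℝ) : Prop where
  one_le_Ceq : 1 ≤ Ceq
  one_le_Cali : 1 ≤ Cali
  equidistribution : ∀ s ∈ T.elems,
    volume.real (cell s) * (M s).det ^ ((1 : ℝ) / 2) ≤
      Ceq * (1 / (T.numElems : ℝ) *
        ∑ t ∈ T.elems, volume.real (cell t) * (M t).det ^ ((1 : ℝ) / 2))
  alignment : ∀ s ∈ T.elems,
    1 / (d : ℝ) * ((jacobian (F s))ᵀ * M s * jacobian (F s)).trace ≤
      Cali * volume.real (cell s) ^ ((2 : ℝ) / d) * (M s).det ^ ((1 : ℝ) / d)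

/-- The closeness condition `Cm I ≤ S⁻¹ H(x) ≤ Cp I` for almost every `x` in the element `s`.
For positive definite `S` and symmetric `H(x)` the matrix `S⁻¹ H(x)` is similar to the symmetric
matrix `S^{-1/2} H(x) S^{-1/2}`, and the inequalities are bounds on its eigenvalues. -/
def IsClose {d : ℕ} (S : Matrix (Fin d) (Fin d) ℝ) (H : Euc d → Matrix (Fin d) (Fin d) ℝ)
    (s : Finset (Euc d)) (Cm Cp : ℝ) : Prop :=
  ∀ᵐ x ∂(volume.restrict (cell s)), spectrum ℝ (S⁻¹ * H x) ⊆ Icc Cm Cp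

end

/-! The error is a quasi-optimality constant times an interpolation error, and the metric tensor is
built so that the interpolation error on an element is a power of the volume of that element in the
metric.

Quasi-optimality (`exists_quasi_optimality_constant`). Let `I` be the nodal interpolant of `u` and
`e = uh - I`. Since `e` vanishes on the boundary, Galerkin orthogonality gives `a(e, e) = a(u - I,
e)`, and coercivity with Young's inequality bounds `e` in `H¹` by `u - I`. Both the weak formulation
and coercivity are given for test functions only. They extend to `e` because its extension by zero
is Lipschitz, and soft thresholding followed by mollification turns it into test functions that
converge boundedly together with their gradients (`exists_testFunctions_tendsto`).

Interpolation (`exists_interpolant_error`). Write `b` for the upper closeness constant of an element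
`K`, `S` for the average `R_K` and `J` for the Jacobian. Closeness and positivity of the Hessian
give `0 ≤ H ≤ b S` almost everywhere on `K`. Mollification turns this into a pointwise Taylor
estimate at almost every `x`, with a remainder at each vertex `v` between `0` and `b` times the form
of `S` at `v - x`. In particular `u` has a continuous representative, so nodal values make sense.
The interpolant minus the Taylor polynomial at `x` is affine with values in `[0, E]` at the
vertices, hence on `K`, where `E` is `b tr(Jᵀ S J)` times the squared reference diameter. An affine
function with oscillation `E` has gradient at most `E ‖J⁻¹‖ / ρ`, where `ρ` is the radius of a ball
in the reference simplex, and `‖J⁻¹‖² ≤ ‖S‖ tr(Jᵀ S J)^(d-1) / det(Jᵀ S J)`.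

Metric. Alignment bounds the trace by the geometric mean of the eigenvalues of `Jᵀ S J`, so that
`|K|` times the squared gradient error is at most a constant times `b² Cali^(d+1) q_K^((d+2)/d)`,
with `q_K = |K| det(M_K)^(1/2)` (`volume_mul_trace_sq_mul_le`). Equidistribution bounds each `q_K`
by `Ceq Q / N`, where `Q` is their sum, and summation produces `N^(-2/d) Q^((d+2)/d)`
(`sum_element_bounds_le`). The lower closeness bound controls `Q^((d+2)/d)` by the norm of
`det(H)^(1/d) H` (`metric_sum_le_eLpNorm`). -/

/-! ### Quadratic forms of real matrices -/

/-- The quadratic form of a real square matrix. -/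
def quadForm {d : ℕ} (S : Matrix (Fin d) (Fin d) ℝ) (v : Euc d) : ℝ :=
  ∑ i, ∑ j, S i j * v i * v j

section QuadForm

variable {d : ℕ}

lemma quadForm_eq_dotProduct (S : Matrix (Fin d) (Fin d) ℝ) (v : Euc d) :
    quadForm S v = v.ofLp ⬝ᵥ S *ᵥ v.ofLp := by
  simp only [quadForm, dotProduct, Matrix.mulVec, Finset.mul_sum]
  refine Finset.sum_congr rfl fun i _ => Finset.sum_congr rfl fun j _ => ?_
  ring

lemma quadForm_sub (S T : Matrix (Fin d) (Fin d) ℝ) (v : Euc d) :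
    quadForm (S - T) v = quadForm S v - quadForm T v := by
  simp [quadForm, sub_mul, Finset.sum_sub_distrib]

lemma quadForm_smul (c : ℝ) (S : Matrix (Fin d) (Fin d) ℝ) (v : Euc d) :
    quadForm (c • S) v = c * quadForm S v := by
  simp [quadForm, Finset.mul_sum, mul_assoc]

lemma quadForm_one (v : Euc d) : quadForm 1 v = ‖v‖ ^ 2 := by
  rw [quadForm_eq_dotProduct, Matrix.one_mulVec, EuclideanSpace.norm_sq_eq]
  simp [dotProduct, sq]

lemma Matrix.PosSemidef.quadForm_nonneg {S : Matrix (Fin d) (Fin d) ℝ} (hS : S.PosSemidef)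
    (v : Euc d) : 0 ≤ quadForm S v := by
  rw [quadForm_eq_dotProduct]
  simpa using hS.dotProduct_mulVec_nonneg v.ofLp

lemma posSemidef_of_quadForm_nonneg {S : Matrix (Fin d) (Fin d) ℝ} (hS : S.IsHermitian)
    (h : ∀ v, 0 ≤ quadForm S v) : S.PosSemidef := by
  refine .of_dotProduct_mulVec_nonneg hS fun x => ?_
  simpa [quadForm_eq_dotProduct] using h (WithLp.toLp 2 x)

lemma quadForm_conj (S Q : Matrix (Fin d) (Fin d) ℝ) (v : Euc d) :
    quadForm (Qᵀ * S * Q) v = quadForm S (WithLp.toLp 2 (Q *ᵥ v.ofLp)) := by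
  simp only [quadForm_eq_dotProduct, ← Matrix.mulVec_mulVec]
  rw [Matrix.dotProduct_mulVec, Matrix.vecMul_transpose]

lemma quadForm_le_opNorm (S : Matrix (Fin d) (Fin d) ℝ) (v : Euc d) :
    quadForm S v ≤ ‖S‖ * ‖v‖ ^ 2 := by
  rw [quadForm_eq_dotProduct, ← Matrix.inner_toEuclideanCLM]
  calc _ ≤ ‖v‖ * ‖Matrix.toEuclideanCLM (𝕜 := ℝ) S v‖ := real_inner_le_norm _ _
    _ ≤ ‖v‖ * (‖S‖ * ‖v‖) := by
      gcongr
      exact ContinuousLinearMap.le_opNorm _ _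
    _ = _ := by ring

lemma Matrix.PosSemidef.exists_eq_transpose_mul_self {S : Matrix (Fin d) (Fin d) ℝ}
    (hS : S.PosSemidef) : ∃ Q : Matrix (Fin d) (Fin d) ℝ, S = Qᵀ * Q := by
  open scoped MatrixOrder in
  obtain ⟨Q, hQ⟩ := CStarAlgebra.nonneg_iff_eq_star_mul_self.mp hS.nonneg
  exact ⟨Q, by simpa [Matrix.star_eq_conjTranspose] using hQ⟩

/-- With `S = Qᵀ Q` the form at `v` is `‖Q v‖²`, so the hypothesis says `‖Q‖ ≤ √c`; the C*-identity
`‖Qᵀ Q‖ = ‖Q‖²` finishes. -/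
lemma opNorm_le_of_quadForm_le {S : Matrix (Fin d) (Fin d) ℝ} (hS : S.PosSemidef) {c : ℝ}
    (hc : 0 ≤ c) (h : ∀ v, quadForm S v ≤ c * ‖v‖ ^ 2) : ‖S‖ ≤ c := by
  obtain ⟨Q, rfl⟩ := hS.exists_eq_transpose_mul_self
  have h1 : ‖Qᵀ * Q‖ = ‖Q‖ * ‖Q‖ := by
    simpa using Matrix.l2_opNorm_conjTranspose_mul_self Q
  have h2 : ‖Q‖ ≤ √c := by
    rw [Matrix.cstar_norm_def]
    refine ContinuousLinearMap.opNorm_le_bound _ (Real.sqrt_nonneg _) fun v => ?_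
    have h3 := h v
    have h4 : quadForm (Qᵀ * Q) v = ‖Matrix.toEuclideanCLM (𝕜 := ℝ) Q v‖ ^ 2 := by
      have := quadForm_conj 1 Q v
      rw [Matrix.mul_one, quadForm_one] at this
      rw [this]
      rfl
    rw [h4] at h3
    calc _ = √(‖Matrix.toEuclideanCLM (𝕜 := ℝ) Q v‖ ^ 2) := (Real.sqrt_sq (norm_nonneg _)).symm
      _ ≤ √(c * ‖v‖ ^ 2) := Real.sqrt_le_sqrt h3
      _ = _ := by rw [Real.sqrt_mul hc, Real.sqrt_sq (norm_nonneg _)]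
  rw [h1]
  calc _ ≤ √c * √c := by gcongr
    _ = c := Real.mul_self_sqrt hc

lemma posSemidef_sub_smul_one_of_spectrum {G : Matrix (Fin d) (Fin d) ℝ} (hG : G.IsHermitian)
    {a : ℝ} (h : ∀ t ∈ spectrum ℝ G, a ≤ t) : (G - a • 1).PosSemidef := by
  rw [Matrix.posSemidef_iff_isHermitian_and_spectrum_nonneg]
  refine ⟨hG.sub ?_, ?_⟩
  · simp [Matrix.IsHermitian]
  · have := spectrum.sub_singleton_eq (R := ℝ) G a
    rw [Algebra.algebraMap_eq_smul_one] at this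
    rw [← this]
    rintro _ ⟨t, ht, s, rfl, rfl⟩
    simpa using h t ht

lemma posSemidef_smul_one_sub_of_spectrum {G : Matrix (Fin d) (Fin d) ℝ} (hG : G.IsHermitian)
    {b : ℝ} (h : ∀ t ∈ spectrum ℝ G, t ≤ b) : (b • 1 - G).PosSemidef := by
  have : (-G - (-b) • 1).PosSemidef := by
    refine posSemidef_sub_smul_one_of_spectrum hG.neg fun t ht => ?_
    rw [← spectrum.neg_eq] at ht
    have := h (-t) (by simpa using ht)
    linarith
  convert this using 1
  simp
  abel

/-- Every matrix `S⁻¹ H` with `S` positive definite and `H` symmetric is similar to a symmetric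
matrix `G` with `H = Qᵀ G Q`, where `S = Qᵀ Q`. -/
lemma Matrix.PosDef.exists_congr_spectrum {S H : Matrix (Fin d) (Fin d) ℝ} (hS : S.PosDef)
    (hH : H.IsHermitian) : ∃ Q G : Matrix (Fin d) (Fin d) ℝ, S = Qᵀ * Q ∧ G.IsHermitian ∧
      H = Qᵀ * G * Q ∧ spectrum ℝ G = spectrum ℝ (S⁻¹ * H) := by
  obtain ⟨Q, hQ⟩ := hS.posSemidef.exists_eq_transpose_mul_self
  have hdet : IsUnit Q.det := by
    have h1 := hS.det_pos
    rw [hQ, Matrix.det_mul, Matrix.det_transpose] at h1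
    exact isUnit_iff_ne_zero.2 fun h0 => by simp [h0] at h1
  have hdetT : IsUnit Qᵀ.det := by rwa [Matrix.det_transpose]
  have hQu : IsUnit Q := (Matrix.isUnit_iff_isUnit_det Q).2 hdet
  refine ⟨Q, (Qᵀ)⁻¹ * H * Q⁻¹, hQ, ?_, ?_, ?_⟩
  · have h1 : Hᵀ = H := by simpa [Matrix.IsHermitian] using hH
    have : ((Qᵀ)⁻¹ * H * Q⁻¹)ᵀ = (Qᵀ)⁻¹ * H * Q⁻¹ := by
      rw [Matrix.transpose_mul, Matrix.transpose_mul, h1, Matrix.transpose_nonsing_inv,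
        Matrix.transpose_nonsing_inv, Matrix.transpose_transpose, Matrix.mul_assoc]
    simpa [Matrix.IsHermitian] using this
  · calc H = (Qᵀ * (Qᵀ)⁻¹) * H * (Q⁻¹ * Q) := by
          rw [Matrix.mul_nonsing_inv _ hdetT, Matrix.nonsing_inv_mul _ hdet]; simp
      _ = _ := by simp only [Matrix.mul_assoc]
  · obtain ⟨U, rfl⟩ := hQu
    -- Conjugating `S⁻¹ H = Q⁻¹ Q⁻ᵀ H` by `Q` gives `Q⁻ᵀ H Q⁻¹`, which is `G`.
    rw [← spectrum.units_conjugate (R := ℝ) (a := S⁻¹ * H) (u := U)]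
    congr 1
    rw [hQ, Matrix.mul_inv_rev, Matrix.coe_units_inv]
    simp only [Matrix.mul_assoc]
    rw [Matrix.mul_nonsing_inv_cancel_left _ _ hdet]

/-- The substitution `w = Q v` turns the form of `S` into `‖w‖²` and the form of `H` into that of
the symmetric matrix `G`, whose eigenvalues are those of `S⁻¹ H`. -/
lemma quadForm_bounds_of_spectrum {S H : Matrix (Fin d) (Fin d) ℝ} (hS : S.PosDef)
    (hH : H.IsHermitian) {a b : ℝ} (h : spectrum ℝ (S⁻¹ * H) ⊆ Icc a b) (v : Euc d) :
    a * quadForm S v ≤ quadForm H v ∧ quadForm H v ≤ b * quadForm S v := by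
  obtain ⟨Q, G, hQ, hG, hHG, hsp⟩ := hS.exists_congr_spectrum hH
  rw [← hsp] at h
  have e1 : quadForm S v = quadForm 1 (WithLp.toLp 2 (Q *ᵥ v.ofLp)) := by
    rw [← quadForm_conj, Matrix.mul_one, ← hQ]
  have e2 : quadForm H v = quadForm G (WithLp.toLp 2 (Q *ᵥ v.ofLp)) := by
    rw [← quadForm_conj, ← hHG]
  have h1 := (posSemidef_sub_smul_one_of_spectrum hG fun t ht => (h ht).1).quadForm_nonneg
    (WithLp.toLp 2 (Q *ᵥ v.ofLp))
  have h2 := (posSemidef_smul_one_sub_of_spectrum hG fun t ht => (h ht).2).quadForm_nonneg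
    (WithLp.toLp 2 (Q *ᵥ v.ofLp))
  rw [quadForm_sub, quadForm_smul] at h1 h2
  rw [e1, e2]
  constructor <;> linarith

lemma pow_mul_det_le_of_spectrum {S H : Matrix (Fin d) (Fin d) ℝ} (hS : S.PosDef)
    (hH : H.IsHermitian) {a : ℝ} (ha : 0 ≤ a) (h : ∀ t ∈ spectrum ℝ (S⁻¹ * H), a ≤ t) :
    a ^ d * S.det ≤ H.det := by
  obtain ⟨Q, G, hQ, hG, hHG, hsp⟩ := hS.exists_congr_spectrum hH
  rw [← hsp] at h
  have h1 : a ^ d ≤ G.det := by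
    rw [hG.det_eq_prod_eigenvalues]
    calc a ^ d = ∏ _i : Fin d, a := by simp
      _ ≤ _ := Finset.prod_le_prod (fun _ _ => ha) fun i _ => by
        simpa using h _ (hG.eigenvalues_mem_spectrum_real i)
  calc a ^ d * S.det = a ^ d * (Q.det * Q.det) := by
        rw [hQ, Matrix.det_mul, Matrix.det_transpose]
    _ ≤ G.det * (Q.det * Q.det) := by gcongr; exact mul_self_nonneg _
    _ = H.det := by rw [hHG, Matrix.det_mul, Matrix.det_mul, Matrix.det_transpose]; ring

lemma Matrix.IsHermitian.quadForm_ge_of_eigenvalues {B : Matrix (Fin d) (Fin d) ℝ}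
    (hB : B.IsHermitian) {a : ℝ} (h : ∀ i, a ≤ hB.eigenvalues i) (v : Euc d) :
    a * ‖v‖ ^ 2 ≤ quadForm B v := by
  have h1 := (posSemidef_sub_smul_one_of_spectrum hB (a := a) fun t ht => by
    rw [hB.spectrum_real_eq_range_eigenvalues] at ht
    obtain ⟨i, rfl⟩ := ht
    exact h i).quadForm_nonneg v
  rw [quadForm_sub, quadForm_smul, quadForm_one] at h1
  linarith

lemma Matrix.PosSemidef.eigenvalues_le_trace {B : Matrix (Fin d) (Fin d) ℝ} (hB : B.PosSemidef)
    (i : Fin d) : hB.1.eigenvalues i ≤ B.trace := by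
  rw [hB.1.trace_eq_sum_eigenvalues]
  simp only [RCLike.ofReal_real_eq_id, id]
  exact Finset.single_le_sum (f := fun i => hB.1.eigenvalues i)
    (fun j _ => hB.eigenvalues_nonneg j) (Finset.mem_univ i)

lemma Matrix.PosSemidef.quadForm_le_trace {B : Matrix (Fin d) (Fin d) ℝ} (hB : B.PosSemidef)
    (v : Euc d) : quadForm B v ≤ B.trace * ‖v‖ ^ 2 := by
  have h1 := (posSemidef_smul_one_sub_of_spectrum hB.1 (b := B.trace) fun t ht => by
    rw [hB.1.spectrum_real_eq_range_eigenvalues] at ht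
    obtain ⟨i, rfl⟩ := ht
    exact hB.eigenvalues_le_trace i).quadForm_nonneg v
  rw [quadForm_sub, quadForm_smul, quadForm_one] at h1
  linarith

/-- The smallest eigenvalue is at least the determinant over a power of the trace. -/
lemma Matrix.PosDef.det_mul_norm_sq_le {B : Matrix (Fin d) (Fin d) ℝ} (hd : 1 ≤ d)
    (hB : B.PosDef) (v : Euc d) :
    B.det * ‖v‖ ^ 2 ≤ B.trace ^ (d - 1) * quadForm B v := by
  have : Nonempty (Fin d) := ⟨⟨0, hd⟩⟩
  have htr : 0 < B.trace := hB.trace_pos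
  -- The determinant is one eigenvalue times the `d - 1` others, each of which is at most the trace.
  have h1 : ∀ i, B.det / B.trace ^ (d - 1) ≤ hB.1.eigenvalues i := fun i => by
    rw [div_le_iff₀ (by positivity), hB.1.det_eq_prod_eigenvalues,
      ← Finset.mul_prod_erase _ _ (Finset.mem_univ i)]
    refine mul_le_mul_of_nonneg_left ?_ (hB.eigenvalues_pos i).le
    calc _ ≤ ∏ _j ∈ Finset.univ.erase i, B.trace :=
          Finset.prod_le_prod (fun j _ => (hB.eigenvalues_pos j).le)
            fun j _ => hB.posSemidef.eigenvalues_le_trace j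
      _ = _ := by simp
  have h2 := hB.1.quadForm_ge_of_eigenvalues h1 v
  rw [div_mul_eq_mul_div, div_le_iff₀ (by positivity)] at h2
  linarith

end QuadForm

/-! ### Algebra of the metric tensor -/

section MetricTensor

variable {d : ℕ}

lemma Matrix.PosDef.opNorm_pos {S : Matrix (Fin d) (Fin d) ℝ} (hd : 1 ≤ d) (hS : S.PosDef) :
    0 < ‖S‖ := by
  rw [norm_pos_iff]
  rintro rfl
  have : Nonempty (Fin d) := ⟨⟨0, hd⟩⟩
  simpa using hS.det_pos

/-- The bound for `‖J⁻¹‖²` in terms of the conjugated matrix `Jᵀ S J`. -/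
noncomputable def invJacobianBound (S J : Matrix (Fin d) (Fin d) ℝ) : ℝ :=
  ‖S‖ * (Jᵀ * S * J).trace ^ (d - 1) / (J.det ^ 2 * S.det)

lemma posDef_transpose_mul_mul {S J : Matrix (Fin d) (Fin d) ℝ} (hS : S.PosDef)
    (hJ : J.det ≠ 0) : (Jᵀ * S * J).PosDef := by
  have hps : (Jᵀ * S * J).PosSemidef := by
    simpa using hS.posSemidef.conjTranspose_mul_mul_same J
  rw [hps.posDef_iff_det_ne_zero, Matrix.det_mul, Matrix.det_mul, Matrix.det_transpose]
  have := hS.det_pos.ne'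
  simp [hJ, this]

lemma invJacobianBound_nonneg {S J : Matrix (Fin d) (Fin d) ℝ} (hS : S.PosDef)
    (hJ : J.det ≠ 0) : 0 ≤ invJacobianBound S J := by
  have h1 := (posDef_transpose_mul_mul hS hJ).posSemidef.trace_nonneg
  have h2 := hS.det_pos
  unfold invJacobianBound
  positivity

/-- The eigenvalue bound `Matrix.PosDef.det_mul_norm_sq_le` is applied to `Jᵀ S J`, whose form at
`v` is that of `S` at `J v`, hence at most `‖S‖ ‖J v‖²`. -/
lemma norm_sq_le_invJacobianBound_mul {S J : Matrix (Fin d) (Fin d) ℝ} (hd : 1 ≤ d)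
    (hS : S.PosDef) (hJ : J.det ≠ 0) (v : Euc d) :
    ‖v‖ ^ 2 ≤ invJacobianBound S J * ‖(WithLp.toLp 2 (J *ᵥ v.ofLp) : Euc d)‖ ^ 2 := by
  have hB := posDef_transpose_mul_mul hS hJ
  have h1 := hB.det_mul_norm_sq_le hd v
  have htr : 0 ≤ (Jᵀ * S * J).trace := hB.posSemidef.trace_nonneg
  have hdet : (Jᵀ * S * J).det = J.det ^ 2 * S.det := by
    rw [Matrix.det_mul, Matrix.det_mul, Matrix.det_transpose]; ring
  have hpos : 0 < J.det ^ 2 * S.det := by have := hS.det_pos; positivity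
  have h2 := quadForm_le_opNorm S (WithLp.toLp 2 (J *ᵥ v.ofLp))
  rw [quadForm_conj, hdet] at h1
  rw [invJacobianBound, div_mul_eq_mul_div, le_div_iff₀ hpos]
  calc _ = J.det ^ 2 * S.det * ‖v‖ ^ 2 := by ring
    _ ≤ _ := h1
    _ ≤ (Jᵀ * S * J).trace ^ (d - 1) *
        (‖S‖ * ‖(WithLp.toLp 2 (J *ᵥ v.ofLp) : Euc d)‖ ^ 2) := by gcongr
    _ = _ := by ring

/-- This is what the exponents of the metric tensor are chosen for. A scalar factor `μ` enters the
determinant as `μ^d`, and `1/2 - d/(2(d+2)) = 1/(d+2)`, so the volume density of the metric is a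
power of `det(S)^(1/d) ‖S‖`, the quantity by which the estimate measures the Hessian. -/
lemma mul_metricTensor_det_rpow {S : Matrix (Fin d) (Fin d) ℝ} (hd : 1 ≤ d) (hS : S.PosDef) :
    (metricTensor S).det ^ ((1 : ℝ) / 2) =
      (S.det ^ ((1 : ℝ) / d) * ‖S‖) ^ ((d : ℝ) / (d + 2)) := by
  have h1 := hS.det_pos
  have h2 := hS.opNorm_pos hd
  have hd0 : (0 : ℝ) < d := by exact_mod_cast hd
  rw [metricTensor, Matrix.det_smul, Fintype.card_fin, Real.mul_rpow (by positivity) h1.le,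
    ← Real.rpow_natCast, Real.mul_rpow (by positivity) (by positivity),
    Real.mul_rpow (by positivity) (by positivity), Real.mul_rpow (by positivity) (by positivity)]
  simp only [← Real.rpow_mul h1.le, ← Real.rpow_mul h2.le]
  rw [mul_right_comm, ← Real.rpow_add h1]
  congr 2
  · field_simp
    ring_nf
  · field_simp

/-- The alignment condition, with the scalar factor of the metric tensor removed. -/
lemma trace_le_of_alignment {S J : Matrix (Fin d) (Fin d) ℝ} (hd : 1 ≤ d) (hS : S.PosDef)
    {V Cali : ℝ} (h : 1 / (d : ℝ) * (Jᵀ * metricTensor S * J).trace ≤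
      Cali * V ^ ((2 : ℝ) / d) * (metricTensor S).det ^ ((1 : ℝ) / d)) :
    (Jᵀ * S * J).trace ≤ d * Cali * (V ^ ((2 : ℝ) / d) * S.det ^ ((1 : ℝ) / d)) := by
  have h1 := hS.det_pos
  have h2 := hS.opNorm_pos hd
  have hd0 : (0 : ℝ) < d := by exact_mod_cast hd
  rw [metricTensor] at h
  set μ : ℝ := S.det ^ (-(1 : ℝ) / (d + 2)) * ‖S‖ ^ ((2 : ℝ) / (d + 2)) with hμ
  have hμ0 : 0 < μ := by positivity
  have e1 : (Jᵀ * (μ • S) * J).trace = μ * (Jᵀ * S * J).trace := by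
    rw [Matrix.mul_smul, Matrix.smul_mul, Matrix.trace_smul, smul_eq_mul]
  have e2 : (μ • S).det ^ ((1 : ℝ) / d) = μ * S.det ^ ((1 : ℝ) / d) := by
    rw [Matrix.det_smul, Fintype.card_fin, Real.mul_rpow (by positivity) h1.le, ← Real.rpow_natCast,
      ← Real.rpow_mul hμ0.le, mul_one_div_cancel hd0.ne', Real.rpow_one]
  rw [e1, e2] at h
  rw [one_div, inv_mul_le_iff₀ hd0] at h
  refine le_of_mul_le_mul_left (h.trans_eq ?_) hμ0
  ring_nf

/-- The element contribution to the error is controlled by the element volume in the metric. -/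
lemma volume_mul_trace_sq_mul_le {S J : Matrix (Fin d) (Fin d) ℝ} (hd : 1 ≤ d) (hS : S.PosDef)
    {V Cali : ℝ} (hV : V = |J.det|) (hV0 : 0 < V)
    (h : 1 / (d : ℝ) * (Jᵀ * metricTensor S * J).trace ≤
      Cali * V ^ ((2 : ℝ) / d) * (metricTensor S).det ^ ((1 : ℝ) / d)) :
    V * (Jᵀ * S * J).trace ^ 2 * invJacobianBound S J ≤
      (d * Cali) ^ (d + 1) *
        (V * (metricTensor S).det ^ ((1 : ℝ) / 2)) ^ (((d : ℝ) + 2) / d) := by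
  have h1 := hS.det_pos
  have h2 := hS.opNorm_pos hd
  have hd0 : (0 : ℝ) < d := by exact_mod_cast hd
  have hJ : J.det ≠ 0 := by rw [← abs_pos, ← hV]; exact hV0
  have hB := posDef_transpose_mul_mul hS hJ
  have htr : 0 ≤ (Jᵀ * S * J).trace := hB.posSemidef.trace_nonneg
  have hτ := trace_le_of_alignment hd hS h
  set τ := (Jᵀ * S * J).trace with hτdef
  have hJV : J.det ^ 2 = V ^ 2 := by rw [hV, sq_abs]
  -- Since `V = |det J|`, `X` is the geometric mean of the eigenvalues of `Jᵀ S J`; alignment says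
  -- `τ ≤ d Cali X`.
  set X : ℝ := V ^ ((2 : ℝ) / d) * S.det ^ ((1 : ℝ) / d) with hX
  have hX0 : 0 < X := by positivity
  have hXd : X ^ d = V ^ 2 * S.det := by
    rw [hX, mul_pow, ← Real.rpow_natCast, ← Real.rpow_natCast, ← Real.rpow_mul hV0.le,
      ← Real.rpow_mul h1.le, div_mul_cancel₀ _ hd0.ne', div_mul_cancel₀ _ hd0.ne']
    simp
  -- The power `d + 1` consists of `2` from the squared interpolation error and `d - 1` from the
  -- bound for the inverse Jacobian.
  have e1 : V * τ ^ 2 * invJacobianBound S J = V * ‖S‖ * τ ^ (d + 1) / X ^ d := by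
    rw [invJacobianBound, hJV, hXd, ← hτdef]
    have : d + 1 = (d - 1) + 2 := by omega
    rw [this, pow_add]
    ring
  have e2 : (V * (metricTensor S).det ^ ((1 : ℝ) / 2)) ^ (((d : ℝ) + 2) / d) = V * ‖S‖ * X := by
    rw [mul_metricTensor_det_rpow hd hS, Real.mul_rpow hV0.le (by positivity),
      ← Real.rpow_mul (by positivity)]
    have : (d : ℝ) / (d + 2) * ((d + 2) / d) = 1 := by field_simp
    rw [this, Real.rpow_one, hX]
    have : ((d : ℝ) + 2) / d = 1 + 2 / d := by field_simp
    rw [this, Real.rpow_add hV0, Real.rpow_one]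
    ring
  rw [e1, e2, div_le_iff₀ (by positivity)]
  calc V * ‖S‖ * τ ^ (d + 1) ≤ V * ‖S‖ * (d * Cali * X) ^ (d + 1) := by gcongr
    _ = _ := by ring

/-- The comparison of the density of the metric with that of the Hessian. -/
lemma metric_density_le {S H : Matrix (Fin d) (Fin d) ℝ} (hd : 1 ≤ d) (hS : S.PosDef)
    (hH : H.IsHermitian) {a : ℝ} (ha : 0 < a) {b : ℝ} (h : spectrum ℝ (S⁻¹ * H) ⊆ Icc a b) :
    a ^ 2 * (S.det ^ ((1 : ℝ) / d) * ‖S‖) ≤ ‖H.det ^ ((1 : ℝ) / d) • H‖ := by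
  have h1 := hS.det_pos
  have hd0 : (0 : ℝ) < d := by exact_mod_cast hd
  have hdet := pow_mul_det_le_of_spectrum hS hH ha.le fun t ht => (h ht).1
  have hH0 : 0 < H.det := lt_of_lt_of_le (by positivity) hdet
  have e1 : a * S.det ^ ((1 : ℝ) / d) ≤ H.det ^ ((1 : ℝ) / d) := by
    calc a * S.det ^ ((1 : ℝ) / d) = (a ^ d * S.det) ^ ((1 : ℝ) / d) := by
          rw [Real.mul_rpow (by positivity) h1.le, ← Real.rpow_natCast, ← Real.rpow_mul ha.le,
            mul_one_div_cancel hd0.ne', Real.rpow_one]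
      _ ≤ _ := by gcongr
  -- The second factor `a` is gained here, from `a S ≤ H` as quadratic forms.
  have e2 : ‖S‖ ≤ ‖H‖ / a := by
    refine opNorm_le_of_quadForm_le hS.posSemidef (by positivity) fun v => ?_
    have h3 := (quadForm_bounds_of_spectrum hS hH h v).1
    have h4 := quadForm_le_opNorm H v
    rw [div_mul_eq_mul_div, le_div_iff₀ ha]
    linarith
  rw [le_div_iff₀ ha] at e2
  rw [norm_smul, Real.norm_of_nonneg (by positivity)]
  calc _ = (a * S.det ^ ((1 : ℝ) / d)) * (‖S‖ * a) := by ring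
    _ ≤ _ := by gcongr

end MetricTensor

/-! ### Simplices -/

section Simplex

variable {d : ℕ} {s : Finset (Euc d)}

/-- The affine basis formed by the vertices of a simplex. -/
noncomputable def IsSimplex.basis (hs : IsSimplex s) : AffineBasis s ℝ (Euc d) where
  toFun := (↑)
  ind' := hs.2
  tot' := by
    rw [hs.2.affineSpan_eq_top_iff_card_eq_finrank_add_one]
    simp [hs.1]

lemma IsSimplex.basis_apply (hs : IsSimplex s) (i : s) : hs.basis i = i := rfl

lemma IsSimplex.coord_of_ne (hs : IsSimplex s) {i : s} {v : Euc d} (hv : v ∈ s)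
    (h : (i : Euc d) ≠ v) : hs.basis.coord i v = 0 :=
  hs.basis.coord_apply_ne (i := i) (j := ⟨v, hv⟩) fun hi => h (congrArg Subtype.val hi)

lemma IsSimplex.range_basis (hs : IsSimplex s) : range hs.basis = (s : Set (Euc d)) := by
  ext x
  simp [IsSimplex.basis_apply]

lemma IsSimplex.cell_eq (hs : IsSimplex s) : cell s = {x | ∀ i, 0 ≤ hs.basis.coord i x} := by
  rw [cell, ← hs.range_basis, hs.basis.convexHull_eq_nonneg_coord]

lemma AffineBasis.apply_eq_sum_coord {ι : Type*} [Fintype ι] (b : AffineBasis ι ℝ (Euc d))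
    (p : Euc d →ᵃ[ℝ] ℝ) (x : Euc d) : p x = ∑ i, b.coord i x * p (b i) := by
  conv_lhs => rw [← b.affineCombination_coord_eq_self x]
  rw [Finset.map_affineCombination _ _ _ (b.sum_coord_apply_eq_one x),
    Finset.affineCombination_eq_linear_combination _ _ _ (b.sum_coord_apply_eq_one x)]
  simp

lemma IsSimplex.exists_affineMap (hs : IsSimplex s) (c : Euc d → ℝ) :
    ∃ p : Euc d →ᵃ[ℝ] ℝ, ∀ v ∈ s, p v = c v := by
  classical
  have hsum : ∀ (t : Finset s) (q : s → Euc d →ᵃ[ℝ] ℝ) (x : Euc d),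
      (∑ i ∈ t, q i) x = ∑ i ∈ t, q i x := fun t q x => by
    induction t using Finset.induction_on with
    | empty => simp
    | insert a t ha ih => simp [Finset.sum_insert ha, ih]
  refine ⟨∑ i : s, c i • hs.basis.coord i, fun v hv => ?_⟩
  rw [hsum]
  have : v = hs.basis ⟨v, hv⟩ := rfl
  rw [this]
  simp only [AffineMap.coe_smul, Pi.smul_apply, AffineBasis.coord_apply, smul_eq_mul]
  simp [hs.basis_apply]

lemma isCompact_cell (s : Finset (Euc d)) : IsCompact (cell s) :=
  s.finite_toSet.isCompact_convexHull ℝ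

lemma convex_cell (s : Finset (Euc d)) : Convex ℝ (cell s) := convex_convexHull ℝ _

lemma subset_cell (s : Finset (Euc d)) : (s : Set (Euc d)) ⊆ cell s := subset_convexHull ℝ _

lemma measurableSet_cell (s : Finset (Euc d)) : MeasurableSet (cell s) :=
  (isCompact_cell s).measurableSet

lemma volume_cell_lt_top (s : Finset (Euc d)) : volume (cell s) < ⊤ :=
  (isCompact_cell s).measure_lt_top

lemma IsSimplex.interior_cell_nonempty (hs : IsSimplex s) : (interior (cell s)).Nonempty := by
  rw [cell, interior_convexHull_nonempty_iff_affineSpan_eq_top]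
  simpa [hs.range_basis] using hs.basis.tot

lemma IsSimplex.closure_interior_cell (hs : IsSimplex s) :
    closure (interior (cell s)) = cell s := by
  rw [(convex_cell s).closure_interior_eq_closure_of_nonempty_interior hs.interior_cell_nonempty,
    (isCompact_cell s).isClosed.closure_eq]

lemma volume_frontier_cell (s : Finset (Euc d)) : volume (frontier (cell s)) = 0 :=
  (convex_cell s).addHaar_frontier _

lemma IsSimplex.volume_real_pos (hs : IsSimplex s) : 0 < volume.real (cell s) :=
  ENNReal.toReal_pos
    ((isOpen_interior.measure_pos _ hs.interior_cell_nonempty).trans_le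
      (measure_mono interior_subset)).ne' (volume_cell_lt_top s).ne

lemma volume_zeros_affineMap {p : Euc d →ᵃ[ℝ] ℝ} (hp : p.linear ≠ 0) :
    volume {x | p x = 0} = 0 := by
  rcases eq_empty_or_nonempty {x | p x = 0} with h | ⟨x₀, hx₀⟩
  · simp [h]
  have hx₀ : p x₀ = 0 := hx₀
  have hne : AffineSubspace.mk' x₀ (LinearMap.ker p.linear) ≠ ⊤ := fun h => hp <| by
    have := congrArg AffineSubspace.direction h
    rw [AffineSubspace.direction_mk', AffineSubspace.direction_top] at this
    exact LinearMap.ker_eq_top.1 this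
  refine measure_mono_null (fun x hx => ?_) (Measure.addHaar_affineSubspace volume _ hne)
  have hx : p x = 0 := hx
  simp only [SetLike.mem_coe, AffineSubspace.mem_mk', LinearMap.mem_ker]
  rw [AffineMap.linearMap_vsub, hx, hx₀]
  simp

lemma eqOn_convexHull_of_eqOn {p q : Euc d →ᵃ[ℝ] ℝ} {A : Set (Euc d)} (h : EqOn p q A) :
    EqOn p q (convexHull ℝ A) := by
  intro x hx
  have : convexHull ℝ A ⊆ (p - q) ⁻¹' {0} :=
    convexHull_min (fun v hv => by simp [h hv]) ((convex_singleton (0 : ℝ)).affine_preimage (p - q))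
  simpa [sub_eq_zero] using this hx

end Simplex

/-! ### Meshes -/

namespace SimplicialMesh

variable {d : ℕ} {Ω : Set (Euc d)} (T : SimplicialMesh Ω)

lemma isCompact_closure (T : SimplicialMesh Ω) : IsCompact (closure Ω) := by
  rw [T.cover]
  exact T.elems.isCompact_biUnion fun s _ => isCompact_cell s

lemma cell_subset_closure {s : Finset (Euc d)} (hs : s ∈ T.elems) : cell s ⊆ closure Ω := by
  rw [T.cover]
  exact subset_biUnion_of_mem (u := fun s => cell s) hs

lemma interior_cell_subset (hΩ : IsPolyhedralDomain Ω) {s : Finset (Euc d)} (hs : s ∈ T.elems) :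
    interior (cell s) ⊆ Ω := by
  rw [← hΩ.interior_closure]
  exact interior_mono (T.cell_subset_closure hs)

lemma exists_mem_cell {x : Euc d} (hx : x ∈ closure Ω) : ∃ s ∈ T.elems, x ∈ cell s := by
  rw [T.cover] at hx
  simpa using hx

lemma elems_nonempty (hΩ : IsPolyhedralDomain Ω) : T.elems.Nonempty := by
  obtain ⟨x, hx⟩ := hΩ.isConnected.nonempty
  obtain ⟨s, hs, -⟩ := T.exists_mem_cell (subset_closure hx)
  exact ⟨s, hs⟩

lemma numElems_pos (hΩ : IsPolyhedralDomain Ω) : 0 < T.numElems :=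
  Finset.card_pos.2 (T.elems_nonempty hΩ)

lemma ae_mem_interior_cell : ∀ᵐ x ∂(volume.restrict (closure Ω)),
    ∃ s ∈ T.elems, x ∈ interior (cell s) := by
  rw [ae_restrict_iff' isClosed_closure.measurableSet]
  have h : ∀ᵐ x, ∀ s ∈ T.elems, x ∉ frontier (cell s) :=
    (ae_ball_iff T.elems.countable_toSet).2 fun s _ =>
      measure_eq_zero_iff_ae_notMem.1 (volume_frontier_cell s)
  filter_upwards [h] with x hx hxΩ
  obtain ⟨s, hs, hxs⟩ := T.exists_mem_cell hxΩ
  refine ⟨s, hs, ?_⟩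
  by_contra hcon
  exact hx s hs ⟨subset_closure hxs, hcon⟩

/-- The boundary of `Ω` is a null set: almost every point of the closure is interior to some cell,
and such points are interior to the closure, that is, in `Ω`. -/
lemma closure_ae_eq (T : SimplicialMesh Ω) (hΩ : IsPolyhedralDomain Ω) : closure Ω =ᵐ[volume] Ω := by
  refine (LE.le.eventuallyLE subset_closure).antisymm ?_ |>.symm
  have h := T.ae_mem_interior_cell
  rw [ae_restrict_iff' isClosed_closure.measurableSet] at h
  filter_upwards [h] with x hx hxc
  obtain ⟨s, hs, hxs⟩ := hx hxc
  exact T.interior_cell_subset hΩ hs hxs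

lemma restrict_closure (T : SimplicialMesh Ω) (hΩ : IsPolyhedralDomain Ω) :
    volume.restrict (closure Ω) = volume.restrict Ω :=
  Measure.restrict_congr_set (T.closure_ae_eq hΩ)

/-- Two distinct elements have equally many vertices, so some vertex `v` of `s` is not in `t`. By
conformity the barycentric coordinate of `v` vanishes on the intersection, which is therefore
contained in a hyperplane. -/
lemma aedisjoint_cells : (T.elems : Set (Finset (Euc d))).Pairwise
    (Function.onFun (AEDisjoint volume) fun s => cell s) := by
  intro s hs t ht hst
  have hss := T.isSimplex s hs
  have hnot : ¬ s ⊆ t := fun h => hst <|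
    Finset.eq_of_subset_of_card_le h (by rw [hss.1, (T.isSimplex t ht).1])
  obtain ⟨v, hvs, hvt⟩ := Finset.not_subset.1 hnot
  let p := hss.basis.coord ⟨v, hvs⟩
  have hpv : p v = 1 := hss.basis.coord_apply_eq ⟨v, hvs⟩
  have hpw : ∀ w ∈ s, w ≠ v → p w = 0 := fun w hw hwv =>
    hss.basis.coord_apply_ne (i := ⟨v, hvs⟩) (j := ⟨w, hw⟩)
      (fun h => hwv (congrArg Subtype.val h).symm)
  have hsub : cell s ∩ cell t ⊆ {x | p x = 0} := by
    rw [T.conforming s hs t ht]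
    intro x hx
    have : EqOn p (0 : Euc d →ᵃ[ℝ] ℝ) (convexHull ℝ ((s : Set (Euc d)) ∩ t)) :=
      eqOn_convexHull_of_eqOn fun w hw => by
        simpa using hpw w hw.1 fun h => hvt (h ▸ hw.2)
    simpa using this hx
  -- A constant coordinate equals one everywhere, by its value at `v`, and then the intersection is
  -- empty.
  by_cases hlin : p.linear = 0
  · have hemp : cell s ∩ cell t = ∅ := by
      rw [eq_empty_iff_forall_notMem]
      intro x hx
      have h0 : p x = 0 := hsub hx
      have := p.linearMap_vsub v x
      rw [hlin, hpv, h0] at this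
      simp at this
    change volume (cell s ∩ cell t) = 0
    simp [hemp]
  · exact measure_mono_null hsub (volume_zeros_affineMap hlin)

lemma lintegral_eq_sum (hΩ : IsPolyhedralDomain Ω) (f : Euc d → ℝ≥0∞) :
    ∫⁻ x in Ω, f x = ∑ s ∈ T.elems, ∫⁻ x in cell s, f x := by
  rw [← T.restrict_closure hΩ, T.cover]
  exact lintegral_biUnion_finset₀ T.aedisjoint_cells
    (fun s _ => (measurableSet_cell s).nullMeasurableSet) _

lemma ae_restrict_cell_of_ae (hΩ : IsPolyhedralDomain Ω) {P : Euc d → Prop}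
    (h : ∀ᵐ x ∂(volume.restrict Ω), P x) {s : Finset (Euc d)} (hs : s ∈ T.elems) :
    ∀ᵐ x ∂(volume.restrict (cell s)), P x := by
  rw [← T.restrict_closure hΩ] at h
  exact ae_mono (Measure.restrict_mono (T.cell_subset_closure hs) le_rfl) h

end SimplicialMesh

/-! ### Reference maps -/

section ReferenceMap

variable {d : ℕ}

lemma toLp_jacobian_mulVec (F : Euc d →ᵃ[ℝ] Euc d) (v : Euc d) :
    (WithLp.toLp 2 (jacobian F *ᵥ v.ofLp) : Euc d) = F.linear v := by
  have h := LinearMap.toMatrix_mulVec_repr (EuclideanSpace.basisFun (Fin d) ℝ).toBasis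
    (EuclideanSpace.basisFun (Fin d) ℝ).toBasis F.linear v
  have hr : ∀ w : Euc d, ⇑((EuclideanSpace.basisFun (Fin d) ℝ).toBasis.repr w) = w.ofLp := fun w => by
    ext i
    simp [OrthonormalBasis.coe_toBasis_repr_apply]
  rw [hr, hr] at h
  rw [jacobian, h]

lemma det_jacobian (F : Euc d →ᵃ[ℝ] Euc d) : (jacobian F).det = LinearMap.det F.linear :=
  LinearMap.det_toMatrix _ _

lemma volume_image_affineMap (F : Euc d →ᵃ[ℝ] Euc d) (A : Set (Euc d)) :
    volume (F '' A) = ENNReal.ofReal |(jacobian F).det| * volume A := by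
  have h : F '' A = (fun x => F 0 + x) '' (F.linear '' A) := by
    rw [image_image]
    refine image_congr fun x _ => ?_
    have := congrFun F.decomp x
    simp only [Pi.add_apply] at this
    rw [this, add_comm]
  rw [h, image_add_left, measure_preimage_add, Measure.addHaar_image_linearMap, det_jacobian]

lemma volume_real_cell_eq {Khat s : Finset (Euc d)} (hvol : volume (cell Khat) = 1)
    {F : Euc d →ᵃ[ℝ] Euc d} (hF : F '' cell Khat = cell s) :
    volume.real (cell s) = |(jacobian F).det| := by
  rw [Measure.real, ← hF, volume_image_affineMap, hvol, mul_one,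
    ENNReal.toReal_ofReal (abs_nonneg _)]

end ReferenceMap

/-! ### Finite element functions with vanishing boundary values -/

namespace SimplicialMesh

variable {d : ℕ} {Ω : Set (Euc d)} (T : SimplicialMesh Ω)

/-- If an interior point `w` of `Ω` lies in the relative interior of the same mesh face as `x`, then
`x` is an interior point as well. The face is given by the positive barycentric coordinates. -/
lemma mem_of_same_face (hΩ : IsPolyhedralDomain Ω) {s : Finset (Euc d)} (hs : s ∈ T.elems)
    {x w : Euc d} (hw : w ∈ Ω) (hws : w ∈ cell s)
    (hxw : ∀ i, 0 < (T.isSimplex s hs).basis.coord i x → 0 < (T.isSimplex s hs).basis.coord i w)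
    (hwx : ∀ i, (T.isSimplex s hs).basis.coord i x = 0 → (T.isSimplex s hs).basis.coord i w = 0)
    (hxs : x ∈ cell s) : x ∈ Ω := by
  classical
  rw [← hΩ.interior_closure, mem_interior_iff_mem_nhds]
  -- The translation by `w - x` carries a neighbourhood of `x` to a neighbourhood of `w`. For `y`
  -- near `x` the translate lies in `Ω`, hence in some cell `t`, and `t` contains `w` because the
  -- cells that miss `w` stay away from it. It will follow that `y` itself lies in `t`, so `x` is
  -- interior to the closure.
  have htr : Tendsto (fun y => w + (y - x)) (𝓝 x) (𝓝 w) := by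
    have : Continuous fun y : Euc d => w + (y - x) := by fun_prop
    simpa using this.tendsto x
  have h1 : ∀ᶠ y in 𝓝 x, w + (y - x) ∈ Ω := htr (hΩ.isOpen.mem_nhds hw)
  have h2 : ∀ᶠ y in 𝓝 x, ∀ t ∈ T.elems, w ∉ cell t → w + (y - x) ∉ cell t := by
    rw [Filter.eventually_all_finset]
    intro t _
    by_cases hwt : w ∈ cell t
    · simp [hwt]
    · have : ∀ᶠ y in 𝓝 x, w + (y - x) ∈ (cell t)ᶜ :=
        htr ((isCompact_cell t).isClosed.isOpen_compl.mem_nhds hwt)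
      filter_upwards [this] with y hy _ using hy
  have h3 : ∀ᶠ y in 𝓝 x, ∀ t : T.elems, ∀ i,
      0 < (T.isSimplex t t.2).basis.coord i x → 0 < (T.isSimplex t t.2).basis.coord i y := by
    rw [eventually_all]
    intro t
    rw [eventually_all]
    intro i
    by_cases hpos : 0 < (T.isSimplex t t.2).basis.coord i x
    · have hc : Continuous ((T.isSimplex t t.2).basis.coord i) :=
        AffineMap.continuous_of_finiteDimensional _
      filter_upwards [hc.continuousAt.eventually (lt_mem_nhds hpos)] with y hy _ using hy
    · simp [hpos]
  filter_upwards [h1, h2, h3] with y hy1 hy2 hy3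
  obtain ⟨t, ht, hyt⟩ := T.exists_mem_cell (subset_closure hy1)
  have hwt : w ∈ cell t := by
    by_contra hcon
    exact hy2 t ht hcon hyt
  set bs := (T.isSimplex s hs).basis with hbs
  set bt := (T.isSimplex t ht).basis with hbt
  -- The vertices that carry `x` belong to `t`: `w` lies in the common face of `s` and `t` and has a
  -- positive coordinate at each of them.
  have hst : ∀ i : s, 0 < bs.coord i x → (i : Euc d) ∈ t := by
    intro i hi
    by_contra hit
    have hwin : w ∈ convexHull ℝ ((s : Set (Euc d)) ∩ t) := by
      rw [← T.conforming s hs t ht]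
      exact ⟨hws, hwt⟩
    have : EqOn (bs.coord i) (0 : Euc d →ᵃ[ℝ] ℝ) (convexHull ℝ ((s : Set (Euc d)) ∩ t)) :=
      eqOn_convexHull_of_eqOn fun v hv => by
        rw [hbs, (T.isSimplex s hs).coord_of_ne hv.1 fun h => hit (by rw [h]; exact hv.2)]
        rfl
    have h0 := this hwin
    have := hxw i hi
    simp only [AffineMap.coe_zero, Pi.zero_apply] at h0
    linarith
  have hxnn : ∀ i, 0 ≤ bs.coord i x := by
    have := hxs
    rw [(T.isSimplex s hs).cell_eq] at this
    exact this
  refine T.cell_subset_closure ht ?_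
  rw [(T.isSimplex t ht).cell_eq] at hyt ⊢
  intro k
  have hyt : 0 ≤ bt.coord k (w + (y - x)) := hyt k
  -- At a vertex that carries `x` the coordinate is positive at `x`, hence at the nearby `y`. Every
  -- other coordinate of `t` vanishes at `x` and at `w`, so it has the same value at `y` as at the
  -- translate, which lies in `t`.
  by_cases hk : ∃ i : s, (i : Euc d) = k ∧ 0 < bs.coord i x
  · obtain ⟨i, hik, hi⟩ := hk
    refine (hy3 ⟨t, ht⟩ k ?_).le
    change 0 < bt.coord k x
    rw [bs.apply_eq_sum_coord (bt.coord k) x]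
    refine Finset.sum_pos' (fun j _ => ?_) ⟨i, Finset.mem_univ i, ?_⟩
    · rcases (hxnn j).eq_or_lt with hj | hj
      · simp [← hj]
      · refine mul_nonneg hj.le ?_
        have : bs j = bt ⟨j, hst j hj⟩ := rfl
        rw [this, bt.coord_apply]
        split_ifs <;> norm_num
    · have : bs i = bt k := hik
      rw [this, bt.coord_apply_eq, mul_one]
      exact hi
  · push Not at hk
    have hzero : ∀ z : Euc d, (∀ i, bs.coord i x = 0 → bs.coord i z = 0) → bt.coord k z = 0 := by
      intro z hz
      rw [bs.apply_eq_sum_coord (bt.coord k) z]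
      refine Finset.sum_eq_zero fun j _ => ?_
      rcases (hxnn j).eq_or_lt with hj | hj
      · rw [hz j hj.symm, zero_mul]
      · have : bs j = bt ⟨j, hst j hj⟩ := rfl
        rw [this, bt.coord_apply_ne, mul_zero]
        rintro rfl
        exact absurd hj (not_lt.2 (hk j rfl))
    have hxz := hzero x fun i hi => hi
    have hwz := hzero w hwx
    have hlin : bt.coord k (w + (y - x)) = bt.coord k w + (bt.coord k y - bt.coord k x) := by
      have e1 := (bt.coord k).map_vadd w (y - x)
      have e2 := (bt.coord k).linearMap_vsub y x
      simp only [vadd_eq_add, vsub_eq_sub] at e1 e2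
      rw [add_comm, e1, e2]
      ring
    rw [hlin, hwz, hxz] at hyt
    change 0 ≤ bt.coord k y
    linarith

/-- The vertices of the face that carries a boundary point are boundary points. -/
lemma vertex_mem_frontier (hΩ : IsPolyhedralDomain Ω) {s : Finset (Euc d)} (hs : s ∈ T.elems)
    {x : Euc d} (hx : x ∈ frontier Ω) (hxs : x ∈ cell s) {v : s}
    (hv : 0 < (T.isSimplex s hs).basis.coord v x) : (v : Euc d) ∈ frontier Ω := by
  by_contra hvf
  have hvc : (v : Euc d) ∈ closure Ω := T.cell_subset_closure hs (subset_cell s v.2)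
  have hvΩ : (v : Euc d) ∈ Ω := by
    by_contra hcon
    exact hvf ⟨hvc, by rwa [hΩ.isOpen.interior_eq]⟩
  set b := (T.isSimplex s hs).basis with hb
  have hxnn : ∀ i, 0 ≤ b.coord i x := by
    have := hxs
    rw [(T.isSimplex s hs).cell_eq] at this
    exact this
  have hcont : Tendsto (fun r : ℝ => AffineMap.lineMap (v : Euc d) x r) (𝓝[>] 0) (𝓝 v) := by
    have : Continuous fun r : ℝ => AffineMap.lineMap (v : Euc d) x r :=
      AffineMap.lineMap_continuous
    have := this.tendsto 0
    rw [AffineMap.lineMap_apply_zero] at this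
    exact this.mono_left nhdsWithin_le_nhds
  -- If `v` were in `Ω`, so would be a point of the segment from `v` to `x` close to `v`. For `0 < r
  -- < 1` this point has the same positive coordinates as `x`, so `x` would be in `Ω` too.
  obtain ⟨r, hrΩ, hr0, hr1⟩ : ∃ r : ℝ, AffineMap.lineMap (v : Euc d) x r ∈ Ω ∧ 0 < r ∧ r < 1 := by
    obtain ⟨r, h1, h2⟩ := ((hcont.eventually (hΩ.isOpen.mem_nhds hvΩ)).and
      (Ioo_mem_nhdsGT (zero_lt_one' ℝ))).exists
    exact ⟨r, h1, h2.1, h2.2⟩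
  have hco : ∀ i, b.coord i (AffineMap.lineMap (v : Euc d) x r) =
      (1 - r) * b.coord i v + r * b.coord i x := fun i => by
    rw [AffineMap.apply_lineMap, AffineMap.lineMap_apply_ring]
  have hvv : ∀ i, b.coord i v = if i = v then 1 else 0 := fun i => by
    have : (v : Euc d) = b v := rfl
    rw [this, b.coord_apply]
  have hxΩ : x ∈ Ω := by
    refine T.mem_of_same_face hΩ hs hrΩ ?_ (fun i hi => ?_) (fun i hi => ?_) hxs
    · rw [(T.isSimplex s hs).cell_eq]
      intro i
      change 0 ≤ b.coord i _
      rw [hco, hvv]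
      have := hxnn i
      have : 0 ≤ 1 - r := by linarith
      split_ifs <;> positivity
    · change 0 < b.coord i _
      rw [hco, hvv]
      have hi : 0 < b.coord i x := hi
      have : 0 ≤ 1 - r := by linarith
      split_ifs <;> positivity
    · change b.coord i _ = 0
      have hi : b.coord i x = 0 := hi
      have hne : i ≠ v := by
        rintro rfl
        exact hv.ne' hi
      rw [hco, hvv, if_neg hne, hi]
      ring
  exact hx.2 (by rwa [hΩ.isOpen.interior_eq])

/-- At a boundary point an affine piece is a combination of its values at the vertices with positive
coordinate, and `vertex_mem_frontier` puts these on the boundary. -/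
lemma mem_feSpaceZero (hΩ : IsPolyhedralDomain Ω) {v : Euc d → ℝ} (hv : v ∈ T.feSpace)
    (h0 : ∀ z ∈ T.vertices, z ∈ frontier Ω → v z = 0) : v ∈ T.feSpaceZero := by
  refine ⟨hv, fun x hx => ?_⟩
  obtain ⟨s, hs, hxs⟩ := T.exists_mem_cell (frontier_subset_closure hx)
  obtain ⟨p, hp⟩ := hv s hs
  rw [hp hxs, (T.isSimplex s hs).basis.apply_eq_sum_coord p x]
  refine Finset.sum_eq_zero fun i _ => ?_
  have hxnn : 0 ≤ (T.isSimplex s hs).basis.coord i x := by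
    have := hxs
    rw [(T.isSimplex s hs).cell_eq] at this
    exact this i
  rcases hxnn.eq_or_lt with hi | hi
  · rw [← hi, zero_mul]
  · have : p ((T.isSimplex s hs).basis i) = 0 := by
      have h1 := T.vertex_mem_frontier hΩ hs hx hxs hi
      have h2 := h0 i ⟨s, hs, i.2⟩ h1
      rw [hp (subset_cell s i.2)] at h2
      exact h2
    rw [this, mul_zero]

/-- The piecewise affine interpolant. -/
lemma exists_interpolant (U : Euc d → ℝ) :
    ∃ I ∈ T.feSpace, ∀ z ∈ T.vertices, I z = U z := by
  classical
  choose! p hp using fun s (hs : s ∈ T.elems) => (T.isSimplex s hs).exists_affineMap U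
  -- The choice of the cell does not matter: two affine pieces agree at the common vertices, hence
  -- on the common face, which is the whole intersection by conformity.
  let I : Euc d → ℝ := fun x => if h : ∃ s ∈ T.elems, x ∈ cell s then p h.choose x else 0
  have hI : ∀ s ∈ T.elems, EqOn I (p s) (cell s) := by
    intro s hs x hx
    have h : ∃ s ∈ T.elems, x ∈ cell s := ⟨s, hs, hx⟩
    have hIx : I x = p h.choose x := dif_pos h
    obtain ⟨ht, hxt⟩ := h.choose_spec
    rw [hIx]
    have : EqOn (p h.choose) (p s) (convexHull ℝ ((h.choose : Set (Euc d)) ∩ s)) :=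
      eqOn_convexHull_of_eqOn fun v hv => by rw [hp _ ht v hv.1, hp s hs v hv.2]
    refine this ?_
    rw [← T.conforming _ ht s hs]
    exact ⟨hxt, hx⟩
  refine ⟨I, fun s hs => ⟨p s, hI s hs⟩, ?_⟩
  rintro z ⟨s, hs, hz⟩
  rw [hI s hs (subset_cell s hz), hp s hs z hz]

end SimplicialMesh

/-! ### Mollification of weakly differentiable functions -/

section Mollify

variable {d : ℕ}

/-- The mollification `x ↦ ∫_Ω φ(x - y) f(y) dy` of a function on `Ω`. -/
noncomputable def mollify (φ : ContDiffBump (0 : Euc d)) (Ω : Set (Euc d)) (f : Euc d → ℝ)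
    (x : Euc d) : ℝ :=
  ∫ y in Ω, f y * φ.normed volume (x - y)

lemma gradient_apply_eq_fderiv (f : Euc d → ℝ) (x : Euc d) (i : Fin d) :
    gradient f x i = fderiv ℝ f x (EuclideanSpace.single i 1) := by
  have h : inner ℝ (gradient f x) (EuclideanSpace.single i (1 : ℝ)) =
      fderiv ℝ f x (EuclideanSpace.single i 1) := by
    rw [← toDual_gradient]; rfl
  rw [← h, EuclideanSpace.inner_single_right]
  simp

lemma inner_gradient (f : Euc d → ℝ) (x v : Euc d) :
    inner ℝ (gradient f x) v = fderiv ℝ f x v := by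
  rw [← toDual_gradient]; rfl

lemma norm_gradient (f : Euc d → ℝ) (x : Euc d) : ‖gradient f x‖ = ‖fderiv ℝ f x‖ := by
  rw [gradient, LinearIsometryEquiv.norm_map]

lemma euc_eq_sum (v : Euc d) : v = ∑ i, v i • EuclideanSpace.single i (1 : ℝ) := by
  have := (EuclideanSpace.basisFun (Fin d) ℝ).sum_repr v
  simpa using this.symm

variable {Ω : Set (Euc d)} {φ : ContDiffBump (0 : Euc d)} {f : Euc d → ℝ}

lemma mollify_eq_convolution (hΩ : MeasurableSet Ω) (x : Euc d) :
    mollify φ Ω f x =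
      (convolution (Ω.indicator f) (φ.normed volume) (ContinuousLinearMap.lsmul ℝ ℝ) volume) x := by
  rw [mollify, ← integral_indicator hΩ, convolution_def]
  congr 1
  ext y
  by_cases hy : y ∈ Ω <;> simp [hy]

lemma mollify_eq_convolution_swap (hΩ : MeasurableSet Ω) (x : Euc d) :
    mollify φ Ω f x =
      (convolution (φ.normed volume) (Ω.indicator f) (ContinuousLinearMap.lsmul ℝ ℝ) volume) x := by
  rw [mollify, ← integral_indicator hΩ, convolution_eq_swap]
  congr 1
  ext y
  by_cases hy : y ∈ Ω <;> simp [hy, mul_comm]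

lemma exists_bound_normed (φ : ContDiffBump (0 : Euc d)) :
    ∃ C, ∀ x, ‖φ.normed (volume : Measure (Euc d)) x‖ ≤ C :=
  φ.continuous_normed.bounded_above_of_compact_support φ.hasCompactSupport_normed

lemma integrable_mul_normed {μ : Measure (Euc d)} (hf : Integrable f μ) (x : Euc d) :
    Integrable (fun y => f y * φ.normed volume (x - y)) μ := by
  obtain ⟨C, hC⟩ := exists_bound_normed φ
  exact hf.mul_bdd ((φ.continuous_normed.comp (by fun_prop)).aestronglyMeasurable)
    (Eventually.of_forall fun y => hC _)

lemma mollify_sum {ι : Type*} (t : Finset ι) (c : ι → ℝ) (g : ι → Euc d → ℝ)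
    (hg : ∀ i ∈ t, IntegrableOn (g i) Ω) (x : Euc d) :
    mollify φ Ω (fun y => ∑ i ∈ t, c i * g i y) x = ∑ i ∈ t, c i * mollify φ Ω (g i) x := by
  simp only [mollify, Finset.sum_mul, mul_assoc]
  rw [integral_finsetSum _ fun i hi => (integrable_mul_normed (hg i hi) x).const_mul _]
  simp only [integral_const_mul]

lemma normed_sub_eq_zero {x y : Euc d} (h : y ∉ Metric.ball x φ.rOut) :
    φ.normed volume (x - y) = 0 := by
  rw [← Function.notMem_support, φ.support_normed_eq]
  simpa [dist_eq_norm, norm_sub_rev] using h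

/-- The kernel is nonnegative, has mass one and lives in a ball inside `Ω`, so the mollification is
a weighted mean of `f` over that ball. -/
lemma mollify_le {x : Euc d} {M : ℝ}
    (hx : Metric.closedBall x φ.rOut ⊆ Ω) (hf : IntegrableOn f Ω)
    (h : ∀ᵐ y ∂(volume.restrict Ω), y ∈ Metric.ball x φ.rOut → f y ≤ M) :
    mollify φ Ω f x ≤ M := by
  have h1 : ∫ y in Ω, M * φ.normed volume (x - y) = M := by
    rw [integral_const_mul, setIntegral_eq_integral_of_forall_compl_eq_zero,
      integral_sub_left_eq_self, φ.integral_normed, mul_one]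
    intro y hy
    exact normed_sub_eq_zero fun hyb => hy (hx (Metric.ball_subset_closedBall hyb))
  rw [← h1]
  have hint : Integrable (fun y => M * φ.normed volume (x - y)) (volume.restrict Ω) :=
    ((φ.integrable_normed.comp_sub_left x).const_mul M).integrableOn
  refine integral_mono_ae (integrable_mul_normed hf x) hint ?_
  filter_upwards [h] with y hy
  by_cases hyb : y ∈ Metric.ball x φ.rOut
  · exact mul_le_mul_of_nonneg_right (hy hyb) (φ.nonneg_normed _)
  · simp [normed_sub_eq_zero hyb]

lemma mollify_ge {x : Euc d} {M : ℝ}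
    (hx : Metric.closedBall x φ.rOut ⊆ Ω) (hf : IntegrableOn f Ω)
    (h : ∀ᵐ y ∂(volume.restrict Ω), y ∈ Metric.ball x φ.rOut → M ≤ f y) :
    M ≤ mollify φ Ω f x := by
  have h1 : mollify φ Ω (fun y => -f y) x ≤ -M := by
    refine mollify_le hx hf.neg ?_
    filter_upwards [h] with y hy hyb
    linarith [hy hyb]
  have h2 : mollify φ Ω (fun y => -f y) x = -mollify φ Ω f x := by
    simp [mollify, integral_neg]
  linarith

lemma normed_sub_mem_testFunctions {x : Euc d} (hx : Metric.closedBall x φ.rOut ⊆ Ω) :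
    (fun y => φ.normed volume (x - y)) ∈ testFunctions Ω := by
  have hsub : tsupport (fun y => φ.normed volume (x - y)) ⊆ Metric.closedBall x φ.rOut := by
    refine closure_minimal (fun y hy => ?_) Metric.isClosed_closedBall
    by_contra hcon
    exact hy (normed_sub_eq_zero fun hb => hcon (Metric.ball_subset_closedBall hb))
  refine ⟨?_, ?_, hsub.trans hx⟩
  · exact φ.contDiff_normed.comp (contDiff_const.sub contDiff_id)
  · exact (isCompact_closedBall x φ.rOut).of_isClosed_subset (isClosed_tsupport _) hsub

/-- Mollification commutes with weak differentiation. -/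
lemma hasFDerivAt_mollify (hΩ : MeasurableSet Ω) {g : Fin d → Euc d → ℝ}
    (hf : IntegrableOn f Ω) (hw : ∀ i, HasWeakPartial Ω i f (g i)) {x : Euc d}
    (hx : Metric.closedBall x φ.rOut ⊆ Ω) :
    ∃ f' : Euc d →L[ℝ] ℝ, HasFDerivAt (mollify φ Ω f) f' x ∧
      ∀ v, f' v = ∑ i, v i * mollify φ Ω (g i) x := by
  have hfi : LocallyIntegrable (Ω.indicator f) volume :=
    ((integrable_indicator_iff hΩ).2 hf).locallyIntegrable
  have hC1 : ContDiff ℝ 1 (φ.normed (volume : Measure (Euc d))) := φ.contDiff_normed (n := 1)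
  have hder := φ.hasCompactSupport_normed.hasFDerivAt_convolution_right
    (ContinuousLinearMap.lsmul ℝ ℝ) hfi hC1 x
  rw [show convolution (Ω.indicator f) (φ.normed volume) (ContinuousLinearMap.lsmul ℝ ℝ) volume =
    mollify φ Ω f from funext fun z => (mollify_eq_convolution hΩ z).symm] at hder
  refine ⟨_, hder, fun v => ?_⟩
  have key : ∀ i, ((convolution (Ω.indicator f) (fderiv ℝ (φ.normed volume))
      (ContinuousLinearMap.precompR (Euc d) (ContinuousLinearMap.lsmul ℝ ℝ)) volume) x)
      (EuclideanSpace.single i 1) = mollify φ Ω (g i) x := fun i => by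
    rw [convolution_precompR_apply _ hfi (φ.hasCompactSupport_normed.fderiv ℝ)
      (hC1.continuous_fderiv one_ne_zero), convolution_def]
    -- The weak derivative is tested with the kernel `y ↦ φ (x - y)`. Differentiating it in `y`
    -- instead of `x` produces a sign, which cancels the sign of integration by parts.
    have h1 := hw i _ (normed_sub_mem_testFunctions hx)
    have h2 : ∀ y, gradient (fun y => φ.normed volume (x - y)) y i =
        -fderiv ℝ (φ.normed volume) (x - y) (EuclideanSpace.single i 1) := fun y => by
      rw [gradient_apply_eq_fderiv]
      have hd : HasFDerivAt (fun y : Euc d => x - y) (-ContinuousLinearMap.id ℝ (Euc d)) y := by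
        simpa using (hasFDerivAt_id y).const_sub x
      have hφd : HasFDerivAt (φ.normed volume) (fderiv ℝ (φ.normed volume) (x - y)) (x - y) :=
        (hC1.differentiable one_ne_zero _).hasFDerivAt
      have := hφd.comp y hd
      rw [show (fun y => φ.normed volume (x - y)) = φ.normed volume ∘ fun y => x - y from rfl,
        this.fderiv]
      simp
    simp only [h2, mul_neg, integral_neg, neg_inj] at h1
    rw [mollify, ← h1, ← integral_indicator hΩ]
    congr 1
    ext y
    by_cases hy : y ∈ Ω <;> simp [hy]
  conv_lhs => rw [euc_eq_sum v]
  rw [map_sum]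
  refine Finset.sum_congr rfl fun i _ => ?_
  rw [map_smul, key i, smul_eq_mul]

lemma hasDerivAt_mollify_line (hΩ : MeasurableSet Ω) {g : Fin d → Euc d → ℝ}
    (hf : IntegrableOn f Ω) (hw : ∀ i, HasWeakPartial Ω i f (g i)) {x v : Euc d} {t : ℝ}
    (hx : Metric.closedBall (x + t • v) φ.rOut ⊆ Ω) :
    HasDerivAt (fun t : ℝ => mollify φ Ω f (x + t • v))
      (∑ i, v i * mollify φ Ω (g i) (x + t • v)) t := by
  obtain ⟨f', hf', hv⟩ := hasFDerivAt_mollify hΩ hf hw hx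
  have hl : HasDerivAt (fun t : ℝ => x + t • v) v t := by
    simpa using ((hasDerivAt_id t).smul_const v).const_add x
  rw [← hv]
  exact hf'.comp_hasDerivAt t hl

/-- The increment of a mollified function along a segment. -/
lemma mollify_increment_bounds (hΩ : MeasurableSet Ω) {g : Fin d → Euc d → ℝ}
    (hf : IntegrableOn f Ω) (hg : ∀ i, IntegrableOn (g i) Ω)
    (hw : ∀ i, HasWeakPartial Ω i f (g i)) {x v : Euc d} {m M : ℝ}
    (hx : ∀ t ∈ Icc (0 : ℝ) 1, Metric.closedBall (x + t • v) φ.rOut ⊆ Ω)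
    (h : ∀ᵐ y ∂(volume.restrict Ω), (∃ t ∈ Icc (0 : ℝ) 1, y ∈ Metric.ball (x + t • v) φ.rOut) →
      ∑ i, v i * g i y ∈ Icc m M) :
    mollify φ Ω f (x + v) - mollify φ Ω f x ∈ Icc m M := by
  obtain ⟨ξ, hξ, hslope⟩ := exists_hasDerivAt_eq_slope (fun t : ℝ => mollify φ Ω f (x + t • v))
    (fun t => ∑ i, v i * mollify φ Ω (g i) (x + t • v)) zero_lt_one
    (fun t ht => (hasDerivAt_mollify_line hΩ hf hw (hx t ht)).continuousAt.continuousWithinAt)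
    (fun t ht => hasDerivAt_mollify_line hΩ hf hw (hx t (Ioo_subset_Icc_self ht)))
  have hξ' := Ioo_subset_Icc_self hξ
  simp only [one_smul, zero_smul, add_zero, sub_zero, div_one] at hslope
  rw [← hslope, ← mollify_sum _ _ _ fun i _ => hg i]
  have hint : IntegrableOn (fun y => ∑ i, v i * g i y) Ω :=
    integrable_finsetSum _ fun i _ => (hg i).const_mul _
  constructor
  · refine mollify_ge (hx ξ hξ') hint ?_
    filter_upwards [h] with y hy hyb using (hy ⟨ξ, hξ', hyb⟩).1
  · refine mollify_le (hx ξ hξ') hint ?_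
    filter_upwards [h] with y hy hyb using (hy ⟨ξ, hξ', hyb⟩).2

/-- The second order remainder of a mollified function along a segment. -/
lemma mollify_remainder_bounds (hΩ : MeasurableSet Ω) {g : Fin d → Euc d → ℝ}
    {h : Fin d → Fin d → Euc d → ℝ} (hf : IntegrableOn f Ω) (hg : ∀ i, IntegrableOn (g i) Ω)
    (hh : ∀ i j, IntegrableOn (h i j) Ω) (hw : ∀ i, HasWeakPartial Ω i f (g i))
    (hw' : ∀ i j, HasWeakPartial Ω j (g i) (h i j)) {x v : Euc d} {m M : ℝ}
    (hm : m ≤ 0) (hM : 0 ≤ M)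
    (hx : ∀ t ∈ Icc (0 : ℝ) 1, Metric.closedBall (x + t • v) φ.rOut ⊆ Ω)
    (hb : ∀ᵐ y ∂(volume.restrict Ω), (∃ t ∈ Icc (0 : ℝ) 1, y ∈ Metric.ball (x + t • v) φ.rOut) →
      ∑ i, ∑ j, h i j y * v i * v j ∈ Icc m M) :
    mollify φ Ω f (x + v) - mollify φ Ω f x - ∑ i, v i * mollify φ Ω (g i) x ∈ Icc m M := by
  obtain ⟨ξ, hξ, hslope⟩ := exists_hasDerivAt_eq_slope (fun t : ℝ => mollify φ Ω f (x + t • v))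
    (fun t => ∑ i, v i * mollify φ Ω (g i) (x + t • v)) zero_lt_one
    (fun t ht => (hasDerivAt_mollify_line hΩ hf hw (hx t ht)).continuousAt.continuousWithinAt)
    (fun t ht => hasDerivAt_mollify_line hΩ hf hw (hx t (Ioo_subset_Icc_self ht)))
  simp only [one_smul, zero_smul, add_zero, sub_zero, div_one] at hslope
  rw [← hslope]
  have hder : ∀ t ∈ Icc (0 : ℝ) 1, HasDerivAt
      (fun t : ℝ => ∑ i, v i * mollify φ Ω (g i) (x + t • v))
      (∑ i, v i * ∑ j, v j * mollify φ Ω (h i j) (x + t • v)) t := fun t ht =>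
    HasDerivAt.fun_sum fun i _ =>
      (hasDerivAt_mollify_line hΩ (hg i) (hw' i) (hx t ht)).const_mul (v i)
  -- A second mean value theorem, for the directional derivative on `[0, ξ]`: the remainder is `ξ`
  -- times the second derivative at `η`. The factor `ξ` in `(0, 1)` does not lead out of `[m, M]`
  -- because `m ≤ 0 ≤ M`.
  obtain ⟨η, hη, hslope'⟩ := exists_hasDerivAt_eq_slope
    (fun t : ℝ => ∑ i, v i * mollify φ Ω (g i) (x + t • v))
    (fun t => ∑ i, v i * ∑ j, v j * mollify φ Ω (h i j) (x + t • v)) hξ.1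
    (fun t ht => (hder t ⟨ht.1, ht.2.trans hξ.2.le⟩).continuousAt.continuousWithinAt)
    (fun t ht => hder t ⟨ht.1.le, ht.2.le.trans hξ.2.le⟩)
  have hη' : η ∈ Icc (0 : ℝ) 1 := ⟨hη.1.le, hη.2.le.trans hξ.2.le⟩
  simp only [zero_smul, add_zero, sub_zero] at hslope'
  rw [eq_div_iff hξ.1.ne'] at hslope'
  rw [← hslope']
  have hint : IntegrableOn (fun y => ∑ p : Fin d × Fin d, (v p.1 * v p.2) * h p.1 p.2 y) Ω :=
    integrable_finsetSum _ fun p _ => (hh p.1 p.2).const_mul _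
  have e1 : ∑ i, v i * ∑ j, v j * mollify φ Ω (h i j) (x + η • v) =
      mollify φ Ω (fun y => ∑ p : Fin d × Fin d, (v p.1 * v p.2) * h p.1 p.2 y) (x + η • v) := by
    rw [mollify_sum _ _ _ fun p _ => hh p.1 p.2, Fintype.sum_prod_type]
    simp only [Finset.mul_sum, mul_assoc]
  have e2 : ∀ y, ∑ p : Fin d × Fin d, (v p.1 * v p.2) * h p.1 p.2 y =
      ∑ i, ∑ j, h i j y * v i * v j := fun y => by
    rw [Fintype.sum_prod_type]
    refine Finset.sum_congr rfl fun i _ => Finset.sum_congr rfl fun j _ => ?_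
    ring
  have hlo : m ≤ ∑ i, v i * ∑ j, v j * mollify φ Ω (h i j) (x + η • v) := by
    rw [e1]
    refine mollify_ge (hx η hη') hint ?_
    filter_upwards [hb] with y hy hyb
    rw [e2]
    exact (hy ⟨η, hη', hyb⟩).1
  have hhi : ∑ i, v i * ∑ j, v j * mollify φ Ω (h i j) (x + η • v) ≤ M := by
    rw [e1]
    refine mollify_le (hx η hη') hint ?_
    filter_upwards [hb] with y hy hyb
    rw [e2]
    exact (hy ⟨η, hη', hyb⟩).2
  have hξ0 := hξ.1
  have hξ1 := hξ.2
  constructor <;> nlinarith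

end Mollify

/-! ### Pointwise Taylor estimates for functions with bounded weak Hessian -/

section Taylor

variable {d : ℕ}

/-- A sequence of mollifiers with shrinking supports. -/
noncomputable def shrinkingBump (d k : ℕ) : ContDiffBump (0 : Euc d) where
  rIn := 1 / (2 * ((k : ℝ) + 1))
  rOut := 1 / ((k : ℝ) + 1)
  rIn_pos := by positivity
  rIn_lt_rOut := by
    have : (0 : ℝ) < k + 1 := by positivity
    exact one_div_lt_one_div_of_lt this (by linarith)

lemma tendsto_shrinkingBump_rOut : Tendsto (fun k => (shrinkingBump d k).rOut) atTop (𝓝 0) :=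
  tendsto_one_div_add_atTop_nhds_zero_nat

/-- The points of `Ω` where the mollifications of `u` and of its gradient converge. -/
def approxPoints (Ω : Set (Euc d)) (u : Euc d → ℝ) (Du : Euc d → Euc d) : Set (Euc d) :=
  {x | x ∈ Ω ∧ Tendsto (fun k => mollify (shrinkingBump d k) Ω u x) atTop (𝓝 (u x)) ∧
    ∀ i, Tendsto (fun k => mollify (shrinkingBump d k) Ω (fun y => Du y i) x) atTop (𝓝 (Du x i))}

variable {Ω : Set (Euc d)} {u : Euc d → ℝ} {Du : Euc d → Euc d}
  {H : Euc d → Matrix (Fin d) (Fin d) ℝ}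

lemma ae_tendsto_mollify (hΩ : MeasurableSet Ω) {f : Euc d → ℝ} (hf : IntegrableOn f Ω) :
    ∀ᵐ x ∂(volume.restrict Ω),
      Tendsto (fun k => mollify (shrinkingBump d k) Ω f x) atTop (𝓝 (f x)) := by
  rw [ae_restrict_iff' hΩ]
  -- The Lebesgue differentiation theorem for these kernels requires a bounded ratio of the two
  -- radii.
  have hK : ∀ᶠ k in atTop, (shrinkingBump d k).rOut ≤ 2 * (shrinkingBump d k).rIn :=
    Eventually.of_forall fun k => by
      simp only [shrinkingBump]
      have : (0 : ℝ) < k + 1 := by positivity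
      apply le_of_eq
      field_simp
  filter_upwards [ContDiffBump.ae_convolution_tendsto_right_of_locallyIntegrable
    tendsto_shrinkingBump_rOut hK
    ((integrable_indicator_iff hΩ).2 hf).locallyIntegrable] with x hx hxΩ
  simp only [← mollify_eq_convolution_swap hΩ] at hx
  simpa [hxΩ] using hx

lemma ae_mem_approxPoints (hΩ : MeasurableSet Ω) (hu : IntegrableOn u Ω)
    (hDu : ∀ i, IntegrableOn (fun x => Du x i) Ω) :
    ∀ᵐ x ∂(volume.restrict Ω), x ∈ approxPoints Ω u Du := by
  filter_upwards [ae_restrict_mem hΩ, ae_tendsto_mollify hΩ hu,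
    ae_all_iff.2 fun i => ae_tendsto_mollify hΩ (hDu i)] with x h1 h2 h3
  exact ⟨h1, h2, h3⟩

/-- A compact segment in an open set has a neighbourhood of positive width in it. Thus the
mollifications on the segment see only values in `V`, and bounds on a single element suffice. -/
lemma eventually_tube_subset {V : Set (Euc d)} (hV : IsOpen V) (hVc : Convex ℝ V)
    {x y : Euc d} (hx : x ∈ V) (hy : y ∈ V) :
    ∀ᶠ k in atTop, ∀ t ∈ Icc (0 : ℝ) 1,
      Metric.closedBall (x + t • (y - x)) (shrinkingBump d k).rOut ⊆ V := by
  have hseg : segment ℝ x y ⊆ V := hVc.segment_subset hx hy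
  have hc : IsCompact (segment ℝ x y) := by
    rw [segment_eq_image_lineMap]
    exact isCompact_Icc.image AffineMap.lineMap_continuous
  obtain ⟨δ, hδ, hsub⟩ := hc.exists_cthickening_subset_open hV hseg
  filter_upwards [tendsto_shrinkingBump_rOut (d := d) (Iio_mem_nhds hδ)] with k hk t ht
  have hmem : x + t • (y - x) ∈ segment ℝ x y := by
    rw [segment_eq_image']
    exact ⟨t, ht, rfl⟩
  exact (Metric.closedBall_subset_cthickening hmem _).trans
    ((Metric.cthickening_mono (le_of_lt hk) _).trans hsub)

/-- A bound a.e. on an open subset `V` holds near a segment in `V`. -/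
lemma ae_near_segment {V : Set (Euc d)} (hVm : MeasurableSet V) {P : Euc d → Prop}
    (hP : ∀ᵐ z ∂(volume.restrict V), P z) {x v : Euc d} {r : ℝ}
    (hk : ∀ t ∈ Icc (0 : ℝ) 1, Metric.closedBall (x + t • v) r ⊆ V) :
    ∀ᵐ z ∂(volume.restrict Ω), (∃ t ∈ Icc (0 : ℝ) 1, z ∈ Metric.ball (x + t • v) r) → P z := by
  rw [ae_restrict_iff' hVm] at hP
  refine ae_restrict_of_ae ?_
  filter_upwards [hP] with z hz
  rintro ⟨t, ht, hzt⟩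
  exact hz (hk t ht (Metric.ball_subset_closedBall hzt))

/-- The mollifications are differentiable near the segment and satisfy the estimate for all large
`k`; at approximation points every term converges. -/
lemma taylor_bounds (hΩ : MeasurableSet Ω) (hu : IntegrableOn u Ω)
    (hDu : ∀ i, IntegrableOn (fun x => Du x i) Ω) (hH : ∀ i j, IntegrableOn (fun x => H x i j) Ω)
    (hw : ∀ i, HasWeakPartial Ω i u (fun x => Du x i))
    (hw' : ∀ i j, HasWeakPartial Ω j (fun x => Du x i) (fun x => H x i j))
    {V : Set (Euc d)} (hV : IsOpen V) (hVc : Convex ℝ V) (hVΩ : V ⊆ Ω) {x y : Euc d}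
    (hx : x ∈ V) (hy : y ∈ V) (hxG : x ∈ approxPoints Ω u Du) (hyG : y ∈ approxPoints Ω u Du)
    {m M : ℝ} (hm : m ≤ 0) (hM : 0 ≤ M)
    (hb : ∀ᵐ z ∂(volume.restrict V), quadForm (H z) (y - x) ∈ Icc m M) :
    u y - u x - inner ℝ (Du x) (y - x) ∈ Icc m M := by
  have hlim : Tendsto (fun k => mollify (shrinkingBump d k) Ω u (x + (y - x)) -
      mollify (shrinkingBump d k) Ω u x -
      ∑ i, (y - x) i * mollify (shrinkingBump d k) Ω (fun z => Du z i) x) atTop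
      (𝓝 (u y - u x - inner ℝ (Du x) (y - x))) := by
    have e : inner ℝ (Du x) (y - x) = ∑ i, (y - x) i * Du x i := by
      simp [PiLp.inner_apply]
    rw [e, add_sub_cancel]
    exact (hyG.2.1.sub hxG.2.1).sub (tendsto_finsetSum _ fun i _ => (hxG.2.2 i).const_mul _)
  refine isClosed_Icc.mem_of_tendsto hlim ?_
  filter_upwards [eventually_tube_subset hV hVc hx hy] with k hk
  exact mollify_remainder_bounds (h := fun i j z => H z i j) hΩ hu hDu hH hw hw' hm hM
    (fun t ht => (hk t ht).trans hVΩ) (ae_near_segment hV.measurableSet hb hk)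

lemma gradient_increment_bounds (hΩ : MeasurableSet Ω) {f : Euc d → ℝ} {g : Fin d → Euc d → ℝ}
    (hf : IntegrableOn f Ω) (hg : ∀ i, IntegrableOn (g i) Ω)
    (hw : ∀ i, HasWeakPartial Ω i f (g i))
    {V : Set (Euc d)} (hV : IsOpen V) (hVc : Convex ℝ V) (hVΩ : V ⊆ Ω) {x y : Euc d}
    (hx : x ∈ V) (hy : y ∈ V)
    (hxG : Tendsto (fun k => mollify (shrinkingBump d k) Ω f x) atTop (𝓝 (f x)))
    (hyG : Tendsto (fun k => mollify (shrinkingBump d k) Ω f y) atTop (𝓝 (f y)))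
    {m M : ℝ} (hb : ∀ᵐ z ∂(volume.restrict V), ∑ i, (y - x) i * g i z ∈ Icc m M) :
    f y - f x ∈ Icc m M := by
  refine isClosed_Icc.mem_of_tendsto (hyG.sub hxG) ?_
  filter_upwards [eventually_tube_subset hV hVc hx hy] with k hk
  have := mollify_increment_bounds (φ := shrinkingBump d k) hΩ hf hg hw
    (fun t ht => (hk t ht).trans hVΩ) (ae_near_segment hV.measurableSet hb hk)
  rwa [add_sub_cancel] at this

lemma exists_mem_of_ae {P : Euc d → Prop} (hP : ∀ᵐ x ∂(volume.restrict Ω), P x)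
    {W : Set (Euc d)} (hW : IsOpen W) (hne : W.Nonempty) (hWΩ : W ⊆ Ω) : ∃ x ∈ W, P x := by
  by_contra hcon
  push Not at hcon
  have h1 : ∀ᵐ x ∂(volume.restrict W), P x := ae_mono (Measure.restrict_mono hWΩ le_rfl) hP
  rw [ae_restrict_iff' hW.measurableSet] at h1
  have h2 : ∀ᵐ x, x ∉ W := by
    filter_upwards [h1] with x hx hxW using hcon x hxW (hx hxW)
  exact (hW.measure_pos volume hne).ne' (measure_eq_zero_iff_ae_notMem.2 h2)

lemma abs_quadForm_le {S : Matrix (Fin d) (Fin d) ℝ} {Λ : ℝ} (h : ∀ i j, |S i j| ≤ Λ)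
    (v : Euc d) : |quadForm S v| ≤ d * (d * (Λ * ‖v‖ * ‖v‖)) := by
  have hv : ∀ i, |v i| ≤ ‖v‖ := fun i => PiLp.norm_apply_le v i
  calc |quadForm S v| ≤ ∑ _i : Fin d, ∑ _j : Fin d, Λ * ‖v‖ * ‖v‖ := by
        refine (Finset.abs_sum_le_sum_abs _ _).trans (Finset.sum_le_sum fun i _ => ?_)
        refine (Finset.abs_sum_le_sum_abs _ _).trans (Finset.sum_le_sum fun j _ => ?_)
        rw [abs_mul, abs_mul]
        have := (abs_nonneg _).trans (h i j)
        gcongr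
        exacts [h i j, hv i, hv j]
    _ = _ := by simp

lemma abs_sum_mul_le {c : Fin d → ℝ} {Λ : ℝ} (h : ∀ i, |c i| ≤ Λ) (v : Euc d) :
    |∑ i, v i * c i| ≤ d * (‖v‖ * Λ) := by
  have hv : ∀ i, |v i| ≤ ‖v‖ := fun i => PiLp.norm_apply_le v i
  calc |∑ i, v i * c i| ≤ ∑ _i : Fin d, ‖v‖ * Λ := by
        refine (Finset.abs_sum_le_sum_abs _ _).trans (Finset.sum_le_sum fun i _ => ?_)
        rw [abs_mul]
        gcongr
        exacts [hv i, h i]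
    _ = _ := by simp

/-- Locally, `u` agrees on the approximation points with a Lipschitz function. -/
lemma exists_local_lipschitz (hΩ : IsOpen Ω) (hu : IntegrableOn u Ω)
    (hDu : ∀ i, IntegrableOn (fun x => Du x i) Ω) (hH : ∀ i j, IntegrableOn (fun x => H x i j) Ω)
    (hw : ∀ i, HasWeakPartial Ω i u (fun x => Du x i))
    (hw' : ∀ i j, HasWeakPartial Ω j (fun x => Du x i) (fun x => H x i j))
    {Λ : ℝ} (hΛ : ∀ᵐ z ∂(volume.restrict Ω), ∀ i j, |H z i j| ≤ Λ) {x₀ : Euc d} (hx₀ : x₀ ∈ Ω) :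
    ∃ W ∈ 𝓝 x₀, ∃ g : Euc d → ℝ, Continuous g ∧ EqOn u g (approxPoints Ω u Du ∩ W) := by
  obtain ⟨r, hr, hball⟩ := Metric.isOpen_iff.1 hΩ x₀ hx₀
  set V := Metric.ball x₀ r with hVdef
  have hVo : IsOpen V := Metric.isOpen_ball
  have hVc : Convex ℝ V := convex_ball _ _
  have hΛV : ∀ᵐ z ∂(volume.restrict V), ∀ i j, |H z i j| ≤ Λ :=
    ae_mono (Measure.restrict_mono hball le_rfl) hΛ
  obtain ⟨z₀, hz₀V, hz₀, hHz₀⟩ := exists_mem_of_ae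
    ((ae_mem_approxPoints hΩ.measurableSet hu hDu).and hΛ) hVo ⟨x₀, Metric.mem_ball_self hr⟩ hball
  have hdist : ∀ x ∈ V, ∀ y ∈ V, ‖y - x‖ ≤ 2 * r := fun x hx y hy => by
    rw [← dist_eq_norm]
    have h1 := Metric.mem_ball.1 hx
    have h2 := Metric.mem_ball.1 hy
    have := dist_triangle_right y x x₀
    linarith
  have hΛ0 : ∀ i : Fin d, 0 ≤ Λ := fun i => (abs_nonneg _).trans (hHz₀ i i)
  -- `K` bounds the gradient in the ball: its size at one fixed point plus an increment controlled
  -- by the Hessian bound and the diameter `2 r`.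
  set K : ℝ := ∑ i, |Du z₀ i| + d * (2 * r * Λ) with hK
  have hDK : ∀ x ∈ approxPoints Ω u Du ∩ V, ∀ i, |Du x i| ≤ K := by
    rintro x ⟨hxG, hxV⟩ i
    have h1 := gradient_increment_bounds (g := fun j z => H z i j) (m := -(d * (‖x - z₀‖ * Λ)))
      (M := d * (‖x - z₀‖ * Λ)) hΩ.measurableSet (hDu i) (hH i) (hw' i) hVo hVc hball hz₀V hxV
      (hz₀.2.2 i) (hxG.2.2 i) (by
        filter_upwards [hΛV] with z hz
        exact abs_le.1 (abs_sum_mul_le (hz i) _))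
    have h2 := abs_le.2 h1
    have h3 : d * (‖x - z₀‖ * Λ) ≤ d * (2 * r * Λ) := by
      have := hdist z₀ hz₀V x hxV
      have := hΛ0 i
      gcongr
    have h4 : |Du z₀ i| ≤ ∑ i, |Du z₀ i| :=
      Finset.single_le_sum (f := fun i => |Du z₀ i|) (fun _ _ => abs_nonneg _) (Finset.mem_univ i)
    have h5 : |Du x i| ≤ |Du z₀ i| + |Du x i - Du z₀ i| := by
      have := abs_add_le (Du z₀ i) (Du x i - Du z₀ i)
      simpa using this
    linarith
  -- The first term bounds the linear part of the Taylor expansion, the second its remainder, with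
  -- one of the two factors `‖y - x‖` replaced by `2 r`.
  set C : ℝ := d * K + d * (d * (Λ * (2 * r))) with hC
  have hlip : ∀ x ∈ approxPoints Ω u Du ∩ V, ∀ y ∈ approxPoints Ω u Du ∩ V,
      |u y - u x| ≤ C * ‖y - x‖ := by
    rintro x ⟨hxG, hxV⟩ y ⟨hyG, hyV⟩
    -- The bound `Λ` is known to be nonnegative only if there is a matrix entry.
    rcases d.eq_zero_or_pos with hd0 | hdpos
    · subst hd0
      have : y = x := Subsingleton.elim _ _
      simp [this]
    have hΛ0 := hΛ0 ⟨0, hdpos⟩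
    have hnn : (0 : ℝ) ≤ d * (d * (Λ * ‖y - x‖ * ‖y - x‖)) := by positivity
    have h1 := abs_le.2 (taylor_bounds hΩ.measurableSet hu hDu hH hw hw' hVo hVc hball hxV hyV hxG
      hyG (neg_nonpos.2 hnn) hnn (by
        filter_upwards [hΛV] with z hz
        exact abs_le.1 (abs_quadForm_le hz _)))
    have h2 : |inner ℝ (Du x) (y - x)| ≤ d * (‖y - x‖ * K) := by
      have e : inner ℝ (Du x) (y - x) = ∑ i, (y - x) i * Du x i := by
        simp [PiLp.inner_apply]
      rw [e]
      exact abs_sum_mul_le (hDK x ⟨hxG, hxV⟩) _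
    have h3 : (d : ℝ) * (d * (Λ * ‖y - x‖ * ‖y - x‖)) ≤ d * (d * (Λ * (2 * r) * ‖y - x‖)) := by
      have := hdist x hxV y hyV
      gcongr
    have h4 : |u y - u x| ≤
        |u y - u x - inner ℝ (Du x) (y - x)| + |inner ℝ (Du x) (y - x)| := by
      have := abs_add_le (u y - u x - inner ℝ (Du x) (y - x)) (inner ℝ (Du x) (y - x))
      simpa using this
    calc |u y - u x| ≤ d * (d * (Λ * (2 * r) * ‖y - x‖)) + d * (‖y - x‖ * K) := by linarith
      _ = _ := by rw [hC]; ring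
  have hLip : LipschitzOnWith C.toNNReal u (approxPoints Ω u Du ∩ V) := by
    refine LipschitzOnWith.of_dist_le' fun x hx y hy => ?_
    rw [Real.dist_eq, dist_eq_norm, abs_sub_comm, norm_sub_rev]
    exact hlip x hx y hy
  obtain ⟨g, hg, hug⟩ := hLip.extend_real
  exact ⟨V, Metric.ball_mem_nhds x₀ hr, g, hg.continuous, hug⟩

/-- The continuous representative of `u` on the closure of `Ω`, with boundary values `g`. -/
lemma exists_continuous_representative (hΩ : IsOpen Ω) (hu : IntegrableOn u Ω)
    (hDu : ∀ i, IntegrableOn (fun x => Du x i) Ω) (hH : ∀ i j, IntegrableOn (fun x => H x i j) Ω)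
    (hw : ∀ i, HasWeakPartial Ω i u (fun x => Du x i))
    (hw' : ∀ i j, HasWeakPartial Ω j (fun x => Du x i) (fun x => H x i j))
    {Λ : ℝ} (hΛ : ∀ᵐ z ∂(volume.restrict Ω), ∀ i j, |H z i j| ≤ Λ) {g : Euc d → ℝ}
    (hg : ∀ z ∈ frontier Ω, Tendsto u (𝓝[Ω] z) (𝓝 (g z))) :
    ∃ U : Euc d → ℝ, ContinuousOn U (closure Ω) ∧ EqOn U u (approxPoints Ω u Du) ∧
      EqOn U g (frontier Ω) := by
  set G := approxPoints Ω u Du with hG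
  have hGΩ : G ⊆ Ω := fun x hx => hx.1
  have hdense : closure Ω ⊆ closure G := by
    refine closure_minimal (fun x hx => ?_) isClosed_closure
    rw [mem_closure_iff]
    intro W hW hxW
    obtain ⟨y, hy, hyG⟩ := exists_mem_of_ae (ae_mem_approxPoints hΩ.measurableSet hu hDu)
      (hW.inter hΩ) ⟨x, hxW, hx⟩ inter_subset_right
    exact ⟨y, hy.1, hyG⟩
  -- Restricted to the dense set `G`, `u` has a limit at every point of `Ω` by the local Lipschitz
  -- bound, and at every boundary point by hypothesis; so `extendFrom` is continuous on the closure.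
  have hloc : ∀ x ∈ Ω, ∃ h : Euc d → ℝ, Tendsto u (𝓝[G] x) (𝓝 (h x)) ∧ (x ∈ G → h x = u x) := by
    intro x hx
    obtain ⟨W, hW, h, hh, hEq⟩ := exists_local_lipschitz hΩ hu hDu hH hw hw' hΛ hx
    refine ⟨h, ?_, fun hxG => (hEq ⟨hxG, mem_of_mem_nhds hW⟩).symm⟩
    refine (hh.continuousAt.tendsto.mono_left nhdsWithin_le_nhds).congr' ?_
    filter_upwards [self_mem_nhdsWithin, nhdsWithin_le_nhds hW] with y hy hyW
      using (hEq ⟨hy, hyW⟩).symm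
  refine ⟨extendFrom G u, continuousOn_extendFrom hdense fun x hx => ?_, fun x hx => ?_,
    fun x hx => ?_⟩
  · by_cases hxΩ : x ∈ Ω
    · obtain ⟨h, hh, -⟩ := hloc x hxΩ
      exact ⟨_, hh⟩
    · exact ⟨_, (hg x ⟨hx, by rwa [hΩ.interior_eq]⟩).mono_left (nhdsWithin_mono _ hGΩ)⟩
  · obtain ⟨h, hh, heq⟩ := hloc x (hGΩ hx)
    rw [extendFrom_eq (hdense (subset_closure (hGΩ hx))) hh, heq hx]
  · exact extendFrom_eq (hdense (frontier_subset_closure hx))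
      ((hg x hx).mono_left (nhdsWithin_mono _ hGΩ))

lemma continuous_quadForm (S : Matrix (Fin d) (Fin d) ℝ) : Continuous (quadForm S) := by
  unfold quadForm
  fun_prop

/-- The Taylor estimate from a point of approximation to a point of the closed cell. -/
lemma taylor_bounds_closure (hΩ : MeasurableSet Ω) (hu : IntegrableOn u Ω)
    (hDu : ∀ i, IntegrableOn (fun x => Du x i) Ω) (hH : ∀ i j, IntegrableOn (fun x => H x i j) Ω)
    (hw : ∀ i, HasWeakPartial Ω i u (fun x => Du x i))
    (hw' : ∀ i j, HasWeakPartial Ω j (fun x => Du x i) (fun x => H x i j))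
    {U : Euc d → ℝ} (hU : ContinuousOn U (closure Ω)) (hUu : EqOn U u (approxPoints Ω u Du))
    {V : Set (Euc d)} (hV : IsOpen V) (hVc : Convex ℝ V) (hVΩ : V ⊆ Ω) {x y : Euc d}
    (hx : x ∈ V) (hy : y ∈ closure V) (hxG : x ∈ approxPoints Ω u Du)
    {S : Matrix (Fin d) (Fin d) ℝ} (hS : ∀ v, 0 ≤ quadForm S v)
    (hb : ∀ᵐ z ∂(volume.restrict V), ∀ v, quadForm (H z) v ∈ Icc 0 (quadForm S v)) :
    U y - u x - inner ℝ (Du x) (y - x) ∈ Icc 0 (quadForm S (y - x)) := by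
  set G := approxPoints Ω u Du
  -- The point `y` may be a vertex, where `u` need not be well behaved; it is reached as a limit of
  -- approximation points inside `V`.
  have hyG : y ∈ closure (G ∩ V) := by
    rw [mem_closure_iff] at hy ⊢
    intro W hW hyW
    obtain ⟨z, hz⟩ := hy W hW hyW
    obtain ⟨w, hw, hwG⟩ := exists_mem_of_ae (ae_mem_approxPoints hΩ hu hDu)
      (hW.inter hV) ⟨z, hz⟩ (inter_subset_right.trans hVΩ)
    exact ⟨w, hw.1, hwG, hw.2⟩
  have hne : (𝓝[G ∩ V] y).NeBot := mem_closure_iff_nhdsWithin_neBot.1 hyG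
  have hUy : Tendsto U (𝓝[G ∩ V] y) (𝓝 (U y)) :=
    (hU y (closure_mono hVΩ hy)).tendsto.mono_left
      (nhdsWithin_mono _ fun z hz => subset_closure hz.1.1)
  have hid : Tendsto (fun z : Euc d => z) (𝓝[G ∩ V] y) (𝓝 y) := nhdsWithin_le_nhds
  have hl : Tendsto (fun z => U z - u x - inner ℝ (Du x) (z - x)) (𝓝[G ∩ V] y)
      (𝓝 (U y - u x - inner ℝ (Du x) (y - x))) :=
    (hUy.sub_const _).sub (tendsto_const_nhds.inner (hid.sub_const x))
  have hr : Tendsto (fun z => quadForm S (z - x)) (𝓝[G ∩ V] y) (𝓝 (quadForm S (y - x))) :=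
    ((continuous_quadForm S).tendsto _).comp (hid.sub_const x)
  have hkey : ∀ᶠ z in 𝓝[G ∩ V] y,
      U z - u x - inner ℝ (Du x) (z - x) ∈ Icc 0 (quadForm S (z - x)) := by
    filter_upwards [self_mem_nhdsWithin] with z hz
    rw [hUu hz.1]
    exact taylor_bounds hΩ hu hDu hH hw hw' hV hVc hVΩ hx hz.2 hxG hz.1 le_rfl (hS _)
      (by filter_upwards [hb] with w hw using hw _)
  exact ⟨ge_of_tendsto hl (hkey.mono fun z hz => hz.1),
    le_of_tendsto_of_tendsto hl hr (hkey.mono fun z hz => hz.2)⟩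

end Taylor

/-! ### Interpolation error on an element -/

section Element

variable {d : ℕ}

/-- An affine function with small oscillation on a cell has a small gradient. -/
lemma abs_linear_le_of_mem_Icc {Khat s : Finset (Euc d)} {F : Euc d →ᵃ[ℝ] Euc d}
    (hF : F '' cell Khat = cell s) {c : Euc d} {ρ : ℝ} (hρ : 0 < ρ)
    (hball : Metric.closedBall c ρ ⊆ cell Khat) {q : Euc d →ᵃ[ℝ] ℝ} {E : ℝ}
    (hq : ∀ x ∈ cell s, q x ∈ Icc 0 E) (w : Euc d) :
    |q.linear (F.linear w)| ≤ E / ρ * ‖w‖ := by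
  rcases eq_or_ne w 0 with rfl | hw
  · simp
  have hw0 : 0 < ‖w‖ := norm_pos_iff.2 hw
  -- The point at distance `ρ` from the centre in the direction `w` still lies in the reference
  -- cell, so `q` changes by at most `E` between the images of `c` and `a`.
  set a := c + (ρ / ‖w‖) • w with ha
  have hmemc : F c ∈ cell s := hF ▸ mem_image_of_mem F (hball (Metric.mem_closedBall_self hρ.le))
  have hmema : F a ∈ cell s := by
    refine hF ▸ mem_image_of_mem F (hball ?_)
    rw [Metric.mem_closedBall, dist_eq_norm, ha, add_sub_cancel_left, norm_smul, Real.norm_eq_abs,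
      abs_of_pos (by positivity), div_mul_cancel₀ _ hw0.ne']
  have h1 : q (F a) - q (F c) = ρ / ‖w‖ * q.linear (F.linear w) := by
    have e1 := q.linearMap_vsub (F a) (F c)
    have e2 := F.linearMap_vsub a c
    simp only [vsub_eq_sub] at e1 e2
    rw [← e1, ← e2, ha, add_sub_cancel_left, map_smul, map_smul, smul_eq_mul]
  have h2 := hq _ hmema
  have h3 := hq _ hmemc
  have h4 : |q (F a) - q (F c)| ≤ E := abs_le.2 ⟨by linarith [h2.1, h3.2], by linarith [h2.2, h3.1]⟩
  rw [h1, abs_mul, abs_of_pos (by positivity : 0 < ρ / ‖w‖)] at h4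
  rw [div_mul_eq_mul_div, le_div_iff₀ hρ]
  rw [div_mul_eq_mul_div, div_le_iff₀ hw0] at h4
  linarith

/-- The bound for the gradient of the interpolation error on an element. -/
noncomputable def gradErrorBound (Dhat ρ Cp : ℝ) (S J : Matrix (Fin d) (Fin d) ℝ) : ℝ :=
  Cp * (Jᵀ * S * J).trace * Dhat ^ 2 / ρ * √(invJacobianBound S J)

variable {Khat s : Finset (Euc d)} {F : Euc d →ᵃ[ℝ] Euc d} {c : Euc d} {ρ Dhat : ℝ}
  {S : Matrix (Fin d) (Fin d) ℝ}

lemma norm_le_sqrt_invJacobianBound_mul (hd : 1 ≤ d) (hS : S.PosDef)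
    (hJ : (jacobian F).det ≠ 0) (w : Euc d) :
    ‖w‖ ≤ √(invJacobianBound S (jacobian F)) * ‖F.linear w‖ := by
  have h := norm_sq_le_invJacobianBound_mul hd hS hJ w
  rw [toLp_jacobian_mulVec] at h
  calc ‖w‖ = √(‖w‖ ^ 2) := (Real.sqrt_sq (norm_nonneg _)).symm
    _ ≤ √(invJacobianBound S (jacobian F) * ‖F.linear w‖ ^ 2) := Real.sqrt_le_sqrt h
    _ = _ := by rw [Real.sqrt_mul (invJacobianBound_nonneg hS hJ), Real.sqrt_sq (norm_nonneg _)]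

/-- On the reference element `y - x` becomes `J (b - a)`, and the form of `Jᵀ S J` is bounded by its
trace. -/
lemma quadForm_sub_le (hF : F '' cell Khat = cell s)
    (hD : ∀ a ∈ cell Khat, ∀ b ∈ cell Khat, ‖a - b‖ ≤ Dhat) (hS : S.PosDef)
    (hJ : (jacobian F).det ≠ 0) {x y : Euc d} (hx : x ∈ cell s) (hy : y ∈ cell s) :
    quadForm S (y - x) ≤ ((jacobian F)ᵀ * S * jacobian F).trace * Dhat ^ 2 := by
  rw [← hF] at hx hy
  obtain ⟨a, ha, rfl⟩ := hx
  obtain ⟨b, hb, rfl⟩ := hy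
  have hB := (posDef_transpose_mul_mul hS hJ).posSemidef
  have e := F.linearMap_vsub b a
  simp only [vsub_eq_sub] at e
  rw [← e, ← toLp_jacobian_mulVec, ← quadForm_conj]
  refine (hB.quadForm_le_trace _).trans ?_
  have := hB.trace_nonneg
  have := hD b hb a ha
  gcongr

/-- The error of the affine interpolant of a function with the Taylor expansion
`a₀ + w₀ · (y - x)` at `x`. -/
lemma interpolation_error_bounds (hd : 1 ≤ d) (hF : F '' cell Khat = cell s) (hρ : 0 < ρ)
    (hball : Metric.closedBall c ρ ⊆ cell Khat)
    (hD : ∀ a ∈ cell Khat, ∀ b ∈ cell Khat, ‖a - b‖ ≤ Dhat) (hS : S.PosDef)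
    (hJ : (jacobian F).det ≠ 0) {Cp : ℝ} (hCp : 0 ≤ Cp) {x : Euc d} (hx : x ∈ cell s)
    {p : Euc d →ᵃ[ℝ] ℝ} {a₀ : ℝ} {w₀ : Euc d}
    (hT : ∀ v ∈ s, p v - a₀ - inner ℝ w₀ (v - x) ∈ Icc 0 (Cp * quadForm S (v - x))) :
    |p x - a₀| ≤ Cp * ((jacobian F)ᵀ * S * jacobian F).trace * Dhat ^ 2 ∧
      ∀ w, |p.linear w - inner ℝ w₀ w| ≤ gradErrorBound Dhat ρ Cp S (jacobian F) * ‖w‖ := by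
  set E := Cp * ((jacobian F)ᵀ * S * jacobian F).trace * Dhat ^ 2 with hE
  -- The interpolant minus the Taylor polynomial at `x` is affine, so bounds at the vertices hold on
  -- the whole cell by convexity. Its value and its gradient at `x` are the two interpolation
  -- errors.
  let q : Euc d →ᵃ[ℝ] ℝ := p - ((innerSL ℝ w₀).toLinearMap.toAffineMap +
    AffineMap.const ℝ (Euc d) (a₀ - inner ℝ w₀ x))
  have hq : ∀ y, q y = p y - a₀ - inner ℝ w₀ (y - x) := fun y => by
    simp only [q, AffineMap.coe_sub, AffineMap.coe_add, Pi.sub_apply, Pi.add_apply,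
      AffineMap.const_apply, LinearMap.coe_toAffineMap, ContinuousLinearMap.coe_coe,
      innerSL_apply_apply, inner_sub_right]
    ring
  have hql : ∀ w, q.linear w = p.linear w - inner ℝ w₀ w := fun w => by
    simp [q]
  have hvert : ∀ v ∈ s, q v ∈ Icc 0 E := fun v hv => by
    have h1 := hT v hv
    have h2 := quadForm_sub_le hF hD hS hJ hx (subset_cell s hv)
    rw [hq]
    refine ⟨h1.1, h1.2.trans ?_⟩
    rw [hE, mul_assoc]
    gcongr
  have hcell : ∀ y ∈ cell s, q y ∈ Icc 0 E := by
    have : cell s ⊆ q ⁻¹' (Icc 0 E) :=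
      convexHull_min (fun v hv => hvert v hv) ((convex_Icc (0 : ℝ) E).affine_preimage q)
    exact this
  constructor
  · have := hcell x hx
    rw [hq, sub_self, inner_zero_right, sub_zero] at this
    rw [abs_of_nonneg this.1]
    exact this.2
  · intro w
    have hsurj : Function.Surjective F.linear := by
      rw [det_jacobian] at hJ
      exact (LinearMap.equivOfDetNeZero F.linear hJ).surjective
    obtain ⟨w, rfl⟩ := hsurj w
    rw [← hql]
    refine (abs_linear_le_of_mem_Icc hF hρ hball hcell w).trans ?_
    have hE0 : 0 ≤ E := (hcell x hx).1.trans (hcell x hx).2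
    rw [gradErrorBound, ← hE, mul_assoc]
    have := norm_le_sqrt_invJacobianBound_mul hd hS hJ w
    gcongr

/-- The size of the inverse Jacobian is bounded below in terms of the diameter of the cell. -/
lemma le_sqrt_invJacobianBound_mul (hd : 1 ≤ d) (hF : F '' cell Khat = cell s) (hρ : 0 < ρ)
    (hball : Metric.closedBall c ρ ⊆ cell Khat) (hS : S.PosDef) (hJ : (jacobian F).det ≠ 0)
    {D : ℝ} (hD : ∀ a ∈ cell s, ∀ b ∈ cell s, ‖a - b‖ ≤ D) :
    ρ ≤ √(invJacobianBound S (jacobian F)) * D := by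
  set w : Euc d := EuclideanSpace.single ⟨0, hd⟩ ρ with hw
  have hwn : ‖w‖ = ρ := by
    rw [hw, PiLp.norm_single, Real.norm_of_nonneg hρ.le]
  have hmemc : F c ∈ cell s := hF ▸ mem_image_of_mem F (hball (Metric.mem_closedBall_self hρ.le))
  have hmema : F (c + w) ∈ cell s := by
    refine hF ▸ mem_image_of_mem F (hball ?_)
    rw [Metric.mem_closedBall, dist_eq_norm, add_sub_cancel_left, hwn]
  have e := F.linearMap_vsub (c + w) c
  simp only [vsub_eq_sub, add_sub_cancel_left] at e
  calc ρ = ‖w‖ := hwn.symm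
    _ ≤ _ := norm_le_sqrt_invJacobianBound_mul hd hS hJ w
    _ ≤ _ := by
      rw [e]
      gcongr
      exact hD _ hmema _ hmemc

lemma gradErrorBound_nonneg (hρ : 0 < ρ) (hS : S.PosDef) {J : Matrix (Fin d) (Fin d) ℝ}
    (hJ : J.det ≠ 0) {Cp : ℝ} (hCp : 0 ≤ Cp) : 0 ≤ gradErrorBound Dhat ρ Cp S J := by
  have := (posDef_transpose_mul_mul hS hJ).posSemidef.trace_nonneg
  unfold gradErrorBound
  positivity

lemma volume_mul_gradErrorBound_sq_le (hd : 1 ≤ d) (hS : S.PosDef)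
    {J : Matrix (Fin d) (Fin d) ℝ} {V Cali Cp : ℝ} (hV : V = |J.det|) (hV0 : 0 < V)
    (h : 1 / (d : ℝ) * (Jᵀ * metricTensor S * J).trace ≤
      Cali * V ^ ((2 : ℝ) / d) * (metricTensor S).det ^ ((1 : ℝ) / d)) :
    V * gradErrorBound Dhat ρ Cp S J ^ 2 ≤ (Dhat ^ 2 / ρ) ^ 2 * Cp ^ 2 * ((d * Cali) ^ (d + 1) *
        (V * (metricTensor S).det ^ ((1 : ℝ) / 2)) ^ (((d : ℝ) + 2) / d)) := by
  have hJ : J.det ≠ 0 := by rw [← abs_pos, ← hV]; exact hV0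
  have key := volume_mul_trace_sq_mul_le hd hS hV hV0 h
  have e : V * gradErrorBound Dhat ρ Cp S J ^ 2 = (Dhat ^ 2 / ρ) ^ 2 * Cp ^ 2 *
      (V * (Jᵀ * S * J).trace ^ 2 * invJacobianBound S J) := by
    rw [gradErrorBound, mul_pow, Real.sq_sqrt (invJacobianBound_nonneg hS hJ)]
    ring
  rw [e]
  gcongr

end Element

/-! ### Piecewise Lipschitz functions -/

section PiecewiseLipschitz

/-- Induction on the number of sets. From `a`, which lies in some `C i`, one jumps to the last point
`c` of `C i` in the interval. Beyond `c` this set is never met again, so the other sets cover the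
rest, including `c` itself because they are closed. -/
lemma abs_sub_le_of_Icc_subset_iUnion {ι : Type*} {f : ℝ → ℝ} {L : ℝ} {C : ι → Set ℝ}
    (hC : ∀ i, IsClosed (C i)) (hf : ∀ i, ∀ x ∈ C i, ∀ y ∈ C i, |f x - f y| ≤ L * |x - y|) {b : ℝ}
    (t : Finset ι) : ∀ a ≤ b, Icc a b ⊆ ⋃ i ∈ t, C i → |f b - f a| ≤ L * (b - a) := by
  classical
  induction t using Finset.strongInduction with
  | H t ih =>
    intro a hab hcov
    obtain ⟨i, hit, hai⟩ : ∃ i ∈ t, a ∈ C i := by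
      simpa using hcov (left_mem_Icc.2 hab)
    have hcomp : IsCompact (C i ∩ Icc a b) := isCompact_Icc.inter_left (hC i)
    obtain ⟨c, ⟨hci, hcab⟩, hmax⟩ := hcomp.exists_isGreatest ⟨a, hai, left_mem_Icc.2 hab⟩
    have h1 : |f c - f a| ≤ L * (c - a) := by
      have := hf i c hci a hai
      rwa [abs_of_nonneg (sub_nonneg.2 hcab.1)] at this
    rcases hcab.2.eq_or_lt with rfl | hcb
    · exact h1
    have hsub : Ioc c b ⊆ ⋃ j ∈ t.erase i, C j := fun y hy => by
      obtain ⟨j, hjt, hyj⟩ : ∃ j ∈ t, y ∈ C j := by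
        simpa using hcov ⟨hcab.1.trans hy.1.le, hy.2⟩
      have hji : j ≠ i := by
        rintro rfl
        exact absurd (hmax ⟨hyj, hcab.1.trans hy.1.le, hy.2⟩) (not_le.2 hy.1)
      simp only [mem_iUnion]
      exact ⟨j, Finset.mem_erase.2 ⟨hji, hjt⟩, hyj⟩
    have hcl : IsClosed (⋃ j ∈ t.erase i, C j) :=
      (t.erase i).finite_toSet.isClosed_biUnion fun j _ => hC j
    have hsub' : Icc c b ⊆ ⋃ j ∈ t.erase i, C j := by
      rw [← closure_Ioc hcb.ne]
      exact closure_minimal hsub hcl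
    have h2 := ih _ (Finset.erase_ssubset hit) c hcb.le hsub'
    have h3 : |f b - f a| ≤ |f b - f c| + |f c - f a| := abs_sub_le _ _ _
    linarith

/-- The one-dimensional statement is applied along the segment from `x` to `y`. The pieces need not
be convex, which permits the complement of `Ω` as a piece. -/
lemma lipschitzWith_of_finite_closed_cover {E ι : Type*} [NormedAddCommGroup E] [NormedSpace ℝ E]
    {f : E → ℝ} {L : NNReal} {C : ι → Set E} (t : Finset ι) (hC : ∀ i, IsClosed (C i))
    (hf : ∀ i, ∀ x ∈ C i, ∀ y ∈ C i, |f x - f y| ≤ L * ‖x - y‖) (hcov : ⋃ i ∈ t, C i = univ) :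
    LipschitzWith L f := by
  refine LipschitzWith.of_dist_le_mul fun x y => ?_
  have hl : ∀ r r' : ℝ, ‖AffineMap.lineMap x y r - AffineMap.lineMap x y r'‖ =
      |r - r'| * ‖x - y‖ := fun r r' => by
    rw [← dist_eq_norm, dist_lineMap_lineMap, Real.dist_eq, dist_eq_norm]
  have := abs_sub_le_of_Icc_subset_iUnion (f := fun r : ℝ => f (AffineMap.lineMap x y r))
    (L := L * ‖x - y‖) (C := fun i => (fun r : ℝ => AffineMap.lineMap x y r) ⁻¹' C i)
    (fun i => (hC i).preimage AffineMap.lineMap_continuous)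
    (fun i r hr r' hr' => by
      refine (hf i _ hr _ hr').trans_eq ?_
      rw [hl]
      ring) (b := 1) t 0 zero_le_one (fun r _ => by
        have : AffineMap.lineMap x y r ∈ ⋃ i ∈ t, C i := by rw [hcov]; trivial
        simpa using this)
  rw [Real.dist_eq, dist_eq_norm, abs_sub_comm]
  simpa using this

end PiecewiseLipschitz

/-! ### Mollification of Lipschitz functions -/

section MollifyLipschitz

variable {d : ℕ} {φ : ContDiffBump (0 : Euc d)} {w : Euc d → ℝ} {K : NNReal}

lemma mollify_univ_eq (x : Euc d) :
    mollify φ univ w x = ∫ t, φ.normed volume t * w (x - t) := by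
  rw [mollify_eq_convolution_swap MeasurableSet.univ, convolution_def]
  simp

lemma integrable_normed_mul (hw : Continuous w) (x : Euc d) :
    Integrable (fun t => φ.normed volume t * w (x - t)) := by
  refine Continuous.integrable_of_hasCompactSupport
    (φ.continuous_normed.mul (hw.comp (by fun_prop))) ?_
  exact φ.hasCompactSupport_normed.mul_right

lemma mollify_univ_sub (hw : Continuous w) (x y : Euc d) :
    mollify φ univ w x - mollify φ univ w y =
      ∫ t, φ.normed volume t * (w (x - t) - w (y - t)) := by
  rw [mollify_univ_eq, mollify_univ_eq,
    ← integral_sub (integrable_normed_mul hw x) (integrable_normed_mul hw y)]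
  simp only [mul_sub]

lemma contDiff_mollify_univ (hw : Continuous w) : ContDiff ℝ ∞ (mollify φ univ w) := by
  rw [show mollify φ univ w = _ from funext fun x => mollify_eq_convolution MeasurableSet.univ x,
    indicator_univ]
  exact φ.hasCompactSupport_normed.contDiff_convolution_right _ hw.locallyIntegrable
    φ.contDiff_normed

lemma lipschitzWith_mollify_univ (hw : LipschitzWith K w) :
    LipschitzWith K (mollify φ univ w) := by
  refine LipschitzWith.of_dist_le_mul fun x y => ?_
  rw [Real.dist_eq, mollify_univ_sub hw.continuous]
  have hb : ∀ t, ‖φ.normed volume t * (w (x - t) - w (y - t))‖ ≤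
      φ.normed volume t * (K * dist x y) := fun t => by
    rw [norm_mul, Real.norm_of_nonneg (φ.nonneg_normed t)]
    refine mul_le_mul_of_nonneg_left ?_ (φ.nonneg_normed t)
    have := hw.dist_le_mul (x - t) (y - t)
    rwa [dist_sub_right, Real.dist_eq, ← Real.norm_eq_abs] at this
  refine (norm_integral_le_of_norm_le (φ.integrable_normed.mul_const _)
    (Eventually.of_forall hb)).trans_eq ?_
  rw [integral_mul_const, φ.integral_normed, one_mul]

lemma abs_mollify_univ_sub_le (hw : LipschitzWith K w) (x : Euc d) :
    |mollify φ univ w x - w x| ≤ K * φ.rOut := by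
  rw [mollify_eq_convolution_swap MeasurableSet.univ, indicator_univ, ← Real.dist_eq]
  refine ContDiffBump.dist_normed_convolution_le hw.continuous.aestronglyMeasurable fun y hy => ?_
  refine (hw.dist_le_mul y x).trans ?_
  gcongr
  exact (Metric.mem_ball.1 hy).le

lemma mollify_univ_eq_zero {x : Euc d} (h : ∀ y ∈ Metric.ball x φ.rOut, w y = 0) :
    mollify φ univ w x = 0 := by
  rw [mollify, setIntegral_univ]
  refine integral_eq_zero_of_ae (Eventually.of_forall fun y => ?_)
  by_cases hy : y ∈ Metric.ball x φ.rOut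
  · simp [h y hy]
  · simp [normed_sub_eq_zero hy]

/-- Where a function is affine, so is its mollification. -/
lemma fderiv_mollify_univ (hw : Continuous w) {x : Euc d} {r : ℝ} (hr : φ.rOut < r)
    {ℓ : Euc d →L[ℝ] ℝ}
    (h : ∀ a ∈ Metric.ball x r, ∀ b ∈ Metric.ball x r, w a - w b = ℓ (a - b)) :
    fderiv ℝ (mollify φ univ w) x = ℓ := by
  have hev : mollify φ univ w =ᶠ[𝓝 x] fun y => mollify φ univ w x + ℓ (y - x) := by
    filter_upwards [Metric.ball_mem_nhds x (sub_pos.2 hr)] with y hy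
    rw [← sub_eq_iff_eq_add', mollify_univ_sub hw]
    have : ∀ t, φ.normed volume t * (w (y - t) - w (x - t)) = φ.normed volume t * ℓ (y - x) := by
      intro t
      by_cases ht : t ∈ Metric.ball (0 : Euc d) φ.rOut
      · have htn : ‖t‖ < φ.rOut := by simpa using ht
        have hyn : ‖y - x‖ < r - φ.rOut := by rw [← dist_eq_norm]; exact hy
        rw [h (y - t) ?_ (x - t) ?_, sub_sub_sub_cancel_right]
        · rw [Metric.mem_ball, dist_eq_norm]
          calc ‖y - t - x‖ = ‖(y - x) - t‖ := by congr 1; abel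
            _ ≤ ‖y - x‖ + ‖t‖ := norm_sub_le _ _
            _ < r := by linarith
        · rw [Metric.mem_ball, dist_eq_norm]
          calc ‖x - t - x‖ = ‖t‖ := by rw [sub_sub_cancel_left, norm_neg]
            _ < r := by linarith
      · have : φ.normed volume t = 0 := by
          rw [← Function.notMem_support, φ.support_normed_eq]; exact ht
        simp [this]
    simp only [this]
    rw [integral_mul_const, φ.integral_normed, one_mul]
  rw [hev.fderiv_eq]
  have : HasFDerivAt (fun y => mollify φ univ w x + ℓ (y - x)) ℓ x := by
    have h0 : HasFDerivAt (fun y : Euc d => y - x) (ContinuousLinearMap.id ℝ (Euc d)) x :=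
      (hasFDerivAt_id x).sub_const x
    exact (ℓ.hasFDerivAt.comp x h0).const_add _
  exact this.fderiv

end MollifyLipschitz

/-! ### Soft thresholding -/

section SoftThreshold

/-- Soft thresholding: moves `t` towards zero by `ε`. -/
noncomputable def softThreshold (ε t : ℝ) : ℝ := max (t - ε) 0 + min (t + ε) 0

lemma softThreshold_of_le {ε t : ℝ} (hε : 0 ≤ ε) (h : ε ≤ t) : softThreshold ε t = t - ε := by
  rw [softThreshold, max_eq_left (by linarith), min_eq_right (by linarith), add_zero]

lemma softThreshold_of_le_neg {ε t : ℝ} (hε : 0 ≤ ε) (h : t ≤ -ε) :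
    softThreshold ε t = t + ε := by
  rw [softThreshold, max_eq_right (by linarith), min_eq_left (by linarith), zero_add]

lemma softThreshold_of_abs_le {ε t : ℝ} (h : |t| ≤ ε) : softThreshold ε t = 0 := by
  have := abs_le.1 h
  rw [softThreshold, max_eq_right (by linarith), min_eq_right (by linarith), add_zero]

lemma abs_softThreshold_sub_le {ε : ℝ} (hε : 0 ≤ ε) (t : ℝ) : |softThreshold ε t - t| ≤ ε := by
  rcases le_total ε t with h | h
  · rw [softThreshold_of_le hε h]; simp [abs_of_nonneg hε]
  rcases le_total t (-ε) with h' | h'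
  · rw [softThreshold_of_le_neg hε h']; simp [abs_of_nonneg hε]
  · rw [softThreshold_of_abs_le (abs_le.2 ⟨h', h⟩), zero_sub, abs_neg]
    exact abs_le.2 ⟨h', h⟩

lemma softThreshold_mono_sub {ε a b : ℝ} (hε : 0 ≤ ε) (hab : a ≤ b) :
    0 ≤ softThreshold ε b - softThreshold ε a ∧
      softThreshold ε b - softThreshold ε a ≤ b - a := by
  unfold softThreshold
  rcases max_cases (b - ε) 0 with h1 | h1 <;> rcases max_cases (a - ε) 0 with h2 | h2 <;>
  rcases min_cases (b + ε) 0 with h3 | h3 <;> rcases min_cases (a + ε) 0 with h4 | h4 <;>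
  constructor <;> linarith

lemma lipschitzWith_softThreshold {ε : ℝ} (hε : 0 ≤ ε) : LipschitzWith 1 (softThreshold ε) := by
  refine LipschitzWith.of_dist_le_mul fun a b => ?_
  rw [NNReal.coe_one, one_mul, Real.dist_eq, Real.dist_eq]
  rcases le_total a b with h | h
  · have := softThreshold_mono_sub hε h
    rw [abs_sub_comm, abs_sub_comm a b, abs_of_nonneg this.1, abs_of_nonneg (sub_nonneg.2 h)]
    exact this.2
  · have := softThreshold_mono_sub hε h
    rw [abs_of_nonneg this.1, abs_of_nonneg (sub_nonneg.2 h)]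
    exact this.2

end SoftThreshold

/-! ### Finite element functions are limits of test functions -/

namespace SimplicialMesh

variable {d : ℕ} {Ω : Set (Euc d)} (T : SimplicialMesh Ω)

lemma indicator_eq_on_closure (hΩ : IsPolyhedralDomain Ω) {v : Euc d → ℝ} (hv : v ∈ T.feSpaceZero)
    {x : Euc d} (hx : x ∈ closure Ω) : Ω.indicator v x = v x := by
  by_cases hxΩ : x ∈ Ω
  · simp [hxΩ]
  · rw [indicator_of_notMem hxΩ, hv.2 x ⟨hx, by rwa [hΩ.isOpen.interior_eq]⟩]

/-- The extension by zero of a finite element function with zero boundary values is Lipschitz. -/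
lemma exists_lipschitzWith_indicator (hΩ : IsPolyhedralDomain Ω) {v : Euc d → ℝ}
    (hv : v ∈ T.feSpaceZero) : ∃ K : NNReal, LipschitzWith K (Ω.indicator v) := by
  classical
  choose! p hp using hv.1
  set L : Finset (Euc d) → ℝ := fun s => ‖(p s).linear.toContinuousLinearMap‖ with hL
  have hL0 : ∀ s, 0 ≤ L s := fun s => norm_nonneg _
  let K : NNReal := ⟨∑ s ∈ T.elems, L s, Finset.sum_nonneg fun s _ => hL0 s⟩
  -- The space is covered by the cells and the complement of `Ω`, where the extension is zero; the
  -- sum of the slopes serves all pieces.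
  let C : Option T.elems → Set (Euc d) := fun o => o.elim Ωᶜ fun s => cell s
  refine ⟨K, lipschitzWith_of_finite_closed_cover (C := C) Finset.univ ?_ ?_ ?_⟩
  · rintro (_ | s)
    · exact hΩ.isOpen.isClosed_compl
    · exact (isCompact_cell _).isClosed
  · rintro (_ | s) x hx y hy
    · have hx : x ∉ Ω := hx
      have hy : y ∉ Ω := hy
      rw [indicator_of_notMem hx, indicator_of_notMem hy]
      simp only [sub_self, abs_zero]
      positivity
    · have hx : x ∈ cell (s : Finset (Euc d)) := hx
      have hy : y ∈ cell (s : Finset (Euc d)) := hy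
      rw [T.indicator_eq_on_closure hΩ hv (T.cell_subset_closure s.2 hx),
        T.indicator_eq_on_closure hΩ hv (T.cell_subset_closure s.2 hy), hp s s.2 hx, hp s s.2 hy]
      have e := (p s).linearMap_vsub x y
      simp only [vsub_eq_sub] at e
      rw [← e]
      refine ((p s).linear.toContinuousLinearMap.le_opNorm (x - y)).trans ?_
      have : L s ≤ K := Finset.single_le_sum (f := L) (fun s _ => hL0 s) s.2
      gcongr
  · rw [eq_univ_iff_forall]
    intro x
    simp only [Finset.mem_univ, iUnion_true, mem_iUnion]
    by_cases hx : x ∈ Ω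
    · obtain ⟨s, hs, hxs⟩ := T.exists_mem_cell (subset_closure hx)
      exact ⟨some ⟨s, hs⟩, hxs⟩
    · exact ⟨none, hx⟩

lemma hasFDerivAt_of_eqOn_cell {v : Euc d → ℝ} {p : Euc d →ᵃ[ℝ] ℝ} {s : Finset (Euc d)}
    (hp : EqOn v p (cell s)) {x : Euc d} (hx : x ∈ interior (cell s)) :
    HasFDerivAt v p.linear.toContinuousLinearMap x := by
  have h1 : v =ᶠ[𝓝 x] p := by
    filter_upwards [isOpen_interior.mem_nhds hx] with y hy using hp (interior_subset hy)
  refine HasFDerivAt.congr_of_eventuallyEq ?_ h1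
  have h2 : ⇑p = fun y => p.linear.toContinuousLinearMap y + p 0 := by
    have := p.decomp
    simpa [funext_iff] using this
  rw [h2]
  exact p.linear.toContinuousLinearMap.hasFDerivAt.add_const _

/-- Near almost every point, soft thresholding shifts a finite element function by a constant. -/
lemma ae_softThreshold_affine (hΩ : IsPolyhedralDomain Ω) {v : Euc d → ℝ}
    (hv : v ∈ T.feSpace) : ∀ᵐ x ∂(volume.restrict Ω), ∃ r > 0, ∃ c > 0, ∀ ε, 0 ≤ ε → ε ≤ c →
      ∀ a ∈ Metric.ball x r, ∀ b ∈ Metric.ball x r,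
        softThreshold ε (Ω.indicator v a) - softThreshold ε (Ω.indicator v b) =
          fderiv ℝ v x (a - b) := by
  choose! p hp using hv
  -- Off this null set a piece that vanishes at `x` is identically zero. Otherwise its value keeps
  -- its sign and stays above half its modulus near `x`, so thresholds up to that half only shift it
  -- by a constant.
  have hnull : ∀ᵐ x ∂(volume.restrict Ω), ∀ s ∈ T.elems, (p s).linear ≠ 0 → p s x ≠ 0 := by
    refine ae_restrict_of_ae ((ae_ball_iff T.elems.countable_toSet).2 fun s _ => ?_)
    by_cases h : (p s).linear = 0
    · simp [h]
    · filter_upwards [measure_eq_zero_iff_ae_notMem.1 (volume_zeros_affineMap h)] with x hx _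
        using hx
  have hint := T.ae_mem_interior_cell
  rw [T.restrict_closure hΩ] at hint
  filter_upwards [hnull, hint] with x hx1 hx2
  obtain ⟨s, hs, hxs⟩ := hx2
  have hfd := (hasFDerivAt_of_eqOn_cell (hp s hs) hxs).fderiv
  have hval : ∀ a ∈ interior (cell s), Ω.indicator v a = p s a := fun a ha => by
    rw [indicator_of_mem (T.interior_cell_subset hΩ hs ha), hp s hs (interior_subset ha)]
  have hlin : ∀ a b, p s a - p s b = fderiv ℝ v x (a - b) := fun a b => by
    rw [hfd]
    have := (p s).linearMap_vsub a b
    simp only [vsub_eq_sub] at this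
    exact this.symm
  have hcont : Continuous (p s) := AffineMap.continuous_of_finiteDimensional _
  rcases lt_trichotomy (p s x) 0 with hneg | hzero | hpos
  · have hnb : interior (cell s) ∩ {a | p s a < p s x / 2} ∈ 𝓝 x :=
      inter_mem (isOpen_interior.mem_nhds hxs)
        ((isOpen_lt hcont continuous_const).mem_nhds (by simpa using by linarith))
    obtain ⟨r, hr, hsub⟩ := Metric.mem_nhds_iff.1 hnb
    refine ⟨r, hr, -(p s x / 2), by linarith, fun ε hε hεc a ha b hb => ?_⟩
    have ha2 : p s a < p s x / 2 := (hsub ha).2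
    have hb2 : p s b < p s x / 2 := (hsub hb).2
    rw [hval a (hsub ha).1, hval b (hsub hb).1, softThreshold_of_le_neg hε (by linarith),
      softThreshold_of_le_neg hε (by linarith), ← hlin]
    ring
  · have hl0 : (p s).linear = 0 := by
      by_contra hcon
      exact hx1 s hs hcon hzero
    have hfd0 : fderiv ℝ v x = 0 := by rw [hfd, hl0]; rfl
    obtain ⟨r, hr, hsub⟩ := Metric.mem_nhds_iff.1 (isOpen_interior.mem_nhds hxs)
    refine ⟨r, hr, 1, one_pos, fun ε _ _ a ha b hb => ?_⟩
    have h1 := hlin a b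
    rw [hfd0, zero_apply, sub_eq_zero] at h1
    rw [hval a (hsub ha), hval b (hsub hb), h1, hfd0]
    simp
  · have hnb : interior (cell s) ∩ {a | p s x / 2 < p s a} ∈ 𝓝 x :=
      inter_mem (isOpen_interior.mem_nhds hxs)
        ((isOpen_lt continuous_const hcont).mem_nhds (by simpa using by linarith))
    obtain ⟨r, hr, hsub⟩ := Metric.mem_nhds_iff.1 hnb
    refine ⟨r, hr, p s x / 2, by linarith, fun ε hε hεc a ha b hb => ?_⟩
    have ha2 : p s x / 2 < p s a := (hsub ha).2
    have hb2 : p s x / 2 < p s b := (hsub hb).2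
    rw [hval a (hsub ha).1, hval b (hsub hb).1, softThreshold_of_le hε (by linarith),
      softThreshold_of_le hε (by linarith), ← hlin]
    ring

/-- Finite element functions with zero boundary values are bounded limits of test functions,
together with their gradients. -/
lemma exists_testFunctions_tendsto (hΩ : IsPolyhedralDomain Ω) {v : Euc d → ℝ}
    (hv : v ∈ T.feSpaceZero) : ∃ (ψ : ℕ → Euc d → ℝ) (B : ℝ), (∀ k, ψ k ∈ testFunctions Ω) ∧
      (∀ k x, |ψ k x| ≤ B) ∧ (∀ k x, ‖gradient (ψ k) x‖ ≤ B) ∧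
      ∀ᵐ x ∂(volume.restrict Ω), Tendsto (fun k => ψ k x) atTop (𝓝 (v x)) ∧
        Tendsto (fun k => gradient (ψ k) x) atTop (𝓝 (gradient v x)) := by
  obtain ⟨K, hK⟩ := T.exists_lipschitzWith_indicator hΩ hv
  obtain ⟨m, hm⟩ := exists_nat_ge (2 * ((K : ℝ) + 1))
  have hK0 : (0 : ℝ) ≤ K := K.2
  set ve := Ω.indicator v with hve
  have hcs : HasCompactSupport ve :=
    HasCompactSupport.of_support_subset_isCompact T.isCompact_closure
      (support_indicator_subset.trans subset_closure)
  obtain ⟨B₁, hB₁⟩ := hcs.exists_bound_of_continuous hK.continuous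
  have hB₁0 : 0 ≤ B₁ := (norm_nonneg _).trans (hB₁ 0)
  set ε : ℕ → ℝ := fun k => 1 / ((k : ℝ) + 1) with hεdef
  have hε : ∀ k, 0 < ε k := fun k => by simp only [hεdef]; positivity
  have hε1 : ∀ k, ε k ≤ 1 := fun k => by
    simp only [hεdef]
    rw [div_le_one (by positivity)]
    have : (0 : ℝ) ≤ k := k.cast_nonneg
    linarith
  have hεlim : Tendsto ε atTop (𝓝 0) := tendsto_one_div_add_atTop_nhds_zero_nat
  -- The factor `m` makes the radius so small that `ve` varies by at most `ε k / 2` over the support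
  -- of the kernel.
  set φ : ℕ → ContDiffBump (0 : Euc d) := fun k => shrinkingBump d (m * (k + 1)) with hφ
  have hm0 : (0 : ℝ) < m := by linarith
  have hrad : ∀ k, (K + 1) * (φ k).rOut ≤ ε k / 2 := fun k => by
    simp only [hφ, shrinkingBump, hεdef]
    push_cast
    rw [mul_one_div, div_div, div_le_div_iff₀ (by positivity) (by positivity)]
    nlinarith [(k.cast_nonneg : (0 : ℝ) ≤ k)]
  have hrad' : ∀ k, (φ k).rOut ≤ ε k := fun k => by
    have h1 := hrad k
    have h2 := (φ k).rOut_pos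
    have h3 := hε k
    nlinarith
  have hKrad : ∀ k, K * (φ k).rOut ≤ ε k / 2 := fun k => by
    have h1 := hrad k
    have h2 := (φ k).rOut_pos
    nlinarith
  -- Thresholding makes the function vanish near the boundary, so that its mollification keeps a
  -- compact support in `Ω`, inside the set where `|ve| ≥ ε k / 2`.
  set w : ℕ → Euc d → ℝ := fun k x => softThreshold (ε k) (ve x) with hw
  have hwK : ∀ k, LipschitzWith K (w k) := fun k => by
    have := (lipschitzWith_softThreshold (hε k).le).comp hK
    rwa [one_mul] at this
  set ψ : ℕ → Euc d → ℝ := fun k => mollify (φ k) univ (w k) with hψ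
  have hψv : ∀ k x, |ψ k x - ve x| ≤ 2 * ε k := fun k x => by
    have h1 := abs_mollify_univ_sub_le (φ := φ k) (hwK k) x
    have h2 := abs_softThreshold_sub_le (hε k).le (ve x)
    have h3 := abs_sub_le (ψ k x) (w k x) (ve x)
    have h4 := hKrad k
    have h5 := hε k
    calc |ψ k x - ve x| ≤ |ψ k x - w k x| + |w k x - ve x| := h3
      _ ≤ K * (φ k).rOut + ε k := add_le_add h1 h2
      _ ≤ _ := by linarith
  refine ⟨ψ, max (B₁ + 2) K, fun k => ⟨contDiff_mollify_univ (hwK k).continuous, ?_⟩,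
    fun k x => ?_, fun k x => ?_, ?_⟩
  · have hsupp : Function.support (ψ k) ⊆ {x | ε k / 2 ≤ |ve x|} := by
      intro x hx
      by_contra hcon
      simp only [mem_ofPred_eq, not_le] at hcon
      refine hx (mollify_univ_eq_zero fun y hy => softThreshold_of_abs_le ?_)
      have h1 := hK.dist_le_mul y x
      rw [Real.dist_eq] at h1
      have h2 : K * dist y x ≤ K * (φ k).rOut := by
        have := (Metric.mem_ball.1 hy).le
        gcongr
      have h3 := hKrad k
      have h4 := abs_sub_abs_le_abs_sub (ve y) (ve x)
      linarith
    have hclosed : IsClosed {x | ε k / 2 ≤ |ve x|} :=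
      isClosed_le continuous_const hK.continuous.abs
    have hts : tsupport (ψ k) ⊆ {x | ε k / 2 ≤ |ve x|} := closure_minimal hsupp hclosed
    have hsubΩ : {x | ε k / 2 ≤ |ve x|} ⊆ Ω := fun x hx => by
      by_contra hcon
      have h0 : ve x = 0 := indicator_of_notMem hcon v
      have hx : ε k / 2 ≤ |ve x| := hx
      rw [h0, abs_zero] at hx
      linarith [hε k]
    refine ⟨?_, hts.trans hsubΩ⟩
    exact T.isCompact_closure.of_isClosed_subset (isClosed_tsupport _)
      (hts.trans (hsubΩ.trans subset_closure))
  · refine le_trans ?_ (le_max_left _ _)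
    have h1 := hψv k x
    have h2 := hB₁ x
    rw [Real.norm_eq_abs] at h2
    have h3 := hε1 k
    have h4 := abs_sub_abs_le_abs_sub (ψ k x) (ve x)
    linarith
  · refine le_trans ?_ (le_max_right _ _)
    rw [norm_gradient]
    exact norm_fderiv_le_of_lipschitz ℝ (lipschitzWith_mollify_univ (hwK k))
  · filter_upwards [ae_restrict_mem hΩ.isOpen.measurableSet, T.ae_softThreshold_affine hΩ hv.1]
      with x hxΩ hx
    constructor
    · have hvx : ve x = v x := indicator_of_mem hxΩ v
      rw [← hvx, tendsto_iff_dist_tendsto_zero]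
      refine squeeze_zero (fun k => dist_nonneg) (fun k => hψv k x) ?_
      simpa using hεlim.const_mul 2
    · obtain ⟨r, hr, c, hc, haff⟩ := hx
      -- At almost every point the gradients are eventually equal to the limit, because both
      -- thresholding and mollification preserve the local slope.
      refine tendsto_const_nhds.congr' ?_
      filter_upwards [hεlim (Iio_mem_nhds hr), hεlim (Iio_mem_nhds hc)] with k hkr hkc
      have hkr : ε k < r := hkr
      have hkc : ε k < c := hkc
      have := fderiv_mollify_univ (φ := φ k) (hwK k).continuous ((hrad' k).trans_lt hkr)
        (haff (ε k) (hε k).le hkc.le)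
      rw [gradient, gradient, this]

end SimplicialMesh

/-! ### Regularity of finite element functions -/

section FERegularity

variable {d : ℕ} {Ω : Set (Euc d)}

lemma measurable_gradient (v : Euc d → ℝ) : Measurable (gradient v) :=
  (InnerProductSpace.toDual ℝ (Euc d)).symm.continuous.measurable.comp (measurable_fderiv ℝ v)

namespace SimplicialMesh

variable (T : SimplicialMesh Ω)

lemma isFiniteMeasure_restrict (T : SimplicialMesh Ω) : IsFiniteMeasure (volume.restrict Ω) :=
  ⟨by
    rw [Measure.restrict_apply_univ]
    exact (measure_mono subset_closure).trans_lt T.isCompact_closure.measure_lt_top⟩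

lemma continuousOn_of_mem_feSpace {v : Euc d → ℝ} (hv : v ∈ T.feSpace) :
    ContinuousOn v (closure Ω) := by
  have hcov : closure Ω = ⋃ s : T.elems, cell (s : Finset (Euc d)) := by
    rw [T.cover, iUnion_subtype]
  rw [hcov]
  refine (locallyFinite_of_finite _).continuousOn_iUnion
    (fun s => (isCompact_cell _).isClosed) fun s => ?_
  obtain ⟨p, hp⟩ := hv s s.2
  exact (AffineMap.continuous_of_finiteDimensional p).continuousOn.congr hp

lemma exists_bounds_of_mem_feSpace (hΩ : IsPolyhedralDomain Ω) {v : Euc d → ℝ}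
    (hv : v ∈ T.feSpace) : ∃ B : ℝ, 0 ≤ B ∧ AEStronglyMeasurable v (volume.restrict Ω) ∧
      ∀ᵐ x ∂(volume.restrict Ω), |v x| ≤ B ∧ ‖gradient v x‖ ≤ B ∧ DifferentiableAt ℝ v x := by
  have hc := T.continuousOn_of_mem_feSpace hv
  obtain ⟨B₁, hB₁⟩ := T.isCompact_closure.exists_bound_of_continuousOn hc
  choose! p hp using hv
  set B₂ := ∑ s ∈ T.elems, ‖(p s).linear.toContinuousLinearMap‖ with hB₂
  have hB₂0 : 0 ≤ B₂ := Finset.sum_nonneg fun s _ => norm_nonneg _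
  refine ⟨max B₁ B₂, hB₂0.trans (le_max_right _ _), ?_, ?_⟩
  · exact (hc.mono subset_closure).aestronglyMeasurable hΩ.isOpen.measurableSet
  have hint := T.ae_mem_interior_cell
  rw [T.restrict_closure hΩ] at hint
  filter_upwards [hint, ae_restrict_mem hΩ.isOpen.measurableSet] with x hx hxΩ
  obtain ⟨s, hs, hxs⟩ := hx
  have hfd := hasFDerivAt_of_eqOn_cell (hp s hs) hxs
  refine ⟨(hB₁ x (subset_closure hxΩ)).trans (le_max_left _ _), ?_, hfd.differentiableAt⟩
  rw [norm_gradient, hfd.fderiv]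
  exact (Finset.single_le_sum (f := fun s => ‖(p s).linear.toContinuousLinearMap‖)
    (fun s _ => norm_nonneg _) hs).trans (le_max_right _ _)

lemma sub_mem_feSpace {v w : Euc d → ℝ} (hv : v ∈ T.feSpace) (hw : w ∈ T.feSpace) :
    v - w ∈ T.feSpace := by
  intro s hs
  obtain ⟨p, hp⟩ := hv s hs
  obtain ⟨q, hq⟩ := hw s hs
  exact ⟨p - q, fun x hx => by simp [hp hx, hq hx]⟩

end SimplicialMesh

end FERegularity

/-! ### The bilinear form -/

section Form

variable {d : ℕ} {Ω : Set (Euc d)} (L : SecondOrderOperator d)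

/-- The integrand of the bilinear form. -/
noncomputable def SecondOrderOperator.density (v : ℝ) (Dv : Euc d) (w : ℝ) (Dw x : Euc d) : ℝ :=
  inner ℝ (L.A x Dv) Dw + inner ℝ (L.b x) Dv * w + L.c x * v * w

lemma SecondOrderOperator.density_sub (v v' : ℝ) (Dv Dv' : Euc d) (w : ℝ) (Dw x : Euc d) :
    L.density (v - v') (Dv - Dv') w Dw x = L.density v Dv w Dw x - L.density v' Dv' w Dw x := by
  simp only [SecondOrderOperator.density, map_sub, inner_sub_left, inner_sub_right]
  ring

lemma SecondOrderOperator.abs_density_le {κ : ℝ} {x : Euc d} (hA : ‖L.A x‖ ≤ κ) (hb : ‖L.b x‖ ≤ κ)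
    (hc : ‖L.c x‖ ≤ κ) (v : ℝ) (Dv : Euc d) (w : ℝ) (Dw : Euc d) :
    |L.density v Dv w Dw x| ≤ κ * (‖Dv‖ * ‖Dw‖ + ‖Dv‖ * |w| + |v| * |w|) := by
  have h1 : |inner ℝ (L.A x Dv) Dw| ≤ κ * ‖Dv‖ * ‖Dw‖ := by
    refine (abs_real_inner_le_norm _ _).trans ?_
    gcongr
    exact (L.A x).le_of_opNorm_le hA Dv
  have h2 : |inner ℝ (L.b x) Dv * w| ≤ κ * ‖Dv‖ * |w| := by
    rw [abs_mul]
    gcongr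
    exact (abs_real_inner_le_norm _ _).trans (by gcongr)
  have h3 : |L.c x * v * w| ≤ κ * |v| * |w| := by
    rw [abs_mul, abs_mul]
    gcongr
    exact hc
  calc |L.density v Dv w Dw x| ≤ |inner ℝ (L.A x Dv) Dw| + |inner ℝ (L.b x) Dv * w| +
        |L.c x * v * w| := abs_add_three _ _ _
    _ ≤ κ * ‖Dv‖ * ‖Dw‖ + κ * ‖Dv‖ * |w| + κ * |v| * |w| := by gcongr
    _ = _ := by ring

lemma MeasureTheory.MemLp.exists_ae_norm_le {α E : Type*} [MeasurableSpace α]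
    [NormedAddCommGroup E] {μ : Measure α} {f : α → E} (hf : MemLp f ⊤ μ) :
    ∃ C : ℝ, ∀ᵐ x ∂μ, ‖f x‖ ≤ C := by
  refine ⟨(eLpNorm f ⊤ μ).toReal, ?_⟩
  have h := ae_le_eLpNormEssSup (f := f) (μ := μ)
  rw [← eLpNorm_exponent_top] at h
  filter_upwards [h] with x hx
  rw [← toReal_enorm]
  exact ENNReal.toReal_mono hf.2.ne hx

variable {L}

lemma SecondOrderOperator.IsElliptic.exists_bound (hL : L.IsElliptic Ω) :
    ∃ κ : ℝ, 0 ≤ κ ∧ ∀ᵐ x ∂(volume.restrict Ω), ‖L.A x‖ ≤ κ ∧ ‖L.b x‖ ≤ κ ∧ ‖L.c x‖ ≤ κ := by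
  obtain ⟨a, ha⟩ := hL.memLp_A.exists_ae_norm_le
  obtain ⟨b, hb⟩ := hL.memLp_b.exists_ae_norm_le
  obtain ⟨c, hc⟩ := hL.memLp_c.exists_ae_norm_le
  refine ⟨|a| + |b| + |c|, by positivity, ?_⟩
  filter_upwards [ha, hb, hc] with x hxa hxb hxc
  have := le_abs_self a
  have := le_abs_self b
  have := le_abs_self c
  have := abs_nonneg a
  have := abs_nonneg b
  have := abs_nonneg c
  refine ⟨?_, ?_, ?_⟩ <;> linarith

lemma SecondOrderOperator.IsElliptic.aestronglyMeasurable_density (hL : L.IsElliptic Ω)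
    {v w : Euc d → ℝ} {Dv Dw : Euc d → Euc d}
    (hv : AEStronglyMeasurable v (volume.restrict Ω))
    (hDv : AEStronglyMeasurable Dv (volume.restrict Ω))
    (hw : AEStronglyMeasurable w (volume.restrict Ω))
    (hDw : AEStronglyMeasurable Dw (volume.restrict Ω)) :
    AEStronglyMeasurable (fun x => L.density (v x) (Dv x) (w x) (Dw x) x)
      (volume.restrict Ω) := by
  have h1 : AEStronglyMeasurable (fun x => L.A x (Dv x)) (volume.restrict Ω) :=
    (ContinuousLinearMap.id ℝ (Euc d →L[ℝ] Euc d)).aestronglyMeasurable_comp₂ hL.memLp_A.1 hDv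
  exact ((h1.inner hDw).add ((hL.memLp_b.1.inner hDv).mul hw)).add ((hL.memLp_c.1.mul hv).mul hw)

lemma SecondOrderOperator.IsElliptic.integrable_density (hL : L.IsElliptic Ω)
    {v w : Euc d → ℝ} {Dv Dw : Euc d → Euc d}
    (hv : IntegrableOn v Ω) (hDv : IntegrableOn Dv Ω)
    (hw : AEStronglyMeasurable w (volume.restrict Ω))
    (hDw : AEStronglyMeasurable Dw (volume.restrict Ω)) {B : ℝ}
    (hB : ∀ᵐ x ∂(volume.restrict Ω), |w x| ≤ B ∧ ‖Dw x‖ ≤ B) :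
    IntegrableOn (fun x => L.density (v x) (Dv x) (w x) (Dw x) x) Ω := by
  obtain ⟨κ, hκ0, hκ⟩ := hL.exists_bound
  have hbd : Integrable (fun x => κ * (‖Dv x‖ * B + ‖Dv x‖ * B + |v x| * B))
      (volume.restrict Ω) :=
    (((hDv.norm.mul_const B).add (hDv.norm.mul_const B)).add (hv.abs.mul_const B)).const_mul κ
  refine hbd.mono' (hL.aestronglyMeasurable_density hv.1 hDv.1 hw hDw) ?_
  filter_upwards [hκ, hB] with x hx hxB
  refine (L.abs_density_le hx.1 hx.2.1 hx.2.2 _ _ _ _).trans ?_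
  have := hxB.1
  have := hxB.2
  gcongr

/-- Dominated convergence. Both arguments may vary, so that it serves the weak formulation, where
the first one is fixed, as well as coercivity, where both are the approximations. -/
lemma SecondOrderOperator.IsElliptic.tendsto_integral_density (hL : L.IsElliptic Ω)
    {v : ℕ → Euc d → ℝ} {Dv : ℕ → Euc d → Euc d} {w : ℕ → Euc d → ℝ} {Dw : ℕ → Euc d → Euc d}
    {v' w' : Euc d → ℝ} {Dv' Dw' : Euc d → Euc d} {V DV : Euc d → ℝ} {B : ℝ}
    (hv : ∀ k, AEStronglyMeasurable (v k) (volume.restrict Ω))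
    (hDv : ∀ k, AEStronglyMeasurable (Dv k) (volume.restrict Ω))
    (hw : ∀ k, AEStronglyMeasurable (w k) (volume.restrict Ω))
    (hDw : ∀ k, AEStronglyMeasurable (Dw k) (volume.restrict Ω))
    (hV : IntegrableOn V Ω) (hDV : IntegrableOn DV Ω)
    (hvV : ∀ k, ∀ᵐ x ∂(volume.restrict Ω), |v k x| ≤ V x ∧ ‖Dv k x‖ ≤ DV x)
    (hB : ∀ k, ∀ᵐ x ∂(volume.restrict Ω), |w k x| ≤ B ∧ ‖Dw k x‖ ≤ B)
    (hlim : ∀ᵐ x ∂(volume.restrict Ω), Tendsto (fun k => v k x) atTop (𝓝 (v' x)) ∧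
      Tendsto (fun k => Dv k x) atTop (𝓝 (Dv' x)) ∧ Tendsto (fun k => w k x) atTop (𝓝 (w' x)) ∧
      Tendsto (fun k => Dw k x) atTop (𝓝 (Dw' x))) :
    Tendsto (fun k => ∫ x in Ω, L.density (v k x) (Dv k x) (w k x) (Dw k x) x) atTop
      (𝓝 (∫ x in Ω, L.density (v' x) (Dv' x) (w' x) (Dw' x) x)) := by
  obtain ⟨κ, hκ0, hκ⟩ := hL.exists_bound
  refine tendsto_integral_of_dominated_convergence
    (fun x => κ * (DV x * B + DV x * B + V x * B))
    (fun k => hL.aestronglyMeasurable_density (hv k) (hDv k) (hw k) (hDw k)) ?_ (fun k => ?_) ?_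
  · exact (((hDV.mul_const B).add (hDV.mul_const B)).add (hV.mul_const B)).const_mul κ
  · filter_upwards [hκ, hvV k, hB k] with x hx hxv hxB
    refine (L.abs_density_le hx.1 hx.2.1 hx.2.2 _ _ _ _).trans ?_
    have h1 := hxB.1
    have h2 := hxB.2
    have h3 := hxv.1
    have h4 := hxv.2
    have h5 := (norm_nonneg _).trans h4
    have h6 := (abs_nonneg _).trans h3
    gcongr
  · filter_upwards [hlim] with x hx
    obtain ⟨h1, h2, h3, h4⟩ := hx
    exact (((((L.A x).continuous.tendsto _).comp h2).inner h4).add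
      ((tendsto_const_nhds.inner h2).mul h3)).add ((h1.const_mul _).mul h3)

end Form

/-! ### Quasi-optimality of the finite element solution -/

section Cea

variable {d : ℕ} {Ω : Set (Euc d)} {L : SecondOrderOperator d}

lemma integrableOn_euc {Dv : Euc d → Euc d} (h : ∀ i, IntegrableOn (fun x => Dv x i) Ω) :
    IntegrableOn Dv Ω := by
  have e : Dv = fun x => ∑ i, Dv x i • EuclideanSpace.single i (1 : ℝ) :=
    funext fun x => euc_eq_sum (Dv x)
  rw [e]
  exact integrable_finsetSum _ fun i _ => (h i).smul_const _

lemma aestronglyMeasurable_testFunction {ψ : Euc d → ℝ} (hψ : ψ ∈ testFunctions Ω)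
    (μ : Measure (Euc d)) : AEStronglyMeasurable ψ μ :=
  hψ.1.continuous.aestronglyMeasurable

lemma aestronglyMeasurable_gradient (v : Euc d → ℝ) (μ : Measure (Euc d)) :
    AEStronglyMeasurable (gradient v) μ :=
  (measurable_gradient v).aestronglyMeasurable

namespace SimplicialMesh

variable (T : SimplicialMesh Ω)

/-- The weak formulation holds for finite element functions with zero boundary values. -/
lemma weak_form_of_mem_feSpaceZero (hΩ : IsPolyhedralDomain Ω) (hL : L.IsElliptic Ω)
    {f u : Euc d → ℝ} {Du : Euc d → Euc d} (hf : IntegrableOn f Ω) (hu : IntegrableOn u Ω)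
    (hDu : IntegrableOn Du Ω)
    (hweak : ∀ φ ∈ testFunctions Ω, L.form Ω u Du φ = ∫ x in Ω, f x * φ x)
    {e : Euc d → ℝ} (he : e ∈ T.feSpaceZero) : L.form Ω u Du e = ∫ x in Ω, f x * e x := by
  obtain ⟨ψ, B, hψ, hψB, hDψB, hlim⟩ := T.exists_testFunctions_tendsto hΩ he
  have h1 : Tendsto (fun k => L.form Ω u Du (ψ k)) atTop (𝓝 (L.form Ω u Du e)) :=
    hL.tendsto_integral_density (v := fun _ => u) (Dv := fun _ => Du) (V := fun x => |u x|)
      (DV := fun x => ‖Du x‖) (B := B) (fun _ => hu.1) (fun _ => hDu.1)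
      (fun k => aestronglyMeasurable_testFunction (hψ k) _)
      (fun k => aestronglyMeasurable_gradient _ _) hu.abs hDu.norm
      (fun _ => Eventually.of_forall fun x => ⟨le_rfl, le_rfl⟩)
      (fun k => Eventually.of_forall fun x => ⟨hψB k x, hDψB k x⟩)
      (by filter_upwards [hlim] with x hx
            using ⟨tendsto_const_nhds, tendsto_const_nhds, hx.1, hx.2⟩)
  have h2 : Tendsto (fun k => ∫ x in Ω, f x * ψ k x) atTop (𝓝 (∫ x in Ω, f x * e x)) := by
    refine tendsto_integral_of_dominated_convergence (fun x => |f x| * B)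
      (fun k => hf.1.mul (aestronglyMeasurable_testFunction (hψ k) _)) (hf.abs.mul_const B)
      (fun k => Eventually.of_forall fun x => ?_) ?_
    · rw [norm_mul]
      exact mul_le_mul_of_nonneg_left (hψB k x) (norm_nonneg _)
    · filter_upwards [hlim] with x hx using hx.1.const_mul _
  simp only [fun k => hweak (ψ k) (hψ k)] at h1
  exact tendsto_nhds_unique h1 h2

/-- Coercivity for finite element functions with zero boundary values. -/
lemma coercive_of_mem_feSpaceZero (hΩ : IsPolyhedralDomain Ω) (hL : L.IsElliptic Ω) {α : ℝ}
    (hα : ∀ φ ∈ testFunctions Ω,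
      α * ∫ x in Ω, (φ x ^ 2 + ‖gradient φ x‖ ^ 2) ≤ L.form Ω φ (gradient φ) φ)
    {e : Euc d → ℝ} (he : e ∈ T.feSpaceZero) :
    α * ∫ x in Ω, (e x ^ 2 + ‖gradient e x‖ ^ 2) ≤ L.form Ω e (gradient e) e := by
  have := T.isFiniteMeasure_restrict
  obtain ⟨ψ, B, hψ, hψB, hDψB, hlim⟩ := T.exists_testFunctions_tendsto hΩ he
  have h1 : Tendsto (fun k => L.form Ω (ψ k) (gradient (ψ k)) (ψ k)) atTop
      (𝓝 (L.form Ω e (gradient e) e)) :=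
    hL.tendsto_integral_density (V := fun _ => B) (DV := fun _ => B) (B := B)
      (fun k => aestronglyMeasurable_testFunction (hψ k) _)
      (fun k => aestronglyMeasurable_gradient _ _)
      (fun k => aestronglyMeasurable_testFunction (hψ k) _)
      (fun k => aestronglyMeasurable_gradient _ _) (integrable_const B) (integrable_const B)
      (fun k => Eventually.of_forall fun x => ⟨hψB k x, hDψB k x⟩)
      (fun k => Eventually.of_forall fun x => ⟨hψB k x, hDψB k x⟩)
      (by filter_upwards [hlim] with x hx using ⟨hx.1, hx.2, hx.1, hx.2⟩)
  have h2 : Tendsto (fun k => ∫ x in Ω, (ψ k x ^ 2 + ‖gradient (ψ k) x‖ ^ 2)) atTop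
      (𝓝 (∫ x in Ω, (e x ^ 2 + ‖gradient e x‖ ^ 2))) := by
    refine tendsto_integral_of_dominated_convergence (fun _ => B ^ 2 + B ^ 2)
      (fun k => ((aestronglyMeasurable_testFunction (hψ k) _).pow 2).add
        ((aestronglyMeasurable_gradient _ _).norm.pow 2)) (integrable_const _)
      (fun k => Eventually.of_forall fun x => ?_) ?_
    · rw [Real.norm_of_nonneg (by positivity), ← sq_abs (ψ k x)]
      have := hψB k x
      have := hDψB k x
      gcongr
    · filter_upwards [hlim] with x hx using (hx.1.pow 2).add (hx.2.norm.pow 2)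
  exact le_of_tendsto_of_tendsto' (h2.const_mul α) h1 fun k => hα _ (hψ k)

end SimplicialMesh

/-- Quasi-optimality: the error of the finite element solution is bounded by any bound of the error
of a finite element function with the same boundary values. -/
theorem exists_quasi_optimality_constant (hΩ : IsPolyhedralDomain Ω) (hL : L.IsElliptic Ω) (D : ℝ) :
    ∃ C > 0, ∀ (T : SimplicialMesh Ω) (f u : Euc d → ℝ) (Du : Euc d → Euc d),
      IntegrableOn f Ω → IntegrableOn u Ω → IntegrableOn Du Ω →
      (∀ φ ∈ testFunctions Ω, L.form Ω u Du φ = ∫ x in Ω, f x * φ x) →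
      ∀ uh ∈ T.feSpace, ∀ I ∈ T.feSpace, uh - I ∈ T.feSpaceZero →
      (∀ v ∈ T.feSpaceZero, L.form Ω uh (gradient uh) v = ∫ x in Ω, f x * v x) →
      ∀ E : Euc d → ℝ, IntegrableOn E Ω →
      (∀ᵐ x ∂(volume.restrict Ω), ‖Du x - gradient I x‖ ^ 2 ≤ E x ∧
        (u x - I x) ^ 2 ≤ D ^ 2 * E x) →
      IntegrableOn (fun x => ‖Du x - gradient uh x‖ ^ 2) Ω ∧
      ∫ x in Ω, ‖Du x - gradient uh x‖ ^ 2 ≤ C * ∫ x in Ω, E x := by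
  obtain ⟨κ, hκ0, hκ⟩ := hL.exists_bound
  obtain ⟨α, hα0, hα⟩ := hL.coercive
  -- The constant of Young's inequality below: the gradient of the interpolation error enters twice
  -- and its value, bounded through `D`, once.
  set C₁ : ℝ := κ ^ 2 * (2 + D ^ 2) / α with hC₁
  have hC₁0 : 0 ≤ C₁ := by positivity
  refine ⟨2 + 4 * C₁ / α, by positivity, ?_⟩
  intro T f u Du hf hu hDu hweak uh huh I hI he hgal E hE hbd
  have := T.isFiniteMeasure_restrict
  set e := uh - I with hedef
  obtain ⟨B₁, hB₁0, hm₁, hb₁⟩ := T.exists_bounds_of_mem_feSpace hΩ huh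
  obtain ⟨B₂, hB₂0, hm₂, hb₂⟩ := T.exists_bounds_of_mem_feSpace hΩ hI
  obtain ⟨B, hB0, hme, hbe⟩ := T.exists_bounds_of_mem_feSpace hΩ he.1
  have hge : ∀ᵐ x ∂(volume.restrict Ω), gradient e x = gradient uh x - gradient I x := by
    filter_upwards [hb₁, hb₂] with x hx1 hx2
    rw [gradient, gradient, gradient, hedef, fderiv_sub hx1.2.2 hx2.2.2, map_sub]
  have hBe : ∀ᵐ x ∂(volume.restrict Ω), |e x| ≤ B ∧ ‖gradient e x‖ ≤ B := by
    filter_upwards [hbe] with x hx using ⟨hx.1, hx.2.1⟩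
  have hfe : ∀ {w : Euc d → ℝ} {b : ℝ}, AEStronglyMeasurable w (volume.restrict Ω) →
      (∀ᵐ x ∂(volume.restrict Ω), |w x| ≤ b ∧ ‖gradient w x‖ ≤ b ∧ DifferentiableAt ℝ w x) →
      IntegrableOn w Ω ∧ IntegrableOn (gradient w) Ω := fun hw hb =>
    ⟨Integrable.of_bound hw _ (hb.mono fun x hx => hx.1),
      Integrable.of_bound (aestronglyMeasurable_gradient _ _) _ (hb.mono fun x hx => hx.2.1)⟩
  have hIi := hfe hm₂ hb₂
  have huhi := hfe hm₁ hb₁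
  have hgm := aestronglyMeasurable_gradient e (volume.restrict Ω)
  have key1 : L.form Ω u Du e = L.form Ω uh (gradient uh) e := by
    rw [T.weak_form_of_mem_feSpaceZero hΩ hL hf hu hDu hweak he, hgal e he]
  have iu := hL.integrable_density hu hDu hme hgm hBe
  have iuh := hL.integrable_density huhi.1 huhi.2 hme hgm hBe
  have iI := hL.integrable_density hIi.1 hIi.2 hme hgm hBe
  -- Galerkin orthogonality `key1` replaces `uh` by `u` in the first argument.
  have key2 : L.form Ω e (gradient e) e =
      ∫ x in Ω, L.density (u x - I x) (Du x - gradient I x) (e x) (gradient e x) x := by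
    have e1 : L.form Ω e (gradient e) e =
        ∫ x in Ω, L.density (uh x - I x) (gradient uh x - gradient I x) (e x) (gradient e x) x := by
      refine integral_congr_ae ?_
      filter_upwards [hge] with x hx
      change L.density (e x) (gradient e x) (e x) (gradient e x) x = _
      rw [← hx]
      rfl
    rw [e1]
    simp only [L.density_sub]
    rw [integral_sub iuh iI, integral_sub iu iI]
    congr 1
    exact key1.symm
  have hcoer := T.coercive_of_mem_feSpaceZero hΩ hL hα he
  have iee : IntegrableOn (fun x => e x ^ 2 + ‖gradient e x‖ ^ 2) Ω := by
    refine Integrable.of_bound ((hme.pow 2).add (hgm.norm.pow 2)) (B ^ 2 + B ^ 2) ?_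
    filter_upwards [hBe] with x hx
    rw [Real.norm_of_nonneg (by positivity), ← sq_abs (e x)]
    have := hx.1
    have := hx.2
    gcongr
  have hyoung : L.form Ω e (gradient e) e ≤
      ∫ x in Ω, (α / 2 * (e x ^ 2 + ‖gradient e x‖ ^ 2) + C₁ * E x) := by
    rw [key2]
    refine integral_mono_ae ?_ ((iee.const_mul _).add (hE.const_mul _)) ?_
    · simp only [L.density_sub]
      exact iu.sub iI
    · filter_upwards [hκ, hbd] with x hx hxb
      refine (le_abs_self _).trans ((L.abs_density_le hx.1 hx.2.1 hx.2.2 _ _ _ _).trans ?_)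
      have hEx := hxb.1
      have hux := hxb.2
      rw [← sq_abs (u x - I x)] at hux
      rw [← sq_abs (e x)]
      set a := ‖Du x - gradient I x‖
      set b := |u x - I x|
      set p := ‖gradient e x‖
      set q := |e x|
      -- The weights are `α / 2` for the single product with `p` and `α / 4` for each of the two
      -- products with `q`; together they amount to half of the coercivity term, which is absorbed.
      have y1 : κ * (a * p) ≤ α / 2 * p ^ 2 + κ ^ 2 * a ^ 2 / (2 * α) := by
        have : α / 2 * p ^ 2 + κ ^ 2 * a ^ 2 / (2 * α) - κ * (a * p) =
            (α * p - κ * a) ^ 2 / (2 * α) := by field_simp; ring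
        have : 0 ≤ (α * p - κ * a) ^ 2 / (2 * α) := by positivity
        linarith
      have y2 : ∀ r : ℝ, κ * (r * q) ≤ α / 4 * q ^ 2 + κ ^ 2 * r ^ 2 / α := fun r => by
        have : α / 4 * q ^ 2 + κ ^ 2 * r ^ 2 / α - κ * (r * q) =
            (α * q - 2 * κ * r) ^ 2 / (4 * α) := by field_simp; ring
        have : 0 ≤ (α * q - 2 * κ * r) ^ 2 / (4 * α) := by positivity
        linarith
      have z0 : κ ^ 2 * a ^ 2 / (2 * α) ≤ κ ^ 2 * a ^ 2 / α := by
        gcongr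
        linarith
      have z1 : κ ^ 2 * a ^ 2 / α ≤ κ ^ 2 * E x / α := by gcongr
      have z2 : κ ^ 2 * b ^ 2 / α ≤ κ ^ 2 * (D ^ 2 * E x) / α := by gcongr
      have z3 : C₁ * E x = κ ^ 2 * E x / α + κ ^ 2 * E x / α + κ ^ 2 * (D ^ 2 * E x) / α := by
        rw [hC₁]; ring
      have := y2 a
      have := y2 b
      rw [z3]
      linarith
  rw [integral_add (iee.const_mul _) (hE.const_mul _), integral_const_mul, integral_const_mul]
    at hyoung
  have hee : ∫ x in Ω, (e x ^ 2 + ‖gradient e x‖ ^ 2) ≤ 2 * C₁ / α * ∫ x in Ω, E x := by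
    rw [div_mul_eq_mul_div, le_div_iff₀ hα0]
    linarith
  have hpt : ∀ᵐ x ∂(volume.restrict Ω), ‖Du x - gradient uh x‖ ^ 2 ≤
      2 * E x + 2 * (e x ^ 2 + ‖gradient e x‖ ^ 2) := by
    filter_upwards [hbd, hge] with x hx hxg
    have h1 : Du x - gradient uh x = (Du x - gradient I x) - gradient e x := by rw [hxg]; abel
    have h2 : ‖Du x - gradient uh x‖ ≤ ‖Du x - gradient I x‖ + ‖gradient e x‖ := by
      rw [h1]; exact norm_sub_le _ _
    have h3 : ‖Du x - gradient uh x‖ ^ 2 ≤ (‖Du x - gradient I x‖ + ‖gradient e x‖) ^ 2 := by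
      gcongr
    have h4 := hx.1
    nlinarith [sq_nonneg (‖Du x - gradient I x‖ - ‖gradient e x‖), sq_nonneg (e x)]
  have irhs : IntegrableOn (fun x => 2 * E x + 2 * (e x ^ 2 + ‖gradient e x‖ ^ 2)) Ω :=
    (hE.const_mul 2).add (iee.const_mul 2)
  have ilhs : IntegrableOn (fun x => ‖Du x - gradient uh x‖ ^ 2) Ω := by
    refine irhs.mono' ((hDu.1.sub (aestronglyMeasurable_gradient _ _)).norm.pow 2) ?_
    filter_upwards [hpt] with x hx
    rwa [Real.norm_of_nonneg (by positivity)]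
  refine ⟨ilhs, (integral_mono_ae ilhs irhs hpt).trans ?_⟩
  rw [integral_add (hE.const_mul 2) (iee.const_mul 2), integral_const_mul, integral_const_mul]
  set X := ∫ x in Ω, E x
  calc _ ≤ 2 * X + 2 * (2 * C₁ / α * X) := by gcongr
    _ = _ := by ring

end Cea

/-! ### The recovered Hessian and the closeness condition -/

section Recovered

variable {d : ℕ} {Ω : Set (Euc d)} (T : SimplicialMesh Ω)

lemma isHermitian_of_sub_smul_one {H : Matrix (Fin d) (Fin d) ℝ} {γ : ℝ}
    (h : (H - γ • 1).PosSemidef) : H.IsHermitian := by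
  have h1 : (γ • (1 : Matrix (Fin d) (Fin d) ℝ)).IsHermitian := by simp [Matrix.IsHermitian]
  simpa using h.1.add h1

lemma mul_norm_sq_le_quadForm {H : Matrix (Fin d) (Fin d) ℝ} {γ : ℝ}
    (h : (H - γ • 1).PosSemidef) (v : Euc d) : γ * ‖v‖ ^ 2 ≤ quadForm H v := by
  have := h.quadForm_nonneg v
  rw [quadForm_sub, quadForm_smul, quadForm_one] at this
  linarith

lemma posDef_of_mul_norm_sq_le {S : Matrix (Fin d) (Fin d) ℝ} (hS : S.IsHermitian) {γ : ℝ}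
    (hγ : 0 < γ) (h : ∀ v, γ * ‖v‖ ^ 2 ≤ quadForm S v) : S.PosDef := by
  refine .of_dotProduct_mulVec_pos hS fun x hx => ?_
  have h1 := h (WithLp.toLp 2 x)
  rw [quadForm_eq_dotProduct] at h1
  have h2 : 0 < ‖(WithLp.toLp 2 x : Euc d)‖ := norm_pos_iff.2 (by simpa using hx)
  have h3 : 0 < γ * ‖(WithLp.toLp 2 x : Euc d)‖ ^ 2 := by positivity
  simpa using h3.trans_le h1

lemma abs_apply_le_opNorm (S : Matrix (Fin d) (Fin d) ℝ) (i j : Fin d) : |S i j| ≤ ‖S‖ := by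
  have h1 : S i j = inner ℝ (EuclideanSpace.single i (1 : ℝ))
      (Matrix.toEuclideanCLM (𝕜 := ℝ) S (EuclideanSpace.single j 1)) := by
    rw [Matrix.inner_toEuclideanCLM]
    simp
  rw [h1]
  refine (abs_real_inner_le_norm _ _).trans ?_
  have h2 := (Matrix.toEuclideanCLM (𝕜 := ℝ) S).le_opNorm (EuclideanSpace.single j 1)
  rw [PiLp.norm_single, norm_one, one_mul]
  rw [PiLp.norm_single, norm_one, mul_one] at h2
  exact h2

/-- The form of the average is the average of the forms, so the uniform lower bound `γ` survives. -/
lemma cellAverage_posDef (hΩ : IsPolyhedralDomain Ω) {R : Euc d → Matrix (Fin d) (Fin d) ℝ}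
    (hR : ∀ i j, IntegrableOn (fun x => R x i j) Ω) {γ : ℝ} (hγ : 0 < γ)
    (hpos : ∀ x ∈ Ω, (R x - γ • 1).PosSemidef) {s : Finset (Euc d)} (hs : s ∈ T.elems) :
    (cellAverage R s).PosDef := by
  have hV := (T.isSimplex s hs).volume_real_pos
  have hae : ∀ᵐ x ∂(volume.restrict (cell s)), (R x - γ • 1).PosSemidef := by
    refine T.ae_restrict_cell_of_ae hΩ ?_ hs
    filter_upwards [ae_restrict_mem hΩ.isOpen.measurableSet] with x hx using hpos x hx
  have hRs : ∀ i j, IntegrableOn (fun x => R x i j) (cell s) := fun i j => by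
    have h1 : IntegrableOn (fun x => R x i j) (closure Ω) := by
      rw [IntegrableOn, T.restrict_closure hΩ]
      exact hR i j
    exact h1.mono_set (T.cell_subset_closure hs)
  refine posDef_of_mul_norm_sq_le ?_ hγ fun v => ?_
  · ext i j
    simp only [cellAverage, Matrix.conjTranspose_apply, Matrix.of_apply, star_trivial]
    refine average_congr ?_
    filter_upwards [hae] with x hx
    simpa using (isHermitian_of_sub_smul_one hx).apply i j
  · have e1 : quadForm (cellAverage R s) v =
        (volume.real (cell s))⁻¹ * ∫ x in cell s, quadForm (R x) v := by
      simp only [quadForm, cellAverage, Matrix.of_apply]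
      rw [integral_finsetSum _ fun i _ => integrable_finsetSum _ fun j _ =>
        ((hRs i j).mul_const _).mul_const _, Finset.mul_sum]
      refine Finset.sum_congr rfl fun i _ => ?_
      rw [integral_finsetSum _ fun j _ => ((hRs i j).mul_const _).mul_const _, Finset.mul_sum]
      refine Finset.sum_congr rfl fun j _ => ?_
      rw [integral_mul_const, integral_mul_const, setAverage_eq, smul_eq_mul]
      ring
    have hint : IntegrableOn (fun x => quadForm (R x) v) (cell s) := by
      unfold quadForm
      exact integrable_finsetSum _ fun i _ => integrable_finsetSum _ fun j _ =>
        ((hRs i j).mul_const _).mul_const _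
    have h1 : ∫ _x in cell s, γ * ‖v‖ ^ 2 ≤ ∫ x in cell s, quadForm (R x) v := by
      refine integral_mono_ae
        (integrableOn_const (volume_cell_lt_top s).ne) hint ?_
      filter_upwards [hae] with x hx using mul_norm_sq_le_quadForm hx v
    rw [setIntegral_const, smul_eq_mul] at h1
    rw [e1, le_inv_mul_iff₀ hV]
    exact h1

/-- Both form bounds are tested on one unit vector. This is the source of the nonnegativity of the
upper constants. -/
lemma closeness_constants_le (hd : 1 ≤ d) {S : Matrix (Fin d) (Fin d) ℝ} (hS : S.PosDef)
    {H : Matrix (Fin d) (Fin d) ℝ} (hH : H.IsHermitian) {a b : ℝ}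
    (h : spectrum ℝ (S⁻¹ * H) ⊆ Icc a b) : a ≤ b := by
  have h1 := quadForm_bounds_of_spectrum hS hH h (EuclideanSpace.single ⟨0, hd⟩ 1)
  have h2 : 0 < quadForm S (EuclideanSpace.single ⟨0, hd⟩ 1) := by
    rw [quadForm_eq_dotProduct]
    simpa using hS.dotProduct_mulVec_pos (x := (EuclideanSpace.single ⟨0, hd⟩ (1 : ℝ) : Euc d).ofLp)
      (by simp)
  exact le_of_mul_le_mul_right (h1.1.trans h1.2) h2

lemma opNorm_le_of_closeness {S : Matrix (Fin d) (Fin d) ℝ} (hS : S.PosDef)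
    {H : Matrix (Fin d) (Fin d) ℝ} (hH : H.PosSemidef) {a b : ℝ} (hb : 0 ≤ b)
    (h : spectrum ℝ (S⁻¹ * H) ⊆ Icc a b) : ‖H‖ ≤ b * ‖S‖ := by
  refine opNorm_le_of_quadForm_le hH (by positivity) fun v => ?_
  refine (quadForm_bounds_of_spectrum hS hH.1 h v).2.trans ?_
  rw [mul_assoc]
  exact mul_le_mul_of_nonneg_left (quadForm_le_opNorm S v) hb

lemma posSemidef_of_sub_smul_one {H : Matrix (Fin d) (Fin d) ℝ} {γ : ℝ} (hγ : 0 ≤ γ)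
    (h : (H - γ • 1).PosSemidef) : H.PosSemidef :=
  posSemidef_of_quadForm_nonneg (isHermitian_of_sub_smul_one h) fun v =>
    (by positivity : 0 ≤ γ * ‖v‖ ^ 2).trans (mul_norm_sq_le_quadForm h v)

/-- A lower bound for the norm that measures the Hessian, by the total volume in the metric. -/
lemma metric_sum_le_eLpNorm (hd : 1 ≤ d) (hΩ : IsPolyhedralDomain Ω)
    {H : Euc d → Matrix (Fin d) (Fin d) ℝ} {S : Finset (Euc d) → Matrix (Fin d) (Fin d) ℝ}
    (hS : ∀ s ∈ T.elems, (S s).PosDef) (hH : ∀ᵐ x ∂(volume.restrict Ω), (H x).IsHermitian)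
    {a b : Finset (Euc d) → ℝ} {m : ℝ} (hm : 0 < m) (hma : ∀ s ∈ T.elems, m ≤ a s)
    (hclose : ∀ s ∈ T.elems, IsClose (S s) H s (a s) (b s)) :
    ENNReal.ofReal (m ^ 2 * (∑ s ∈ T.elems, volume.real (cell s) *
        (metricTensor (S s)).det ^ ((1 : ℝ) / 2)) ^ (((d : ℝ) + 2) / d)) ≤
      eLpNorm (fun x => (H x).det ^ ((1 : ℝ) / d) • H x)
        (ENNReal.ofReal ((d : ℝ) / (d + 2))) (volume.restrict Ω) := by
  have hd0 : (0 : ℝ) < d := by exact_mod_cast hd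
  set r : ℝ := ((d : ℝ) + 2) / d with hr
  set p : ℝ := (d : ℝ) / (d + 2) with hp
  have hr0 : 0 < r := by positivity
  have hp0 : 0 < p := by positivity
  have hpr : p * r = 1 := by rw [hp, hr]; field_simp
  have hpr' : 1 / p = r := by rw [hp, hr, one_div_div]
  -- The exponent `p` is below one, so no triangle inequality is available; only additivity of the
  -- integral over the cells is used.
  rw [eLpNorm_eq_lintegral_rpow_enorm_toReal (by simpa using hp0) ENNReal.ofReal_ne_top,
    ENNReal.toReal_ofReal hp0.le, hpr', T.lintegral_eq_sum hΩ]
  set q : Finset (Euc d) → ℝ := fun s => volume.real (cell s) *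
    (metricTensor (S s)).det ^ ((1 : ℝ) / 2) with hq
  set n : Finset (Euc d) → ℝ := fun s => (S s).det ^ ((1 : ℝ) / d) * ‖S s‖ with hn
  have hn0 : ∀ s ∈ T.elems, 0 ≤ n s := fun s hs => by
    have := (hS s hs).det_pos
    simp only [hn]
    positivity
  have hqn : ∀ s ∈ T.elems, q s = volume.real (cell s) * n s ^ p := fun s hs => by
    simp only [hq, hn, hp]
    rw [mul_metricTensor_det_rpow hd (hS s hs)]
  have hq0 : ∀ s ∈ T.elems, 0 ≤ q s := fun s hs => by
    rw [hqn s hs]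
    have := hn0 s hs
    positivity
  have hQ0 : 0 ≤ ∑ s ∈ T.elems, q s := Finset.sum_nonneg hq0
  have hcell : ∀ s ∈ T.elems, ENNReal.ofReal ((m ^ 2) ^ p * q s) ≤
      ∫⁻ x in cell s, ‖(H x).det ^ ((1 : ℝ) / d) • H x‖ₑ ^ p := fun s hs => by
    have hpt : ∀ᵐ x ∂(volume.restrict (cell s)), ENNReal.ofReal ((m ^ 2 * n s) ^ p) ≤
        ‖(H x).det ^ ((1 : ℝ) / d) • H x‖ₑ ^ p := by
      filter_upwards [hclose s hs, T.ae_restrict_cell_of_ae hΩ hH hs] with x hx hxH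
      have h1 := metric_density_le hd (hS s hs) hxH (hm.trans_le (hma s hs)) hx
      have h2 : m ^ 2 * n s ≤ ‖(H x).det ^ ((1 : ℝ) / d) • H x‖ := by
        refine le_trans ?_ h1
        have := hma s hs
        have := hn0 s hs
        gcongr
      rw [← ofReal_norm, ← ENNReal.ofReal_rpow_of_nonneg (by have := hn0 s hs; positivity) hp0.le]
      gcongr
    calc ENNReal.ofReal ((m ^ 2) ^ p * q s)
        = ENNReal.ofReal ((m ^ 2 * n s) ^ p) * volume (cell s) := by
          rw [← ENNReal.ofReal_toReal (volume_cell_lt_top s).ne,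
            ← ENNReal.ofReal_mul (by have := hn0 s hs; positivity), hqn s hs,
            Real.mul_rpow (by positivity) (hn0 s hs), Measure.real]
          congr 1
          ring
      _ = ∫⁻ _x in cell s, ENNReal.ofReal ((m ^ 2 * n s) ^ p) := by
          rw [setLIntegral_const]
      _ ≤ _ := lintegral_mono_ae hpt
  -- The outer power `r = 1 / p` restores `m ^ 2` from `(m ^ 2) ^ p`.
  have e1 : ENNReal.ofReal (m ^ 2 * (∑ s ∈ T.elems, q s) ^ r) =
      (∑ s ∈ T.elems, ENNReal.ofReal ((m ^ 2) ^ p * q s)) ^ r := by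
    rw [← ENNReal.ofReal_sum_of_nonneg fun s hs => by have := hq0 s hs; positivity,
      ← Finset.mul_sum, ENNReal.ofReal_rpow_of_nonneg (by positivity) hr0.le,
      Real.mul_rpow (by positivity) hQ0, ← Real.rpow_mul (by positivity), hpr, Real.rpow_one]
  rw [e1]
  gcongr with s hs
  exact hcell s hs

end Recovered

/-! ### The global interpolation error -/

section Interpolation

variable {d : ℕ} {Ω : Set (Euc d)}

/-- The Hessian is bounded, by the closeness condition. -/
lemma exists_hessian_bound (hΩ : IsPolyhedralDomain Ω) (T : SimplicialMesh Ω)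
    {H : Euc d → Matrix (Fin d) (Fin d) ℝ} {S : Finset (Euc d) → Matrix (Fin d) (Fin d) ℝ}
    (hS : ∀ s ∈ T.elems, (S s).PosDef) (hH : ∀ᵐ x ∂(volume.restrict Ω), (H x).PosSemidef)
    {a b : Finset (Euc d) → ℝ} (hb : ∀ s ∈ T.elems, 0 ≤ b s)
    (hclose : ∀ s ∈ T.elems, IsClose (S s) H s (a s) (b s)) :
    ∃ Λ : ℝ, ∀ᵐ x ∂(volume.restrict Ω), ∀ i j, |H x i j| ≤ Λ := by
  refine ⟨∑ s ∈ T.elems, b s * ‖S s‖, ?_⟩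
  have hcl : ∀ᵐ x, ∀ s ∈ T.elems, x ∈ cell s → spectrum ℝ ((S s)⁻¹ * H x) ⊆ Icc (a s) (b s) :=
    (ae_ball_iff T.elems.countable_toSet).2 fun s hs =>
      (ae_restrict_iff' (measurableSet_cell s)).1 (hclose s hs)
  filter_upwards [hH, ae_restrict_of_ae hcl, ae_restrict_mem hΩ.isOpen.measurableSet]
    with x hxH hx hxΩ i j
  obtain ⟨s, hs, hxs⟩ := T.exists_mem_cell (subset_closure hxΩ)
  refine (abs_apply_le_opNorm _ i j).trans
    ((opNorm_le_of_closeness (hS s hs) hxH (hb s hs) (hx s hs hxs)).trans ?_)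
  exact Finset.single_le_sum (f := fun s => b s * ‖S s‖)
    (fun t ht => mul_nonneg (hb t ht) (norm_nonneg _)) hs

/-- Existence of a finite element interpolant with the element-wise error bounds. -/
lemma exists_interpolant_error (hd : 1 ≤ d) {Khat : Finset (Euc d)}
    (hvol : volume (cell Khat) = 1) {c : Euc d} {ρ Dhat D : ℝ} (hρ : 0 < ρ)
    (hball : Metric.closedBall c ρ ⊆ cell Khat)
    (hDhat : ∀ a ∈ cell Khat, ∀ b ∈ cell Khat, ‖a - b‖ ≤ Dhat) (hΩ : IsPolyhedralDomain Ω)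
    (hD : ∀ a ∈ closure Ω, ∀ b ∈ closure Ω, ‖a - b‖ ≤ D)
    {g u : Euc d → ℝ} {Du : Euc d → Euc d} {H : Euc d → Matrix (Fin d) (Fin d) ℝ}
    (hu : IsH2 Ω u Du H) (hg : ∀ z ∈ frontier Ω, Tendsto u (𝓝[Ω] z) (𝓝 (g z)))
    (hH : ∀ᵐ x ∂(volume.restrict Ω), (H x).PosSemidef)
    (T : SimplicialMesh Ω) {F : Finset (Euc d) → Euc d →ᵃ[ℝ] Euc d}
    (hF : T.IsReferenceMap Khat F) {S : Finset (Euc d) → Matrix (Fin d) (Fin d) ℝ}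
    (hS : ∀ s ∈ T.elems, (S s).PosDef) {a b : Finset (Euc d) → ℝ} (hb : ∀ s ∈ T.elems, 0 ≤ b s)
    (hclose : ∀ s ∈ T.elems, IsClose (S s) H s (a s) (b s)) :
    ∃ I ∈ T.feSpace, (∀ z ∈ T.vertices, z ∈ frontier Ω → I z = g z) ∧
      ∀ᵐ x ∂(volume.restrict Ω), ∃ s ∈ T.elems, x ∈ cell s ∧
        ‖Du x - gradient I x‖ ≤ gradErrorBound Dhat ρ (b s) (S s) (jacobian (F s)) ∧
        |u x - I x| ≤ D * gradErrorBound Dhat ρ (b s) (S s) (jacobian (F s)) := by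
  have := T.isFiniteMeasure_restrict
  have hΩm := hΩ.isOpen.measurableSet
  have iu : IntegrableOn u Ω := hu.memLp.integrable one_le_two
  have iDu : ∀ i, IntegrableOn (fun x => Du x i) Ω := fun i =>
    (hu.memLp_grad i).integrable one_le_two
  have iH : ∀ i j, IntegrableOn (fun x => H x i j) Ω := fun i j =>
    (hu.memLp_hess i j).integrable one_le_two
  obtain ⟨Λ, hΛ⟩ := exists_hessian_bound hΩ T hS hH hb hclose
  obtain ⟨U, hUc, hUu, hUg⟩ := exists_continuous_representative hΩ.isOpen iu iDu iH hu.weak_grad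
    hu.weak_hess hΛ hg
  obtain ⟨I, hI, hIU⟩ := T.exists_interpolant U
  refine ⟨I, hI, fun z hz hzf => (hIU z hz).trans (hUg hzf), ?_⟩
  have hint := T.ae_mem_interior_cell
  rw [T.restrict_closure hΩ] at hint
  filter_upwards [hint, ae_mem_approxPoints hΩm iu iDu] with x hx hxG
  obtain ⟨s, hs, hxs⟩ := hx
  refine ⟨s, hs, interior_subset hxs, ?_⟩
  obtain ⟨p, hp⟩ := hI s hs
  have hJ : (jacobian (F s)).det ≠ 0 := by
    rw [← abs_pos, ← volume_real_cell_eq hvol (hF s hs)]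
    exact (T.isSimplex s hs).volume_real_pos
  have hSnn : ∀ v, 0 ≤ quadForm (b s • S s) v := fun v => by
    rw [quadForm_smul]
    exact mul_nonneg (hb s hs) ((hS s hs).posSemidef.quadForm_nonneg v)
  -- Closeness gives the upper bound `H ≤ b S`; the lower bound zero is the positivity of the
  -- Hessian.
  have hbd : ∀ᵐ z ∂(volume.restrict (interior (cell s))), ∀ v,
      quadForm (H z) v ∈ Icc 0 (quadForm (b s • S s) v) := by
    have h1 : ∀ᵐ z ∂(volume.restrict (cell s)), ∀ v,
        quadForm (H z) v ∈ Icc 0 (quadForm (b s • S s) v) := by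
      filter_upwards [hclose s hs, T.ae_restrict_cell_of_ae hΩ hH hs] with z hz hzH v
      rw [quadForm_smul]
      exact ⟨hzH.quadForm_nonneg v, (quadForm_bounds_of_spectrum (hS s hs) hzH.1 hz v).2⟩
    exact ae_mono (Measure.restrict_mono interior_subset le_rfl) h1
  have hT : ∀ v ∈ s, p v - u x - inner ℝ (Du x) (v - x) ∈
      Icc 0 (b s * quadForm (S s) (v - x)) := fun v hv => by
    have h1 := taylor_bounds_closure hΩm iu iDu iH hu.weak_grad hu.weak_hess hUc hUu
      isOpen_interior (convex_cell s).interior (T.interior_cell_subset hΩ hs) hxs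
      (by rw [(T.isSimplex s hs).closure_interior_cell]; exact subset_cell s hv) hxG hSnn hbd
    rw [quadForm_smul] at h1
    rwa [← hp (subset_cell s hv), hIU v ⟨s, hs, hv⟩]
  obtain ⟨h1, h2⟩ := interpolation_error_bounds hd (hF s hs) hρ hball hDhat (hS s hs) hJ (hb s hs)
    (interior_subset hxs) hT
  have hη0 := gradErrorBound_nonneg (Dhat := Dhat) hρ (hS s hs) hJ (hb s hs)
  constructor
  · have hfd := (SimplicialMesh.hasFDerivAt_of_eqOn_cell hp hxs).fderiv
    -- The bound for the linear functional is tested with the gradient error itself.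
    set w := Du x - gradient I x with hw
    have h3 := h2 w
    have h4 : p.linear w = inner ℝ (gradient I x) w := by
      rw [inner_gradient, hfd]; rfl
    rw [h4, ← inner_sub_left, ← neg_sub, ← hw, inner_neg_left, abs_neg,
      real_inner_self_eq_norm_sq, abs_of_nonneg (by positivity)] at h3
    rcases (norm_nonneg w).eq_or_lt with h0 | h0
    · rw [← h0]; exact hη0
    · exact le_of_mul_le_mul_right (by linarith [sq ‖w‖]) h0
  · rw [abs_sub_comm, hp (interior_subset hxs)]
    refine h1.trans ?_
    -- The cell has diameter at most `D`, so the inverse Jacobian cannot be too small; the bound for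
    -- the value is thus at most `D` times the bound for the gradient.
    have h5 := le_sqrt_invJacobianBound_mul hd (hF s hs) hρ hball (hS s hs) hJ (D := D)
      fun a ha b hb => hD a (T.cell_subset_closure hs ha) b (T.cell_subset_closure hs hb)
    have htr := (posDef_transpose_mul_mul (hS s hs) hJ).posSemidef.trace_nonneg
    have hE0 : 0 ≤ b s * ((jacobian (F s))ᵀ * S s * jacobian (F s)).trace * Dhat ^ 2 := by
      have := hb s hs
      positivity
    rw [gradErrorBound]
    set E := b s * ((jacobian (F s))ᵀ * S s * jacobian (F s)).trace * Dhat ^ 2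
    calc E = E / ρ * ρ := (div_mul_cancel₀ _ hρ.ne').symm
      _ ≤ E / ρ * (√(invJacobianBound (S s) (jacobian (F s))) * D) := by gcongr
      _ = _ := by ring

end Interpolation

/-! ### Summation over the elements -/

/-- Equidistribution replaces each `q s` by `Ceq` times the mean, so this power leaves the sum and
only the squares of `b` are summed. They contribute `N Cp²`, and `N · N^(-(d+2)/d) = N^(-2/d)` is
the rate. -/
lemma sum_element_bounds_le {ι : Type*} {t : Finset ι} {d : ℕ} (hd : 1 ≤ d) (ht : t.Nonempty)
    {W q b : ι → ℝ} {k Cali Ceq Cp : ℝ} (hk : 0 ≤ k) (hCali : 0 ≤ Cali) (hCeq : 0 ≤ Ceq)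
    (hq : ∀ s ∈ t, 0 ≤ q s)
    (hW : ∀ s ∈ t, W s ≤ k * b s ^ 2 * ((d * Cali) ^ (d + 1) * q s ^ (((d : ℝ) + 2) / d)))
    (heq : ∀ s ∈ t, q s ≤ Ceq * (1 / (t.card : ℝ) * ∑ r ∈ t, q r))
    (hb : √(1 / (t.card : ℝ) * ∑ s ∈ t, b s ^ 2) ≤ Cp) :
    ∑ s ∈ t, W s ≤ k * (d : ℝ) ^ (d + 1) * Cali ^ (d + 1) * Ceq ^ (((d : ℝ) + 2) / d) * Cp ^ 2 *
      (t.card : ℝ) ^ (-(2 : ℝ) / d) * (∑ s ∈ t, q s) ^ (((d : ℝ) + 2) / d) := by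
  have hd0 : (0 : ℝ) < d := by exact_mod_cast hd
  have hN : (0 : ℝ) < t.card := by exact_mod_cast ht.card_pos
  set N : ℝ := (t.card : ℝ) with hNdef
  set r : ℝ := ((d : ℝ) + 2) / d with hr
  have hr0 : 0 < r := by positivity
  set Q := ∑ s ∈ t, q s with hQ
  have hQ0 : 0 ≤ Q := Finset.sum_nonneg hq
  have hqr : ∀ s ∈ t, q s ^ r ≤ Ceq ^ r * (N ^ (-r) * Q ^ r) := fun s hs => by
    calc q s ^ r ≤ (Ceq * (1 / N * Q)) ^ r := by
          have := hq s hs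
          have := heq s hs
          gcongr
      _ = _ := by
          rw [Real.mul_rpow hCeq (by positivity), Real.mul_rpow (by positivity) hQ0, one_div,
            Real.inv_rpow hN.le, Real.rpow_neg hN.le]
  have hbsum : ∑ s ∈ t, b s ^ 2 ≤ N * Cp ^ 2 := by
    have h1 : 1 / N * ∑ s ∈ t, b s ^ 2 ≤ Cp ^ 2 := (Real.sqrt_le_iff.1 hb).2
    rw [one_div, inv_mul_le_iff₀ hN] at h1
    exact h1
  have hNr : N * N ^ (-r) = N ^ (-(2 : ℝ) / d) := by
    rw [← Real.rpow_one_add' hN.le]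
    · congr 1
      rw [hr]
      field_simp
      ring
    · rw [hr]
      have : 1 + -(((d : ℝ) + 2) / d) = -2 / d := by field_simp; ring
      rw [this]
      exact (div_neg_of_neg_of_pos (by norm_num) hd0).ne
  calc ∑ s ∈ t, W s
      ≤ ∑ s ∈ t, k * b s ^ 2 * ((d * Cali) ^ (d + 1) * (Ceq ^ r * (N ^ (-r) * Q ^ r))) := by
        refine Finset.sum_le_sum fun s hs => (hW s hs).trans ?_
        have := hqr s hs
        gcongr
    _ = k * (∑ s ∈ t, b s ^ 2) * ((d * Cali) ^ (d + 1) * (Ceq ^ r * (N ^ (-r) * Q ^ r))) := by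
        rw [← Finset.sum_mul, Finset.mul_sum]
    _ ≤ k * (N * Cp ^ 2) * ((d * Cali) ^ (d + 1) * (Ceq ^ r * (N ^ (-r) * Q ^ r))) := by gcongr
    _ = k * (d : ℝ) ^ (d + 1) * Cali ^ (d + 1) * Ceq ^ r * Cp ^ 2 * (N * N ^ (-r)) * Q ^ r := by
        rw [mul_pow]; ring
    _ = _ := by rw [hNr]

/-! ### The error estimate -/

lemma exists_norm_sub_le {d : ℕ} {A : Set (Euc d)} (hA : IsCompact A) :
    ∃ D : ℝ, ∀ a ∈ A, ∀ b ∈ A, ‖a - b‖ ≤ D := by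
  obtain ⟨D, hD⟩ := Metric.isBounded_iff.1 hA.isBounded
  exact ⟨D, fun a ha b hb => by rw [← dist_eq_norm]; exact hD ha hb⟩

lemma IsPolyhedralDomain.isCompact_closure {d : ℕ} {Ω : Set (Euc d)} (hΩ : IsPolyhedralDomain Ω) :
    IsCompact (closure Ω) := by
  obtain ⟨S, -, hS⟩ := hΩ.polyhedral
  rw [hS]
  exact S.isCompact_biUnion fun s _ => isCompact_cell s

lemma eLpNorm_two_le_of_integral_le {d : ℕ} {Ω : Set (Euc d)} {G : Euc d → Euc d} {M : ℝ}
    (hM : 0 ≤ M) (hG : IntegrableOn (fun x => ‖G x‖ ^ 2) Ω)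
    (h : ∫ x in Ω, ‖G x‖ ^ 2 ≤ M ^ 2) : eLpNorm G 2 (volume.restrict Ω) ≤ ENNReal.ofReal M := by
  rw [eLpNorm_eq_lintegral_rpow_enorm_toReal two_ne_zero ENNReal.ofNat_ne_top]
  have h1 : ∫⁻ x in Ω, ‖G x‖ₑ ^ (2 : ℝ≥0∞).toReal = ENNReal.ofReal (∫ x in Ω, ‖G x‖ ^ 2) := by
    rw [ofReal_integral_eq_lintegral_ofReal hG (Eventually.of_forall fun x => by positivity)]
    refine lintegral_congr fun x => ?_
    rw [← ofReal_norm, ENNReal.ofReal_rpow_of_nonneg (norm_nonneg _) (by simp)]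
    simp
  rw [h1, ENNReal.ofReal_rpow_of_nonneg (integral_nonneg fun x => by positivity) (by simp)]
  refine ENNReal.ofReal_le_ofReal ?_
  rw [ENNReal.toReal_ofNat, ← Real.sqrt_eq_rpow]
  exact (Real.sqrt_le_sqrt h).trans_eq (Real.sqrt_sq hM)

theorem theorem2p1 (d : ℕ) (hd : 1 ≤ d)
    -- the reference element, of unit volume
    (Khat : Finset (Euc d)) (hKhat : IsSimplex Khat) (hvol : volume (cell Khat) = 1)
    (Ω : Set (Euc d)) (hΩ : IsPolyhedralDomain Ω)
    (L : SecondOrderOperator d) (hL : L.IsElliptic Ω) :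
    ∃ C : ℝ, 0 < C ∧
      -- the boundary value problem and its solution in `H²(Ω)` with uniformly positive Hessian
      ∀ (f g u : Euc d → ℝ) (Du : Euc d → Euc d) (H : Euc d → Matrix (Fin d) (Fin d) ℝ),
      MemLp f 2 (volume.restrict Ω) →
      IsH2 Ω u Du H →
      IsBVPSolution L Ω f g u Du →
      (∃ γ > (0 : ℝ), ∀ᵐ x ∂(volume.restrict Ω), (H x - γ • 1).PosSemidef) →
      -- the mesh and the finite element solution on it
      ∀ (T : SimplicialMesh Ω) (F : Finset (Euc d) → Euc d →ᵃ[ℝ] Euc d) (uh : Euc d → ℝ),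
      T.IsReferenceMap Khat F →
      IsFESolution L T f g uh →
      -- the recovered Hessian
      ∀ R : Euc d → Matrix (Fin d) (Fin d) ℝ,
      (∀ i j, IntegrableOn (fun x => R x i j) Ω) →
      (∃ γ > (0 : ℝ), ∀ x ∈ Ω, (R x - γ • 1).PosSemidef) →
      -- the closeness constants
      ∀ (CRmK CRpK : Finset (Euc d) → ℝ) (CRm CRp : ℝ), 0 < CRm → 0 < CRp →
      (∀ s ∈ T.elems, IsClose (cellAverage R s) H s (CRmK s) (CRpK s)) →
      (∀ s ∈ T.elems, CRm ≤ CRmK s) →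
      √(1 / (T.numElems : ℝ) * ∑ s ∈ T.elems, CRpK s ^ 2) ≤ CRp →
      -- the mesh conditions
      ∀ Ceq Cali : ℝ,
      IsQuasiMUniform T F (fun s => metricTensor (cellAverage R s)) Ceq Cali →
      eLpNorm (fun x => Du x - gradient uh x) 2 (volume.restrict Ω) ≤
        ENNReal.ofReal (C * Cali ^ (((d : ℝ) + 1) / 2) * Ceq ^ (((d : ℝ) + 2) / (2 * d))
            * (CRp / CRm) * (T.numElems : ℝ) ^ (-(1 : ℝ) / d))
          * eLpNorm (fun x => (H x).det ^ ((1 : ℝ) / d) • H x)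
              (ENNReal.ofReal ((d : ℝ) / (d + 2))) (volume.restrict Ω) ^ ((1 : ℝ) / 2) := by
  have hd0 : (0 : ℝ) < d := by exact_mod_cast hd
  obtain ⟨c, hc⟩ := hKhat.interior_cell_nonempty
  obtain ⟨ρ, hρ, hball⟩ := Metric.nhds_basis_closedBall.mem_iff.1
    (mem_interior_iff_mem_nhds.1 hc)
  obtain ⟨Dhat, hDhat⟩ := exists_norm_sub_le (isCompact_cell Khat)
  obtain ⟨D, hD⟩ := exists_norm_sub_le hΩ.isCompact_closure
  obtain ⟨Cq, hCq, hquasi⟩ := exists_quasi_optimality_constant hΩ hL D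
  set k : ℝ := (Dhat ^ 2 / ρ) ^ 2 with hk
  have hk0 : 0 ≤ k := by positivity
  -- The summand one only ensures that the constant is positive.
  set C₀ : ℝ := Cq * k * (d : ℝ) ^ (d + 1) + 1 with hC₀
  have hC₀0 : 0 < C₀ := by positivity
  refine ⟨√C₀, Real.sqrt_pos.2 hC₀0, ?_⟩
  intro f g u Du H hf hu hsol ⟨γ, hγ, hHγ⟩ T F uh hF huh R hR ⟨γ', hγ', hRγ⟩ CRmK CRpK CRm CRp hCRm
    hCRp hclose hmin hmean Ceq Cali hM
  have := T.isFiniteMeasure_restrict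
  set S : Finset (Euc d) → Matrix (Fin d) (Fin d) ℝ := fun s => cellAverage R s with hSdef
  have hS : ∀ s ∈ T.elems, (S s).PosDef := fun s hs => cellAverage_posDef T hΩ hR hγ' hRγ hs
  have hHpos : ∀ᵐ x ∂(volume.restrict Ω), (H x).PosSemidef :=
    hHγ.mono fun x hx => posSemidef_of_sub_smul_one hγ.le hx
  have hVpos : ∀ s ∈ T.elems, 0 < volume.real (cell s) := fun s hs =>
    (T.isSimplex s hs).volume_real_pos
  -- An element has positive measure, so closeness holds at some point of it and yields `0 < CRm ≤
  -- CRmK s ≤ CRpK s`.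
  have hb0 : ∀ s ∈ T.elems, 0 ≤ CRpK s := fun s hs => by
    have hne : (ae (volume.restrict (cell s))).NeBot := by
      rw [ae_neBot, Ne, Measure.restrict_eq_zero]
      intro h0
      have := hVpos s hs
      simp [Measure.real, h0] at this
    obtain ⟨x, hx, hxH⟩ := ((hclose s hs).and (T.ae_restrict_cell_of_ae hΩ hHpos hs)).exists
    exact (hCRm.le.trans (hmin s hs)).trans (closeness_constants_le hd (hS s hs) hxH.1 hx)
  obtain ⟨I, hI, hIg, herr⟩ := exists_interpolant_error hd hvol hρ hball hDhat hΩ hD hu hsol.boundary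
    hHpos T hF hS hb0 hclose
  set η : Finset (Euc d) → ℝ := fun s => gradErrorBound Dhat ρ (CRpK s) (S s) (jacobian (F s))
    with hη
  -- A sum of indicators over the closed cells: on overlaps it only exceeds the bound of each cell,
  -- and its integral is at most the sum of the element contributions.
  set E : Euc d → ℝ := fun x => ∑ s ∈ T.elems, (cell s).indicator (fun _ => η s ^ 2) x with hE
  have hEcell : ∀ s ∈ T.elems, ∀ x ∈ cell s, η s ^ 2 ≤ E x := fun s hs x hx => by
    have h1 := Finset.single_le_sum (f := fun s => (cell s).indicator (fun _ => η s ^ 2) x)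
      (fun t _ => indicator_nonneg (fun _ _ => sq_nonneg _) x) hs
    simpa [hx] using h1
  have hEi : ∀ s ∈ T.elems, Integrable ((cell s).indicator (fun _ => η s ^ 2))
      (volume.restrict Ω) := fun s _ =>
    (integrable_const _).indicator (measurableSet_cell s)
  have hEint : IntegrableOn E Ω := integrable_finsetSum _ hEi
  have hEle : ∫ x in Ω, E x ≤ ∑ s ∈ T.elems, volume.real (cell s) * η s ^ 2 := by
    rw [integral_finsetSum _ hEi]
    refine Finset.sum_le_sum fun s _ => ?_
    rw [integral_indicator_const _ (measurableSet_cell s), smul_eq_mul]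
    refine mul_le_mul_of_nonneg_right ?_ (sq_nonneg _)
    exact ENNReal.toReal_mono (volume_cell_lt_top s).ne (Measure.restrict_apply_le _ _)
  have hJvol : ∀ s ∈ T.elems, volume.real (cell s) = |(jacobian (F s)).det| := fun s hs =>
    volume_real_cell_eq hvol (hF s hs)
  have hη0 : ∀ s ∈ T.elems, 0 ≤ η s := fun s hs =>
    gradErrorBound_nonneg hρ (hS s hs)
      (by rw [← abs_pos, ← hJvol s hs]; exact hVpos s hs) (hb0 s hs)
  obtain ⟨hint, herrle⟩ := hquasi T f u Du (hf.integrable one_le_two) (hu.memLp.integrable one_le_two)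
    (integrableOn_euc fun i => (hu.memLp_grad i).integrable one_le_two) hsol.weak_form uh huh.mem I hI
    (T.mem_feSpaceZero hΩ (T.sub_mem_feSpace huh.mem hI) fun z hz hzf => by
      rw [Pi.sub_apply, huh.boundary z hz hzf, hIg z hz hzf, sub_self])
    huh.galerkin E hEint (by
      filter_upwards [herr] with x hx
      obtain ⟨s, hs, hxs, h1, h2⟩ := hx
      have h3 := hEcell s hs x hxs
      have h4 : ‖Du x - gradient I x‖ ^ 2 ≤ η s ^ 2 := by gcongr
      have h5 : (u x - I x) ^ 2 ≤ (D * η s) ^ 2 := by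
        rw [← sq_abs (u x - I x)]
        gcongr
      refine ⟨h4.trans h3, h5.trans ?_⟩
      rw [mul_pow]
      gcongr)
  set q : Finset (Euc d) → ℝ := fun s => volume.real (cell s) *
    (metricTensor (S s)).det ^ ((1 : ℝ) / 2) with hq
  have hq0 : ∀ s ∈ T.elems, 0 ≤ q s := fun s hs => by
    simp only [hq]
    rw [mul_metricTensor_det_rpow hd (hS s hs)]
    have := (hS s hs).det_pos
    positivity
  have hCeq : (0 : ℝ) ≤ Ceq := zero_le_one.trans hM.one_le_Ceq
  have hCali : (0 : ℝ) ≤ Cali := zero_le_one.trans hM.one_le_Cali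
  have hsum := sum_element_bounds_le hd (T.elems_nonempty hΩ) hk0 hCali hCeq hq0
    (W := fun s => volume.real (cell s) * η s ^ 2) (b := CRpK)
    (fun s hs => volume_mul_gradErrorBound_sq_le hd (hS s hs) (hJvol s hs) (hVpos s hs)
      (hM.alignment s hs)) hM.equidistribution hmean
  have hnorm := metric_sum_le_eLpNorm T hd hΩ hS (hHpos.mono fun x hx => hx.1) hCRm hmin hclose
  set r : ℝ := ((d : ℝ) + 2) / d with hr
  set Q := ∑ s ∈ T.elems, q s with hQ
  have hQ0 : 0 ≤ Q := Finset.sum_nonneg hq0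
  have hN : (0 : ℝ) < T.numElems := by exact_mod_cast T.numElems_pos hΩ
  set P : ℝ := √C₀ * Cali ^ (((d : ℝ) + 1) / 2) * Ceq ^ (((d : ℝ) + 2) / (2 * d))
    * (CRp / CRm) * (T.numElems : ℝ) ^ (-(1 : ℝ) / d) with hP
  have hP0 : 0 ≤ P := by positivity
  -- The factor `CRm ^ 2` that comes with the lower bound for the Hessian norm cancels the
  -- denominator of `CRp / CRm`, leaving the quantities in the summed element bounds.
  have hsq : (P * √(CRm ^ 2 * Q ^ r)) ^ 2 = C₀ * Cali ^ (d + 1) * Ceq ^ r * CRp ^ 2 *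
      (T.numElems : ℝ) ^ (-(2 : ℝ) / d) * Q ^ r := by
    have e1 : (Cali ^ (((d : ℝ) + 1) / 2)) ^ 2 = Cali ^ (d + 1) := by
      rw [← Real.rpow_natCast, ← Real.rpow_mul hCali, ← Real.rpow_natCast]
      congr 1
      push_cast
      ring
    have e2 : (Ceq ^ (((d : ℝ) + 2) / (2 * d))) ^ 2 = Ceq ^ r := by
      rw [← Real.rpow_natCast, ← Real.rpow_mul hCeq, hr]
      congr 1
      push_cast
      field_simp
    have e3 : ((T.numElems : ℝ) ^ (-(1 : ℝ) / d)) ^ 2 = (T.numElems : ℝ) ^ (-(2 : ℝ) / d) := by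
      rw [← Real.rpow_natCast, ← Real.rpow_mul hN.le]
      congr 1
      push_cast
      ring
    rw [mul_pow, Real.sq_sqrt (by positivity), hP, mul_pow, mul_pow, mul_pow, mul_pow,
      Real.sq_sqrt hC₀0.le, e1, e2, e3]
    field_simp
  have hmain : ∫ x in Ω, ‖Du x - gradient uh x‖ ^ 2 ≤ (P * √(CRm ^ 2 * Q ^ r)) ^ 2 := by
    rw [hsq]
    refine herrle.trans ((mul_le_mul_of_nonneg_left (hEle.trans hsum) hCq.le).trans ?_)
    set Y : ℝ := Cali ^ (d + 1) * Ceq ^ r * CRp ^ 2 * (T.numElems : ℝ) ^ (-(2 : ℝ) / d) * Q ^ r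
      with hY
    have hY0 : 0 ≤ Y := by positivity
    calc _ = (Cq * k * (d : ℝ) ^ (d + 1)) * Y := by rw [hY, SimplicialMesh.numElems]; ring
      _ ≤ C₀ * Y := by
        gcongr
        rw [hC₀]
        linarith
      _ = _ := by rw [hY]; ring
  refine (eLpNorm_two_le_of_integral_le (by positivity) hint hmain).trans ?_
  rw [ENNReal.ofReal_mul hP0, Real.sqrt_eq_rpow,
    ← ENNReal.ofReal_rpow_of_nonneg (by positivity) (by norm_num)]
  gcongr
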